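/- Let $n\ge 1$, and let $\mathbb{HP}^n$ be the space of non-zero vectors of $\mathbb H^{n+1}$ up to right multiplication by non-zero quaternions. A *linear $\mathbb{HP}^n$-bundle* over $S^2$ is a smooth fibre bundle with fibre $\mathbb{HP}^n$ and structure group $\mathrm{Sp}(n+1)/\{\pm1\}$; isomorphisms and triviality of such bundles are understood over the identity of $S^2$ and with respect to this structure group. Let $L=SU(n+1)\times S^1$ act on $\mathbb{HP}^n$ by $(A,e^{i\theta})\cdot[v]=[e^{i\theta/2}Av]$, let $S^1\subseteq SU(2)$ be the subgroup of diagonal matrices $\mathrm{diag}(\lambda,\bar\lambda)$, so that $L\subseteq G=SU(n+1)\times SU(2)$, and let $M=\mathbb{HP}^n\times_{S^1}SU(2)$ be the quotient of $\mathbb{HP}^n\times SU(2)$ by the $S^1$-action $\lambda\cdot(x,s)=(\lambda x,s\lambda^{-1})$. Then the following hold. 1. The projection $M\to SU(2)/S^1=S^2$ is a non-trivial linear $\mathbb{HP}^n$-bundle, and every non-trivial linear $\mathbb{HP}^n$-bundle over $S^2$ is isomorphic to it. 2. The action $(A,t)\cdot[x,s]=[Ax,ts]$ of $G$ on the closed connected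 manifold $M$ is a cohomogeneity one action: it is smooth and almost effective, and its orbit space is one-dimensional. It is non-primitive: for a group diagram $H\subseteq K^\pm\subseteq G$ of the action, both groups $K^\pm$ are contained in the proper closed subgroup $L\subsetneq G$. 3. The $G$-manifold $M$ is induced from the $L$-manifold $\mathbb{HP}^n$: the map $[x,(A,s)]\mapsto[Ax,s]$ is a $G$-equivariant diffeomorphism $\mathbb{HP}^n\times_LG\cong\mathbb{HP}^n\times_{S^1}SU(2)$. Here $\mathbb{HP}^n\times_LG$ is the quotient of $\mathbb{HP}^n\times G$ by $l\cdot(x,g)=(l\cdot x,gl^{-1})$. A group diagram of a cohomogeneity one action with orbit space an interval consists of the common isotropy group $H$ at the interior points, and the isotropy groups $K^\pm$ at the end points, of a smooth curve over a closed interval that meets every orbit exactly once. -/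

import Mathlib

open scoped Quaternion Manifold ContDiff Matrix Topology
open Set

noncomputable section

namespace CohomOne

/-! ### Quaternionic projective space -/

/-- Quaternionic projective space: nonzero vectors of `ℍ^(n+1)` up to right multiplication by
nonzero quaternions. -/
def HP (n : ℕ) : Type := Projectivization ℍᵐᵒᵖ (Fin (n + 1) → ℍ)

/-- The nonzero vectors of `ℍ^(n+1)`. -/
abbrev NZ (n : ℕ) : Type := {v : Fin (n + 1) → ℍ // v ≠ 0}

/-- The point `[v]`. -/
def HP.mk {n : ℕ} (v : NZ n) : HP n := Projectivization.mk ℍᵐᵒᵖ v.1 v.2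

/-- The quotient topology. -/
instance (n : ℕ) : TopologicalSpace (HP n) := TopologicalSpace.coinduced HP.mk inferInstance

/-- Invertible quaternionic matrices. -/
abbrev GLH (n : ℕ) : Type := (Matrix (Fin (n + 1)) (Fin (n + 1)) ℍ)ˣ

/-- The vector `A v`. -/
def NZ.mulVec {n : ℕ} (A : GLH n) (v : NZ n) : NZ n :=
  ⟨A.1 *ᵥ v.1, fun h => v.2 (by
    have : A⁻¹.1 *ᵥ (A.1 *ᵥ v.1) = v.1 := by
      rw [Matrix.mulVec_mulVec, Units.inv_mul, Matrix.one_mulVec]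
    rw [← this, h, Matrix.mulVec_zero])⟩

theorem HP.mk_eq_iff {n : ℕ} {v w : NZ n} :
    HP.mk v = HP.mk w ↔ ∃ q : ℍ, q ≠ 0 ∧ ∀ i, v.1 i = w.1 i * q := by
  unfold HP.mk
  erw [Projectivization.mk_eq_mk_iff]
  constructor
  · rintro ⟨a, ha⟩
    refine ⟨a.1.unop, by simp, fun i => ?_⟩
    rw [← ha]; rfl
  · rintro ⟨q, hq, h⟩
    refine ⟨Units.mk0 (MulOpposite.op q) (by simpa using hq), ?_⟩
    funext i
    rw [h i]; rfl

/-- A chosen representative. -/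
def HP.rep {n : ℕ} (x : HP n) : NZ n := Quotient.out x

@[simp] theorem HP.mk_rep {n : ℕ} (x : HP n) : HP.mk x.rep = x := Quotient.out_eq x

theorem HP.mk_surjective {n : ℕ} : Function.Surjective (HP.mk (n := n)) :=
  fun x => ⟨x.rep, x.mk_rep⟩

/-- `A • [v] = [A v]`. -/
instance (n : ℕ) : SMul (GLH n) (HP n) := ⟨fun A x => HP.mk (NZ.mulVec A x.rep)⟩

theorem HP.smul_mk {n : ℕ} (A : GLH n) (v : NZ n) : A • HP.mk v = HP.mk (NZ.mulVec A v) := by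
  obtain ⟨q, hq, h⟩ := HP.mk_eq_iff.1 (HP.mk_rep (HP.mk v))
  refine HP.mk_eq_iff.2 ⟨q, hq, fun i => ?_⟩
  simp only [NZ.mulVec, Matrix.mulVec, dotProduct, h, Finset.sum_mul, mul_assoc]

instance (n : ℕ) : MulAction (GLH n) (HP n) where
  one_smul x := by
    obtain ⟨v, rfl⟩ := HP.mk_surjective x
    rw [HP.smul_mk]; congr 1; ext1; simp [NZ.mulVec]
  mul_smul A B x := by
    obtain ⟨v, rfl⟩ := HP.mk_surjective x
    rw [HP.smul_mk, HP.smul_mk, HP.smul_mk]; congr 1; ext1; simp [NZ.mulVec]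

theorem HP.isOpenQuotientMap_mk {n : ℕ} : IsOpenQuotientMap (HP.mk (n := n)) := by
  refine ⟨HP.mk_surjective, continuous_coinduced_rng, fun U hU => ?_⟩
  rw [isOpen_coinduced]
  have : HP.mk ⁻¹' (HP.mk '' U) = ⋃ q : {q : ℍ // q ≠ 0},
      (fun w : NZ n => (⟨fun i => w.1 i * q.1, fun h => w.2 (by
        funext i; simpa [q.2] using congrFun h i)⟩ : NZ n)) ⁻¹' U := by
    ext w
    simp only [mem_preimage, mem_image, mem_iUnion]
    constructor
    · rintro ⟨v, hv, h⟩
      obtain ⟨q, hq, h⟩ := HP.mk_eq_iff.1 h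
      refine ⟨⟨q, hq⟩, ?_⟩
      convert hv using 1
      ext1; funext i; exact (h i).symm
    · rintro ⟨q, hq⟩
      exact ⟨_, hq, HP.mk_eq_iff.2 ⟨q.1, q.2, fun i => rfl⟩⟩
  rw [this]
  refine isOpen_iUnion fun q => hU.preimage ?_
  exact Continuous.subtype_mk (continuous_pi fun i =>
    ((continuous_apply i).comp continuous_subtype_val).mul continuous_const) _

/-! Affine charts of quaternionic projective space -/

/-- The homogeneous vector with `i`-th entry `1` and the other entries `u`. -/
def homog {n : ℕ} (i : Fin (n + 1)) (u : Fin n → ℍ) : NZ n :=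
  ⟨i.insertNth (α := fun _ => ℍ) 1 u, fun h => by simpa using congrFun h i⟩

/-- The affine coordinates `v_k v_i⁻¹`, `k ≠ i`. -/
def affine {n : ℕ} (i : Fin (n + 1)) (v : Fin (n + 1) → ℍ) : Fin n → ℍ :=
  fun k => v (i.succAbove k) * (v i)⁻¹

theorem HP.rep_ne_iff {n : ℕ} (i : Fin (n + 1)) (v : NZ n) :
    (HP.mk v).rep.1 i ≠ 0 ↔ v.1 i ≠ 0 := by
  obtain ⟨q, hq, h⟩ := HP.mk_eq_iff.1 (HP.mk_rep (HP.mk v))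
  simp [h, hq]

theorem HP.affine_rep {n : ℕ} (i : Fin (n + 1)) (v : NZ n) :
    affine i (HP.mk v).rep.1 = affine i v.1 := by
  obtain ⟨q, hq, h⟩ := HP.mk_eq_iff.1 (HP.mk_rep (HP.mk v))
  funext k
  simp only [affine, h, mul_inv_rev]
  rw [mul_assoc, ← mul_assoc q, mul_inv_cancel₀ hq, one_mul]

theorem continuous_homog {n : ℕ} (i : Fin (n + 1)) : Continuous (homog (n := n) i) := by
  refine Continuous.subtype_mk (continuous_pi fun m => ?_) _
  refine Fin.succAboveCases i ?_ (fun k => ?_) m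
  · simp only [Fin.insertNth_apply_same]; fun_prop
  · simp only [Fin.insertNth_apply_succAbove]; fun_prop

theorem continuous_coord {n : ℕ} (i : Fin (n + 1)) : Continuous fun v : NZ n => v.1 i :=
  (continuous_apply i).comp continuous_subtype_val

/-- The affine chart `[v] ↦ (v_k v_i⁻¹)_{k ≠ i}` on `{v_i ≠ 0}`. -/
def HP.chart {n : ℕ} (i : Fin (n + 1)) : OpenPartialHomeomorph (HP n) (Fin n → ℍ) where
  toFun x := affine i x.rep.1
  invFun u := HP.mk (homog i u)
  source := {x | x.rep.1 i ≠ 0}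
  target := univ
  map_source' _ _ := mem_univ _
  map_target' u _ := by
    change (HP.mk (homog i u)).rep.1 i ≠ 0
    rw [HP.rep_ne_iff]; simp [homog]
  left_inv' x hx := by
    obtain ⟨v, rfl⟩ := HP.mk_surjective x
    have hv : v.1 i ≠ 0 := (HP.rep_ne_iff i v).1 hx
    rw [HP.affine_rep]
    refine HP.mk_eq_iff.2 ⟨(v.1 i)⁻¹, inv_ne_zero hv, fun m => ?_⟩
    refine Fin.succAboveCases i ?_ (fun k => ?_) m
    · simp [homog, hv]
    · simp [homog, affine]
  right_inv' u _ := by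
    rw [HP.affine_rep]; funext k; simp [homog, affine]
  open_source := by
    rw [← HP.isOpenQuotientMap_mk.isQuotientMap.isOpen_preimage]
    have : HP.mk ⁻¹' {x : HP n | x.rep.1 i ≠ 0} = {v : NZ n | v.1 i ≠ 0} := by
      ext v; exact HP.rep_ne_iff i v
    rw [this]
    exact isOpen_ne_fun (continuous_coord _) continuous_const
  open_target := isOpen_univ
  continuousOn_toFun := by
    intro x hx
    obtain ⟨v, rfl⟩ := HP.mk_surjective x
    have hv : v.1 i ≠ 0 := (HP.rep_ne_iff i v).1 hx
    refine ContinuousAt.continuousWithinAt ?_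
    rw [← HP.isOpenQuotientMap_mk.continuousAt_comp_iff]
    have : (fun x : HP n => affine i x.rep.1) ∘ HP.mk = fun v : NZ n => affine i v.1 := by
      funext v; exact HP.affine_rep i v
    rw [this]
    refine continuousAt_pi.2 fun k => ?_
    refine ContinuousAt.mul (continuous_coord _).continuousAt
      (ContinuousAt.inv₀ (continuous_coord _).continuousAt hv)
  continuousOn_invFun :=
    (HP.isOpenQuotientMap_mk.continuous.comp (continuous_homog i)).continuousOn

theorem NZ.exists_ne {n : ℕ} (v : NZ n) : ∃ i, v.1 i ≠ 0 := Function.ne_iff.1 v.2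

instance (n : ℕ) : ChartedSpace (Fin n → ℍ) (HP n) where
  atlas := range HP.chart
  chartAt x := HP.chart x.rep.exists_ne.choose
  mem_chart_source x := x.rep.exists_ne.choose_spec
  chart_mem_atlas _ := mem_range_self _

theorem contDiff_homog {n : ℕ} (i m : Fin (n + 1)) :
    ContDiff ℝ ∞ fun u : Fin n → ℍ => (homog i u).1 m := by
  refine Fin.succAboveCases i ?_ (fun k => ?_) m
  · simp only [homog, Fin.insertNth_apply_same]; fun_prop
  · simp only [homog, Fin.insertNth_apply_succAbove]; fun_prop

theorem contDiffAt_quatInv {q : ℍ} (hq : q ≠ 0) : ContDiffAt ℝ ∞ (fun p : ℍ => p⁻¹) q := by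
  have := contDiffAt_ringInverse ℝ (n := ∞) (Units.mk0 q hq)
  simpa [Ring.inverse_eq_inv'] using this

theorem contDiffAt_affine {n : ℕ} (i : Fin (n + 1)) {v : Fin (n + 1) → ℍ} (hv : v i ≠ 0) :
    ContDiffAt ℝ ∞ (affine i) v := by
  refine contDiffAt_pi.2 fun k => ?_
  exact ContDiffAt.mul (by fun_prop)
    ((contDiffAt_quatInv hv).comp v (f := fun v : Fin (n + 1) → ℍ => v i) (by fun_prop))

instance (n : ℕ) : IsManifold 𝓘(ℝ, Fin n → ℍ) ∞ (HP n) := by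
  refine isManifold_of_contDiffOn _ _ _ ?_
  rintro _ _ ⟨i, rfl⟩ ⟨j, rfl⟩
  intro u hu
  have hu' : (homog i u).1 j ≠ 0 := by
    have : (HP.mk (homog i u)).rep.1 j ≠ 0 := by
      simpa [HP.chart] using hu
    exact (HP.rep_ne_iff j _).1 this
  refine ContDiffAt.contDiffWithinAt ?_
  have : (𝓘(ℝ, Fin n → ℍ) ∘ (HP.chart i).symm ≫ₕ HP.chart j ∘ 𝓘(ℝ, Fin n → ℍ).symm) =
      fun u => affine j (homog i u).1 := by
    funext u
    exact HP.affine_rep j (homog i u)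
  rw [this]
  exact (contDiffAt_affine j hu').comp u
    (f := fun u => (homog i u).1) (contDiffAt_pi.2 fun m => (contDiff_homog i m).contDiffAt)

/-! ### The groups -/

/-- The compact symplectic group `Sp(n+1)` of unitary quaternionic matrices. -/
abbrev Sp (n : ℕ) : Type := unitary (Matrix (Fin (n + 1)) (Fin (n + 1)) ℍ)

/-- The special unitary group `SU(m)`. -/
abbrev SU (m : ℕ) : Type := Matrix.specialUnitaryGroup (Fin m) ℂ

instance (n : ℕ) : MulAction (Sp n) (HP n) := MulAction.compHom _ Unitary.toUnits

/-- A complex special unitary matrix, regarded as an invertible quaternionic matrix. -/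
def SU.toGLH {n : ℕ} : SU (n + 1) →* GLH n :=
  MonoidHom.toHomUnits
    ((Quaternion.ofComplex.toRingHom.mapMatrix :
        Matrix (Fin (n + 1)) (Fin (n + 1)) ℂ →+* _).toMonoidHom.comp (Submonoid.subtype _))

/-- `A • [v] = [A v]` for `A ∈ SU(n+1)`. -/
instance (n : ℕ) : MulAction (SU (n + 1)) (HP n) := MulAction.compHom _ SU.toGLH

/-- Left multiplication by a unit complex number, as an invertible quaternionic matrix. -/
def circleToGLH {n : ℕ} : Circle →* GLH n :=
  MonoidHom.toHomUnits
    ((Matrix.scalar (Fin (n + 1)) : ℍ →+* _).toMonoidHom.comp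
      (Quaternion.ofComplex.toRingHom.toMonoidHom.comp Circle.coeHom))

/-- A square root `e^{iθ/2}` of `e^{iθ}`, `-π < θ ≤ π`. -/
def halfAngle (z : Circle) : Circle := Circle.exp (Complex.arg z / 2)

theorem halfAngle_mul_self (z : Circle) : halfAngle z * halfAngle z = z := by
  rw [halfAngle, ← Circle.exp_add, add_halves, Circle.exp_arg]

theorem circleToGLH_mulVec {n : ℕ} (μ : Circle) (v : NZ n) (i : Fin (n + 1)) :
    (NZ.mulVec (circleToGLH μ) v).1 i = ((μ : ℂ) : ℍ) * v.1 i := by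
  simp only [NZ.mulVec, circleToGLH]
  exact Matrix.mulVec_diagonal _ _ _

/-- Only the square of `μ` matters for the action of `μ`, as `-1` acts trivially. -/
theorem circleToGLH_smul_congr {n : ℕ} {μ ν : Circle} (h : μ * μ = ν * ν) (x : HP n) :
    (circleToGLH μ : GLH n) • x = (circleToGLH ν : GLH n) • x := by
  obtain ⟨v, rfl⟩ := HP.mk_surjective x
  rw [HP.smul_mk, HP.smul_mk]
  have h' : (μ : ℂ) * μ = ν * ν := by exact_mod_cast congrArg (fun z : Circle => (z : ℂ)) h
  rcases mul_self_eq_mul_self_iff.1 h' with h | h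
  · have : μ = ν := Circle.ext h
    rw [this]
  · refine HP.mk_eq_iff.2 ⟨-1, by simp, fun i => ?_⟩
    rw [circleToGLH_mulVec, circleToGLH_mulVec, h]
    have : ((-(ν : ℂ) : ℂ) : ℍ) = -((ν : ℂ) : ℍ) := map_neg Quaternion.ofComplex _
    rw [this]; simp

/-- The circle action `e^{iθ} • [v] = [e^{iθ/2} v]`. -/
instance (n : ℕ) : SMul Circle (HP n) := ⟨fun z x => (circleToGLH (halfAngle z) : GLH n) • x⟩

theorem circle_smul_eq {n : ℕ} {z μ : Circle} (h : μ * μ = z) (x : HP n) :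
    z • x = (circleToGLH μ : GLH n) • x :=
  circleToGLH_smul_congr (by rw [halfAngle_mul_self, h]) x

instance (n : ℕ) : MulAction Circle (HP n) where
  one_smul x := by rw [circle_smul_eq (μ := 1) (by simp), map_one, one_smul]
  mul_smul z w x := by
    rw [circle_smul_eq (z := z * w) (μ := halfAngle z * halfAngle w), map_mul, mul_smul]
    · rfl
    · rw [mul_mul_mul_comm, halfAngle_mul_self, halfAngle_mul_self]

theorem SU.smul_circle_smul {n : ℕ} (A : SU (n + 1)) (z : Circle) (x : HP n) :
    A • z • x = z • A • x := by
  change SU.toGLH A • (circleToGLH (halfAngle z) : GLH n) • x =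
    (circleToGLH (halfAngle z) : GLH n) • SU.toGLH A • x
  rw [← mul_smul, ← mul_smul]
  congr 1
  ext1
  change (SU.toGLH A).1 * Matrix.scalar _ ((halfAngle z : ℂ) : ℍ) =
    Matrix.scalar _ ((halfAngle z : ℂ) : ℍ) * (SU.toGLH A).1
  ext1 i j
  simp only [Matrix.scalar_apply, Matrix.mul_diagonal, Matrix.diagonal_mul]
  change (Quaternion.ofComplex (A.1 i j)) * Quaternion.ofComplex (halfAngle z : ℂ) =
    Quaternion.ofComplex (halfAngle z : ℂ) * Quaternion.ofComplex (A.1 i j)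
  rw [← map_mul, ← map_mul, mul_comm]

/-- The inclusion `S¹ ⊆ SU(2)`, `λ ↦ diag(λ, λ⁻¹)`. -/
def torus : Circle →* SU 2 where
  toFun z := ⟨Matrix.diagonal ![(z : ℂ), ((z⁻¹ : Circle) : ℂ)], by
    rw [Matrix.mem_specialUnitaryGroup_iff]
    refine ⟨?_, by simp⟩
    rw [Matrix.mem_unitaryGroup_iff, Matrix.star_eq_conjTranspose, Matrix.diagonal_conjTranspose,
      Matrix.diagonal_mul_diagonal, ← Matrix.diagonal_one]
    congr 1; funext i
    fin_cases i <;> simp [← Circle.coe_inv_eq_conj]⟩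
  map_one' := by
    ext1; ext i j; fin_cases i <;> fin_cases j <;> simp
  map_mul' z w := by
    ext1; ext i j; fin_cases i <;> fin_cases j <;> simp [mul_comm]

/-- `S¹` acts on `SU(2)` by `λ • s = s λ⁻¹`. -/
instance : MulAction Circle (SU 2) where
  smul z s := s * (torus z)⁻¹
  one_smul s := by change s * (torus 1)⁻¹ = s; simp
  mul_smul z w s := by
    change s * (torus (z * w))⁻¹ = s * (torus w)⁻¹ * (torus z)⁻¹
    simp [mul_assoc]

theorem circle_smul_SU (z : Circle) (s : SU 2) : z • s = s * (torus z)⁻¹ := rfl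

/-- `L = SU(n+1) × S¹`. -/
abbrev L (n : ℕ) : Type := SU (n + 1) × Circle

/-- `G = SU(n+1) × SU(2)`. -/
abbrev G (n : ℕ) : Type := SU (n + 1) × SU 2

/-- The natural inclusion `L ⊆ G`. -/
def inclL (n : ℕ) : L n →* G n := MonoidHom.prodMap (MonoidHom.id _) torus

/-- The action `(A, e^{iθ}) • [v] = [e^{iθ/2} A v]` of `L` on `HP^n`. -/
instance (n : ℕ) : MulAction (L n) (HP n) where
  smul l x := l.2 • l.1 • x
  one_smul x := by change (1 : Circle) • (1 : SU (n + 1)) • x = x; simp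
  mul_smul l m x := by
    change (l.2 * m.2) • (l.1 * m.1) • x = l.2 • l.1 • m.2 • m.1 • x
    rw [mul_smul, mul_smul, SU.smul_circle_smul]

/-! ### The space `HP^n ×_{S¹} SU(2)` -/

/-- The quotient of `HP^n × SU(2)` by the circle action `λ • (x, s) = (λ • x, s λ⁻¹)`. -/
def Tot (n : ℕ) : Type := MulAction.orbitRel.Quotient Circle (HP n × SU 2)

/-- The point `[x, s]`. -/
def Tot.mk {n : ℕ} (p : HP n × SU 2) : Tot n := Quotient.mk'' p

/-- The quotient topology. -/
instance (n : ℕ) : TopologicalSpace (Tot n) := TopologicalSpace.coinduced Tot.mk inferInstance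

theorem Tot.mk_eq_iff {n : ℕ} {p q : HP n × SU 2} :
    Tot.mk p = Tot.mk q ↔ ∃ z : Circle, z • q = p :=
  Quotient.eq''.trans MulAction.orbitRel_apply

theorem Tot.mk_surjective {n : ℕ} : Function.Surjective (Tot.mk (n := n)) :=
  Quotient.mk''_surjective

/-- `(A, t) • [x, s] = [A x, t s]`. -/
instance (n : ℕ) : MulAction (G n) (Tot n) where
  smul g := Quotient.map' (fun p => (g.1 • p.1, g.2 * p.2)) (by
    rintro p q h
    obtain ⟨z, rfl⟩ := MulAction.orbitRel_apply.1 h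
    refine MulAction.orbitRel_apply.2 ⟨z, ?_⟩
    refine Prod.ext (SU.smul_circle_smul _ _ _).symm ?_
    change g.2 * q.2 * _ = g.2 * (q.2 * _)
    rw [mul_assoc])
  one_smul e := by
    obtain ⟨p, rfl⟩ := Tot.mk_surjective e
    change Tot.mk ((1 : SU (n + 1)) • p.1, (1 : SU 2) * p.2) = _
    simp
  mul_smul g h e := by
    obtain ⟨p, rfl⟩ := Tot.mk_surjective e
    change Tot.mk ((g.1 * h.1) • p.1, g.2 * h.2 * p.2) =
      Tot.mk (g.1 • h.1 • p.1, g.2 * (h.2 * p.2))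
    rw [mul_smul, mul_assoc]

theorem Tot.smul_mk {n : ℕ} (g : G n) (x : HP n) (s : SU 2) :
    g • Tot.mk (x, s) = Tot.mk (g.1 • x, g.2 * s) := rfl

/-! Auxiliary facts on the circle action -/

/-- For `q = a + b j` with `a, b` complex, this is `a + c b j`. -/
def rot (c : ℂ) (q : ℍ) : ℍ :=
  (1 / 2 : ℝ) • ((q - ((Complex.I : ℂ) : ℍ) * q * ((Complex.I : ℂ) : ℍ)) +
    (c : ℍ) * (q + ((Complex.I : ℂ) : ℍ) * q * ((Complex.I : ℂ) : ℍ)))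

theorem contDiff_coeComplex : ContDiff ℝ ∞ (fun c : ℂ => (c : ℍ)) :=
  (LinearMap.toContinuousLinearMap Quaternion.ofComplex.toLinearMap).contDiff

theorem contDiff_rot : ContDiff ℝ ∞ fun p : ℂ × ℍ => rot p.1 p.2 := by
  unfold rot
  have h : ContDiff ℝ ∞ fun p : ℂ × ℍ => (p.1 : ℍ) := contDiff_coeComplex.comp contDiff_fst
  fun_prop

theorem mul_eq_rot_mul (μ : Circle) (q : ℍ) :
    ((μ : ℂ) : ℍ) * q = rot ((μ : ℂ) * μ) q * ((μ : ℂ) : ℍ) := by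
  have h : (μ : ℂ).re * (μ : ℂ).re + (μ : ℂ).im * (μ : ℂ).im = 1 := by
    rw [← Complex.normSq_apply]; exact Circle.normSq_coe μ
  generalize (μ : ℂ) = m at h
  ext
  · simp [rot]; ring
  · simp [rot]; ring
  · simp [rot]; linear_combination (-m.re * q.imJ + m.im * q.imK) * h
  · simp [rot]; linear_combination (-m.re * q.imK - m.im * q.imJ) * h

theorem rot_ne_zero (z : Circle) {q : ℍ} (hq : q ≠ 0) : rot z q ≠ 0 := by
  intro h
  have := mul_eq_rot_mul (halfAngle z) q
  rw [← Circle.coe_mul, halfAngle_mul_self, h, zero_mul] at this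
  rcases mul_eq_zero.1 this with h | h
  · exact Circle.coe_ne_zero _ (Quaternion.ofComplex.toRingHom.injective
      (h.trans (map_zero Quaternion.ofComplex).symm))
  · exact hq h

/-- Entrywise `rot`. -/
def NZ.rot {n : ℕ} (z : Circle) (v : NZ n) : NZ n :=
  ⟨fun i => CohomOne.rot z (v.1 i), fun h => by
    obtain ⟨i, hi⟩ := v.exists_ne
    exact rot_ne_zero z hi (congrFun h i)⟩

theorem circle_smul_mk {n : ℕ} (z : Circle) (v : NZ n) :
    z • HP.mk v = HP.mk (NZ.rot z v) := by
  change (circleToGLH (halfAngle z) : GLH n) • HP.mk v = _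
  rw [HP.smul_mk]
  refine HP.mk_eq_iff.2 ⟨((halfAngle z : ℂ) : ℍ), fun h => ?_, fun i => ?_⟩
  · exact Circle.coe_ne_zero _ (Quaternion.ofComplex.toRingHom.injective
      (h.trans (map_zero Quaternion.ofComplex).symm))
  · rw [circleToGLH_mulVec, mul_eq_rot_mul, ← Circle.coe_mul, halfAngle_mul_self]; rfl

instance (n : ℕ) : ContinuousSMul Circle (HP n) where
  continuous_smul := by
    have hq : IsOpenQuotientMap (Prod.map id HP.mk : Circle × NZ n → Circle × HP n) :=
      IsOpenQuotientMap.id.prodMap HP.isOpenQuotientMap_mk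
    rw [hq.isQuotientMap.continuous_iff]
    have : (fun p : Circle × HP n => p.1 • p.2) ∘ Prod.map id HP.mk =
        fun p : Circle × NZ n => HP.mk (NZ.rot p.1 p.2) := by
      funext p; exact circle_smul_mk _ _
    rw [this]
    refine HP.isOpenQuotientMap_mk.continuous.comp (Continuous.subtype_mk ?_ _)
    refine continuous_pi fun i => ?_
    exact contDiff_rot.continuous.comp ((continuous_subtype_val.comp continuous_fst).prodMk
      ((continuous_coord i).comp continuous_snd))

instance : ContinuousConstSMul Circle (SU 2) where
  continuous_const_smul z := by
    have : Continuous fun s : SU 2 => (s.1 * ((torus z)⁻¹).1) := by fun_prop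
    exact Continuous.subtype_mk this _

theorem Tot.isOpenQuotientMap_mk {n : ℕ} : IsOpenQuotientMap (Tot.mk (n := n)) :=
  MulAction.isOpenQuotientMap_quotientMk

/-! Elements of `SU(2)` are determined by their first column -/

theorem SU2.entries (s : SU 2) :
    s.1 0 1 = -star (s.1 1 0) ∧ s.1 1 1 = star (s.1 0 0) := by
  have h1 : star s.1 * s.1 = 1 := Matrix.mem_unitaryGroup_iff'.1
    (Matrix.mem_specialUnitaryGroup_iff.1 s.2).1
  have hd : s.1.det = 1 := (Matrix.mem_specialUnitaryGroup_iff.1 s.2).2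
  have h2 : s.1 * s.1.adjugate = 1 := by rw [Matrix.mul_adjugate, hd, one_smul]
  have h3 : star s.1 = s.1.adjugate := left_inv_eq_right_inv h1 h2
  rw [Matrix.adjugate_fin_two] at h3
  have a := congrFun (congrFun h3 0) 0
  have b := congrFun (congrFun h3 0) 1
  simp [Matrix.star_apply] at a b
  refine ⟨?_, a.symm⟩
  rw [Complex.star_def, b, neg_neg]

theorem SU2.normSq_col (s : SU 2) : Complex.normSq (s.1 0 0) + Complex.normSq (s.1 1 0) = 1 := by
  have hd : s.1.det = 1 := (Matrix.mem_specialUnitaryGroup_iff.1 s.2).2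
  rw [Matrix.det_fin_two, (SU2.entries s).1, (SU2.entries s).2] at hd
  have : ((Complex.normSq (s.1 0 0) + Complex.normSq (s.1 1 0) : ℝ) : ℂ) = 1 := by
    rw [← hd]; push_cast
    rw [Complex.normSq_eq_conj_mul_self, Complex.normSq_eq_conj_mul_self]
    simp only [Complex.star_def]; ring
  exact_mod_cast this

theorem SU2.ext_col {s t : SU 2} (h : ∀ i, s.1 i 0 = t.1 i 0) : s = t := by
  ext1; ext i j
  fin_cases j
  · exact h i
  · fin_cases i
    · simp [(SU2.entries s).1, (SU2.entries t).1, h]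
    · simp [(SU2.entries s).2, (SU2.entries t).2, h]

/-- The element of `SU(2)` with the given first column. -/
def SU2.ofCol (c : Fin 2 → ℂ) (h : Complex.normSq (c 0) + Complex.normSq (c 1) = 1) : SU 2 :=
  ⟨!![c 0, -star (c 1); c 1, star (c 0)], by
    have h' : c 0 * star (c 0) + c 1 * star (c 1) = 1 := by
      rw [Complex.star_def, Complex.mul_conj, Complex.mul_conj]; exact_mod_cast h
    rw [Matrix.mem_specialUnitaryGroup_iff, Matrix.mem_unitaryGroup_iff]
    refine ⟨?_, ?_⟩
    · ext i j
      fin_cases i <;> fin_cases j <;>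
        simp [Matrix.mul_apply, Matrix.star_apply, Fin.sum_univ_two] <;>
        simp only [← Complex.star_def]
      · linear_combination h'
      · ring
      · ring
      · linear_combination h'
    · rw [Matrix.det_fin_two]; simp
      simp only [← Complex.star_def]; linear_combination h'⟩

theorem SU2.ofCol_apply (c : Fin 2 → ℂ) (h) (i : Fin 2) : (SU2.ofCol c h).1 i 0 = c i := by
  fin_cases i <;> rfl

/-- The unit vector proportional to the vector with `k`-th entry `1` and other entry `ζ`. -/
def unitCol (k : Fin 2) (ζ : ℂ) : Fin 2 → ℂ :=
  fun i => (if i = k then 1 else ζ) / (Real.sqrt (1 + Complex.normSq ζ) : ℝ)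

theorem unitCol_normSq (k : Fin 2) (ζ : ℂ) :
    Complex.normSq (unitCol k ζ 0) + Complex.normSq (unitCol k ζ 1) = 1 := by
  have h0 : 0 < 1 + Complex.normSq ζ := by have := Complex.normSq_nonneg ζ; linarith
  have h : ∀ i, Complex.normSq (unitCol k ζ i) =
      Complex.normSq (if i = k then 1 else ζ) / (1 + Complex.normSq ζ) := by
    intro i
    rw [unitCol, map_div₀, Complex.normSq_ofReal, Real.mul_self_sqrt h0.le]
  rw [h, h]
  fin_cases k
  · simp; field_simp
  · simp; field_simp; ring

/-- A section of `SU(2) → SU(2)/S¹` over an affine chart. -/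
def sec (k : Fin 2) (ζ : ℂ) : SU 2 := SU2.ofCol (unitCol k ζ) (unitCol_normSq k ζ)

theorem sec_apply (k : Fin 2) (ζ : ℂ) (i : Fin 2) : (sec k ζ).1 i 0 = unitCol k ζ i :=
  SU2.ofCol_apply _ _ _

/-- The phase `z / |z|`. -/
def phase (z : ℂ) : Circle := Circle.exp z.arg

theorem norm_mul_phase (z : ℂ) : (‖z‖ : ℂ) * (phase z : ℂ) = z := by
  rw [phase, Circle.coe_exp]; exact Complex.norm_mul_exp_arg_mul_I z

theorem coe_phase {z : ℂ} (hz : z ≠ 0) : (phase z : ℂ) = z / ‖z‖ := by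
  have : (‖z‖ : ℂ) ≠ 0 := by simpa using hz
  rw [eq_div_iff this, mul_comm, norm_mul_phase]

theorem phase_mul {z : ℂ} (hz : z ≠ 0) (u : Circle) : phase (z * u) = phase z * u := by
  ext1
  rw [coe_phase (mul_ne_zero hz (Circle.coe_ne_zero u)), Circle.coe_mul, coe_phase hz]
  rw [norm_mul, Circle.norm_coe, mul_one]; ring

theorem phase_ofReal_pos {r : ℝ} (hr : 0 < r) : phase r = 1 := by
  rw [phase, Complex.arg_ofReal_of_nonneg hr.le, Circle.exp_zero]

theorem continuousAt_phase {z : ℂ} (hz : z ≠ 0) : ContinuousAt phase z := by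
  have : ContinuousAt (fun z : ℂ => z / (‖z‖ : ℂ)) z := by
    refine ContinuousAt.div continuousAt_id (by fun_prop) (by simpa using hz)
  refine (Topology.IsEmbedding.subtypeVal.continuousAt_iff).2 (this.congr ?_)
  filter_upwards [isOpen_ne.mem_nhds hz] with w hw
  exact (coe_phase hw).symm

theorem torus_inv_apply (s : SU 2) (z : Circle) (i : Fin 2) :
    (s * (torus z)⁻¹).1 i 0 = s.1 i 0 * ((z⁻¹ : Circle) : ℂ) := by
  rw [← map_inv]
  change (s.1 * Matrix.diagonal ![((z⁻¹ : Circle) : ℂ), _] : Matrix (Fin 2) (Fin 2) ℂ) i 0 = _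
  rw [Matrix.mul_diagonal]; rfl

/-! Smooth structure on `HP^n ×_{S¹} SU(2)` -/

/-- A chosen representative. -/
def Tot.rep {n : ℕ} (e : Tot n) : HP n × SU 2 := Quotient.out e

theorem Tot.mk_rep {n : ℕ} (e : Tot n) : Tot.mk e.rep = e := Quotient.out_eq e

/-- Local trivialization in coordinates: on `{s_{k1} ≠ 0}` it sends `[x, s]` to the point `y` and
the ratio `ζ` of the entries of the first column of `s` such that `[x, s] = [y, s']`, where `s'` has
positive entry `s'_{k1}`. -/
def trivCoord {n : ℕ} (k : Fin 2) (p : HP n × SU 2) : HP n × ℂ :=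
  (phase (p.2.1 k 0) • p.1, p.2.1 (k + 1) 0 / p.2.1 k 0)

theorem circle_smul_entry {n : ℕ} (z : Circle) (p : HP n × SU 2) (k : Fin 2) :
    (z • p).2.1 k 0 = p.2.1 k 0 * ((z⁻¹ : Circle) : ℂ) := torus_inv_apply _ _ _

theorem Tot.rep_ne_iff {n : ℕ} (k : Fin 2) (p : HP n × SU 2) :
    (Tot.mk p).rep.2.1 k 0 ≠ 0 ↔ p.2.1 k 0 ≠ 0 := by
  obtain ⟨z, hz⟩ := Tot.mk_eq_iff.1 (Tot.mk_rep (Tot.mk p))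
  rw [← hz, circle_smul_entry]
  simp

theorem Tot.trivCoord_rep {n : ℕ} (k : Fin 2) (p : HP n × SU 2) (hp : p.2.1 k 0 ≠ 0) :
    trivCoord k (Tot.mk p).rep = trivCoord k p := by
  obtain ⟨z, hz⟩ := Tot.mk_eq_iff.1 (Tot.mk_rep (Tot.mk p))
  rw [← hz]
  unfold trivCoord
  rw [circle_smul_entry, circle_smul_entry, phase_mul hp]
  refine Prod.ext ?_ ?_
  · change (phase (p.2.1 k 0) * z⁻¹) • z • p.1 = phase (p.2.1 k 0) • p.1
    rw [← mul_smul, inv_mul_cancel_right]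
  · exact mul_div_mul_right _ _ (Circle.coe_ne_zero _)

theorem continuous_entry (k : Fin 2) : Continuous fun s : SU 2 => s.1 k 0 :=
  continuous_subtype_val.matrix_elem k 0

theorem sqrt_pos (ζ : ℂ) : 0 < Real.sqrt (1 + Complex.normSq ζ) :=
  Real.sqrt_pos.2 (by have := Complex.normSq_nonneg ζ; linarith)

theorem sec_self (k : Fin 2) (ζ : ℂ) :
    (sec k ζ).1 k 0 = (((Real.sqrt (1 + Complex.normSq ζ))⁻¹ : ℝ) : ℂ) := by
  rw [sec_apply, unitCol, if_pos rfl]; push_cast; simp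

theorem sec_other (k : Fin 2) (ζ : ℂ) :
    (sec k ζ).1 (k + 1) 0 = ζ / ((Real.sqrt (1 + Complex.normSq ζ) : ℝ) : ℂ) := by
  rw [sec_apply, unitCol, if_neg (by fin_cases k <;> decide)]

theorem sec_self_ne (k : Fin 2) (ζ : ℂ) : (sec k ζ).1 k 0 ≠ 0 := by
  rw [sec_self]; exact_mod_cast (inv_pos.2 (sqrt_pos ζ)).ne'

theorem trivCoord_sec {n : ℕ} (k : Fin 2) (x : HP n) (ζ : ℂ) :
    trivCoord k (x, sec k ζ) = (x, ζ) := by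
  unfold trivCoord
  refine Prod.ext ?_ ?_
  · change phase ((sec k ζ).1 k 0) • x = x
    rw [sec_self, phase_ofReal_pos (inv_pos.2 (sqrt_pos ζ)), one_smul]
  · change (sec k ζ).1 (k + 1) 0 / (sec k ζ).1 k 0 = ζ
    rw [sec_self, sec_other]
    have : ((Real.sqrt (1 + Complex.normSq ζ) : ℝ) : ℂ) ≠ 0 := by exact_mod_cast (sqrt_pos ζ).ne'
    push_cast; field_simp

theorem mk_sec_trivCoord {n : ℕ} (k : Fin 2) (p : HP n × SU 2) (hp : p.2.1 k 0 ≠ 0) :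
    Tot.mk ((trivCoord k p).1, sec k (trivCoord k p).2) = Tot.mk p := by
  refine Tot.mk_eq_iff.2 ⟨phase (p.2.1 k 0), Prod.ext rfl (SU2.ext_col fun i => ?_)⟩
  rw [circle_smul_entry]
  have hn : (0 : ℝ) < ‖p.2.1 k 0‖ := by simpa using hp
  have hs : Complex.normSq (p.2.1 k 0) + Complex.normSq (p.2.1 (k + 1) 0) = 1 := by
    have := SU2.normSq_col p.2
    fin_cases k
    · exact this
    · rw [add_comm]; exact this
  have hN : Real.sqrt (1 + Complex.normSq (p.2.1 (k + 1) 0 / p.2.1 k 0)) = ‖p.2.1 k 0‖⁻¹ := by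
    rw [map_div₀]
    have h0 : Complex.normSq (p.2.1 k 0) ≠ 0 := by simpa using hp
    have : 1 + Complex.normSq (p.2.1 (k + 1) 0) / Complex.normSq (p.2.1 k 0) =
        (‖p.2.1 k 0‖⁻¹) ^ 2 := by
      rw [inv_pow, ← Complex.normSq_eq_norm_sq]; field_simp; exact hs
    rw [this, Real.sqrt_sq (inv_nonneg.2 hn.le)]
  have hph := coe_phase hp
  have hnc : ((‖p.2.1 k 0‖ : ℝ) : ℂ) ≠ 0 := by exact_mod_cast hn.ne'
  have hi : i = k ∨ i = k + 1 := by fin_cases i <;> fin_cases k <;> decide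
  rcases hi with rfl | rfl
  · change _ = (sec i (p.2.1 (i + 1) 0 / p.2.1 i 0)).1 i 0
    rw [sec_self, hN, Circle.coe_inv, hph]
    push_cast; field_simp
  · change _ = (sec k (p.2.1 (k + 1) 0 / p.2.1 k 0)).1 (k + 1) 0
    rw [sec_other, hN, Circle.coe_inv, hph]
    push_cast; field_simp

theorem continuous_sec (k : Fin 2) : Continuous (sec k) := by
  have hc : ∀ i, Continuous fun ζ => unitCol k ζ i := by
    intro i
    unfold unitCol
    refine Continuous.div ?_ ?_ fun ζ => by exact_mod_cast (sqrt_pos ζ).ne'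
    · exact continuous_const.if_const _ continuous_id
    · exact Complex.continuous_ofReal.comp (Real.continuous_sqrt.comp
        (continuous_const.add Complex.continuous_normSq))
  refine Continuous.subtype_mk (continuous_matrix fun i j => ?_) _
  fin_cases i <;> fin_cases j
  · exact hc 0
  · exact (continuous_star.comp (hc 1)).neg
  · exact hc 1
  · exact continuous_star.comp (hc 0)

/-- The local trivialization over `{s_{k1} ≠ 0}`. -/
def Tot.triv {n : ℕ} (k : Fin 2) : OpenPartialHomeomorph (Tot n) (HP n × ℂ) where
  toFun e := trivCoord k e.rep
  invFun y := Tot.mk (y.1, sec k y.2)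
  source := {e | e.rep.2.1 k 0 ≠ 0}
  target := univ
  map_source' _ _ := mem_univ _
  map_target' y _ := by
    change (Tot.mk (y.1, sec k y.2)).rep.2.1 k 0 ≠ 0
    rw [Tot.rep_ne_iff]; exact sec_self_ne k y.2
  left_inv' e he := by
    have := mk_sec_trivCoord k e.rep he
    rwa [Tot.mk_rep] at this
  right_inv' y _ := by
    rw [Tot.trivCoord_rep k _ (sec_self_ne k y.2), trivCoord_sec]
  open_source := by
    rw [← Tot.isOpenQuotientMap_mk.isQuotientMap.isOpen_preimage]
    have : Tot.mk ⁻¹' {e : Tot n | e.rep.2.1 k 0 ≠ 0} = {p | p.2.1 k 0 ≠ 0} := by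
      ext p; exact Tot.rep_ne_iff k p
    rw [this]
    exact isOpen_ne_fun ((continuous_entry k).comp continuous_snd) continuous_const
  open_target := isOpen_univ
  continuousOn_toFun := by
    intro e he
    obtain ⟨p, rfl⟩ := Tot.mk_surjective e
    have hp : p.2.1 k 0 ≠ 0 := (Tot.rep_ne_iff k p).1 he
    refine ContinuousAt.continuousWithinAt ?_
    rw [← Tot.isOpenQuotientMap_mk.continuousAt_comp_iff]
    have hc : ∀ i, Continuous fun p : HP n × SU 2 => p.2.1 i 0 :=
      fun i => (continuous_entry i).comp continuous_snd
    have h1 : ContinuousAt (trivCoord (n := n) k) p := by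
      have h2 : ContinuousAt (fun p : HP n × SU 2 => phase (p.2.1 k 0)) p :=
        ContinuousAt.comp (f := fun p : HP n × SU 2 => p.2.1 k 0)
          (continuousAt_phase hp) (hc k).continuousAt
      have h3 : ContinuousAt (fun p : HP n × SU 2 => phase (p.2.1 k 0) • p.1) p :=
        h2.smul continuousAt_fst
      exact h3.prodMk ((hc _).continuousAt.div (hc _).continuousAt hp)
    refine h1.congr ?_
    filter_upwards [(isOpen_ne_fun (hc k) continuous_const).mem_nhds hp] with q hq
    exact (Tot.trivCoord_rep k q hq).symm
  continuousOn_invFun := by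
    refine Continuous.continuousOn (Tot.isOpenQuotientMap_mk.continuous.comp ?_)
    exact continuous_fst.prodMk ((continuous_sec k).comp continuous_snd)

theorem SU2.exists_ne (s : SU 2) : ∃ k, s.1 k 0 ≠ 0 := by
  by_contra! h
  have := SU2.normSq_col s
  simp [h] at this

/-- `HP^n ×_{S¹} SU(2)` is locally `HP^n × ℂ`. -/
@[reducible]
def Tot.chartedTriv (n : ℕ) : ChartedSpace (HP n × ℂ) (Tot n) where
  atlas := range Tot.triv
  chartAt e := Tot.triv (SU2.exists_ne e.rep.2).choose
  mem_chart_source e := (SU2.exists_ne e.rep.2).choose_spec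
  chart_mem_atlas _ := mem_range_self _

/-- The charts are the local trivializations followed by affine charts of `HP^n`. -/
instance (n : ℕ) : ChartedSpace (ModelProd (Fin n → ℍ) ℂ) (Tot n) :=
  letI := Tot.chartedTriv n
  ChartedSpace.comp _ (HP n × ℂ) _

/-- The model of `HP^n`. -/
abbrev modelHP (n : ℕ) : ModelWithCorners ℝ (Fin n → ℍ) (Fin n → ℍ) := 𝓘(ℝ, Fin n → ℍ)

/-- The model of `HP^n ×_{S¹} SU(2)`. -/
abbrev modelTot (n : ℕ) :
    ModelWithCorners ℝ ((Fin n → ℍ) × ℂ) (ModelProd (Fin n → ℍ) ℂ) := (modelHP n).prod 𝓘(ℝ, ℂ)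

/-- The chart of `HP^n ×_{S¹} SU(2)` with indices `k`, `i`. -/
def Tot.chart {n : ℕ} (k : Fin 2) (i : Fin (n + 1)) :
    OpenPartialHomeomorph (Tot n) (ModelProd (Fin n → ℍ) ℂ) :=
  (Tot.triv k).trans ((HP.chart i).prod (OpenPartialHomeomorph.refl ℂ))

theorem Tot.mem_atlas {n : ℕ} {e : OpenPartialHomeomorph (Tot n) (ModelProd (Fin n → ℍ) ℂ)}
    (he : e ∈ atlas (ModelProd (Fin n → ℍ) ℂ) (Tot n)) : ∃ k i, e = Tot.chart k i := by
  obtain ⟨_, ⟨k, rfl⟩, _, ⟨_, ⟨i, rfl⟩, f, hf, rfl⟩, rfl⟩ := he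
  have hf' : f = OpenPartialHomeomorph.refl ℂ := by simpa using hf
  exact ⟨k, i, by rw [hf']; rfl⟩

/-- The inverse of a chart. -/
def Tot.chartInv {n : ℕ} (k : Fin 2) (i : Fin (n + 1)) (u : (Fin n → ℍ) × ℂ) : HP n × SU 2 :=
  (HP.mk (homog i u.1), sec k u.2)

/-- The coordinate change. -/
def Tot.trans {n : ℕ} (k k' : Fin 2) (i i' : Fin (n + 1)) (u : (Fin n → ℍ) × ℂ) :
    (Fin n → ℍ) × ℂ :=
  if k' = k then (affine i' (homog i u.1).1, u.2)
  else (affine i' (fun m => rot (u.2 / ‖u.2‖) ((homog i u.1).1 m)), u.2⁻¹)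

theorem phase_mul_pos {r : ℝ} (hr : 0 < r) (z : ℂ) : phase (z * r) = phase z := by
  rw [phase, phase, Complex.arg_mul_real hr]

theorem Tot.trivCoord_chartInv {n : ℕ} (k k' : Fin 2) (i : Fin (n + 1)) (u : (Fin n → ℍ) × ℂ)
    (h : (sec k u.2).1 k' 0 ≠ 0) : trivCoord k' (Tot.chartInv k i u) =
      if k' = k then (HP.mk (homog i u.1), u.2)
      else (HP.mk (NZ.rot (phase u.2) (homog i u.1)), u.2⁻¹) := by
  split_ifs with hk
  · subst hk
    exact trivCoord_sec k' _ _
  · have hk' : k' = k + 1 := by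
      revert hk; fin_cases k <;> fin_cases k' <;> decide
    subst hk'
    have hkk : k + 1 + 1 = k := by fin_cases k <;> decide
    unfold trivCoord chartInv
    have hp := inv_pos.2 (sqrt_pos u.2)
    refine Prod.ext ?_ ?_
    · change phase ((sec k u.2).1 (k + 1) 0) • HP.mk (homog i u.1) = _
      rw [circle_smul_mk, sec_other, div_eq_mul_inv, ← Complex.ofReal_inv, phase_mul_pos hp]
    · change (sec k u.2).1 (k + 1 + 1) 0 / (sec k u.2).1 (k + 1) 0 = _
      rw [hkk, sec_self, sec_other]
      have : ((Real.sqrt (1 + Complex.normSq u.2) : ℝ) : ℂ) ≠ 0 := by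
        exact_mod_cast (sqrt_pos u.2).ne'
      push_cast; field_simp

instance (n : ℕ) : IsManifold (modelTot n) ∞ (Tot n) := by
  refine isManifold_of_contDiffOn _ _ _ ?_
  intro e e' he he'
  obtain ⟨k, i, rfl⟩ := Tot.mem_atlas he
  obtain ⟨k', i', rfl⟩ := Tot.mem_atlas he'
  have key : ∀ u : (Fin n → ℍ) × ℂ,
      u ∈ ((modelTot n).symm ⁻¹' ((Tot.chart k i).symm ≫ₕ Tot.chart k' i').source ∩
        range (modelTot n)) → (sec k u.2).1 k' 0 ≠ 0 ∧
        (HP.mk (homog i u.1), u.2).1 = HP.mk (homog i u.1) ∧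
        (trivCoord k' (Tot.chartInv k i u)).1.rep.1 i' ≠ 0 := by
    intro u hu
    have h1 : (Tot.mk (Tot.chartInv k i u)).rep.2.1 k' 0 ≠ 0 := hu.1.2.1
    have h2 : (sec k u.2).1 k' 0 ≠ 0 := (Tot.rep_ne_iff k' _).1 h1
    have h3 : (trivCoord k' (Tot.mk (Tot.chartInv k i u)).rep).1.rep.1 i' ≠ 0 := hu.1.2.2.1
    rw [Tot.trivCoord_rep k' _ h2] at h3
    exact ⟨h2, rfl, h3⟩
  have hcd : ∀ m, ContDiff ℝ ∞ fun u : (Fin n → ℍ) × ℂ => (homog i u.1).1 m :=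
    fun m => (contDiff_homog i m).comp contDiff_fst
  refine ContDiffOn.congr (f := Tot.trans k k' i i') ?_ ?_
  · intro u hu
    obtain ⟨h1, -, h3⟩ := key u hu
    rw [Tot.trivCoord_chartInv k k' i u h1] at h3
    refine ContDiffAt.contDiffWithinAt ?_
    unfold Tot.trans
    split_ifs at h3 ⊢ with hk
    · have h3' := (HP.rep_ne_iff _ _).1 h3
      refine ContDiffAt.prodMk ?_ contDiffAt_snd
      exact (contDiffAt_affine i' h3').comp u (f := fun u : (Fin n → ℍ) × ℂ => (homog i u.1).1)
        (contDiffAt_pi.2 fun m => (hcd m).contDiffAt)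
    · have h3' := (HP.rep_ne_iff _ _).1 h3
      have hk' : k' = k + 1 := by
        revert hk; fin_cases k <;> fin_cases k' <;> decide
      subst hk'
      have hz : u.2 ≠ 0 := by
        intro hz; apply h1; rw [sec_other, hz, zero_div]
      have hph : ContDiffAt ℝ ∞ (fun u : (Fin n → ℍ) × ℂ => u.2 / (‖u.2‖ : ℂ)) u := by
        have hn : ContDiffAt ℝ ∞ (fun u : (Fin n → ℍ) × ℂ => (‖u.2‖ : ℂ)) u :=
          Complex.ofRealCLM.contDiff.contDiffAt.comp u (contDiffAt_snd.norm ℝ hz)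
        have hi : ContDiffAt ℝ ∞ (fun u : (Fin n → ℍ) × ℂ => (‖u.2‖ : ℂ)⁻¹) u :=
          hn.inv (by simpa using hz)
        simpa only [div_eq_mul_inv] using contDiffAt_snd.mul hi
      refine ContDiffAt.prodMk ?_ (contDiffAt_snd.inv hz)
      have hne : rot (u.2 / ‖u.2‖) ((homog i u.1).1 i') ≠ 0 := by
        rw [← coe_phase hz]; exact h3'
      refine ContDiffAt.comp u (g := affine i')
        (f := fun u : (Fin n → ℍ) × ℂ => fun m => rot (u.2 / ‖u.2‖) ((homog i u.1).1 m))
        (contDiffAt_affine i' hne) (contDiffAt_pi.2 fun m => ?_)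
      exact contDiff_rot.contDiffAt.comp u (hph.prodMk (hcd m).contDiffAt)
  · intro u hu
    obtain ⟨h1, -, h3⟩ := key u hu
    change (affine i' (trivCoord k' (Tot.mk (Tot.chartInv k i u)).rep).1.rep.1,
      (trivCoord k' (Tot.mk (Tot.chartInv k i u)).rep).2) = _
    rw [Tot.trivCoord_rep k' _ h1, Tot.trivCoord_chartInv k k' i u h1]
    unfold Tot.trans
    split_ifs with hk
    · simp only [HP.affine_rep]
    · have hk' : k' = k + 1 := by
        revert hk; fin_cases k <;> fin_cases k' <;> decide
      subst hk'
      have hz : u.2 ≠ 0 := by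
        intro hz; apply h1
        rw [sec_other, hz, zero_div]
      simp only [HP.affine_rep, NZ.rot, coe_phase hz]

/-! ### Linear `HP^n`-bundles over `S²` -/

/-- The unit sphere in `ℝ³`. -/
abbrev S2 : Type := Metric.sphere (0 : EuclideanSpace ℝ (Fin 3)) 1

/-- The model of `S²`. -/
abbrev modelS2 : ModelWithCorners ℝ (EuclideanSpace ℝ (Fin 2)) (EuclideanSpace ℝ (Fin 2)) := 𝓡 2

/-- The Hopf map `SU(2) → S²`, `s ↦ (2 z̄ w, |z|² - |w|²) ∈ ℂ × ℝ`, where `(z, w)` is the first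
column of `s`; its fibres are the cosets `s S¹`. -/
def hopf (s : SU 2) : S2 :=
  ⟨!₂[2 * (star (s.1 0 0) * s.1 1 0).re, 2 * (star (s.1 0 0) * s.1 1 0).im,
      Complex.normSq (s.1 0 0) - Complex.normSq (s.1 1 0)], by
    rw [mem_sphere_zero_iff_norm, EuclideanSpace.norm_eq, Real.sqrt_eq_one, Fin.sum_univ_three]
    have h := SU2.normSq_col s
    simp only [Real.norm_eq_abs, sq_abs]
    simp [Complex.normSq_apply] at h ⊢
    generalize (s.1 0 0).re = a at h ⊢
    generalize (s.1 0 0).im = b at h ⊢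
    generalize (s.1 1 0).re = c at h ⊢
    generalize (s.1 1 0).im = d at h ⊢
    linear_combination (a * a + b * b + (c * c + d * d) + 1) * h⟩

theorem hopf_smul (z : Circle) (s : SU 2) : hopf (z • s) = hopf s := by
  have h : ∀ i, (z • s).1 i 0 = s.1 i 0 * ((z⁻¹ : Circle) : ℂ) := torus_inv_apply s z
  have hz : star ((z⁻¹ : Circle) : ℂ) * ((z⁻¹ : Circle) : ℂ) = 1 := by
    rw [Complex.star_def, ← Complex.normSq_eq_conj_mul_self, Circle.normSq_coe, Complex.ofReal_one]
  have h1 : star ((z • s).1 0 0) * (z • s).1 1 0 = star (s.1 0 0) * s.1 1 0 := by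
    rw [h, h, star_mul]
    linear_combination (star (s.1 0 0) * s.1 1 0) * hz
  have h2 : ∀ i, Complex.normSq ((z • s).1 i 0) = Complex.normSq (s.1 i 0) := by
    intro i; rw [h, map_mul, Circle.normSq_coe, mul_one]
  ext1
  simp only [hopf, h1, h2]

/-- The projection `HP^n ×_{S¹} SU(2) → SU(2)/S¹ = S²`. -/
def Tot.proj {n : ℕ} : Tot n → S2 :=
  Quotient.lift (fun p : HP n × SU 2 => hopf p.2) (by
    rintro p q h
    obtain ⟨z, rfl⟩ := MulAction.orbitRel_apply.1 h
    exact hopf_smul z q.2)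

theorem Tot.proj_mk {n : ℕ} (x : HP n) (s : SU 2) : Tot.proj (Tot.mk (x, s)) = hopf s := rfl

section Bundles

variable {E : Type*} [NormedAddCommGroup E] [NormedSpace ℝ E] {H : Type*} [TopologicalSpace H]
  {E' : Type*} [NormedAddCommGroup E'] [NormedSpace ℝ E'] {H' : Type*} [TopologicalSpace H']

/-- A smooth linear `HP^n`-bundle over `S²` with total space `M`: a smooth fibre bundle with an
atlas of smooth local trivializations whose transition maps are, on every fibre, given by
elements of `Sp(n+1)`, i.e. the structure group is `Sp(n+1)/{±1}`. -/
structure LinearHPBundle (n : ℕ) (I : ModelWithCorners ℝ E H) (M : Type*) [TopologicalSpace M]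
    [ChartedSpace H M] where
  /-- the bundle projection -/
  proj : M → S2
  /-- the admissible local trivializations -/
  atlas : Set (Bundle.Trivialization (HP n) proj)
  cover : ∀ b : S2, ∃ e ∈ atlas, b ∈ e.baseSet
  smooth : ∀ e ∈ atlas, ContMDiffOn I (modelS2.prod (modelHP n)) ∞ e e.source
  smooth_symm : ∀ e ∈ atlas,
    ContMDiffOn (modelS2.prod (modelHP n)) I ∞ e.toOpenPartialHomeomorph.symm e.target
  linear : ∀ e ∈ atlas, ∀ e' ∈ atlas, ∀ b ∈ e.baseSet ∩ e'.baseSet, ∃ A : Sp n, ∀ x : HP n,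
    e' (e.toOpenPartialHomeomorph.symm (b, x)) = (b, A • x)

variable {n : ℕ} {I : ModelWithCorners ℝ E H} {M : Type*} [TopologicalSpace M] [ChartedSpace H M]
  {I' : ModelWithCorners ℝ E' H'} {M' : Type*} [TopologicalSpace M'] [ChartedSpace H' M']

/-- Isomorphism of linear `HP^n`-bundles over the identity of `S²`: a fibre-preserving
diffeomorphism that is, on every fibre and in admissible local trivializations, given by an
element of `Sp(n+1)`. -/
def LinearHPBundle.Isomorphic (B : LinearHPBundle n I M) (B' : LinearHPBundle n I' M') : Prop :=
  ∃ Φ : Diffeomorph I I' M M' ∞, (∀ m, B'.proj (Φ m) = B.proj m) ∧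
    ∀ e ∈ B.atlas, ∀ e' ∈ B'.atlas, ∀ b ∈ e.baseSet ∩ e'.baseSet, ∃ A : Sp n, ∀ x : HP n,
      e' (Φ (e.toOpenPartialHomeomorph.symm (b, x))) = (b, A • x)

/-- A linear `HP^n`-bundle is trivial if it is isomorphic, as a linear bundle, to the product
`S² × HP^n`. -/
def LinearHPBundle.IsTrivial (B : LinearHPBundle n I M) : Prop :=
  ∃ Φ : Diffeomorph I (modelS2.prod (modelHP n)) M (S2 × HP n) ∞, (∀ m, (Φ m).1 = B.proj m) ∧
    ∀ e ∈ B.atlas, ∀ b ∈ e.baseSet, ∃ A : Sp n, ∀ x : HP n,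
      Φ (e.toOpenPartialHomeomorph.symm (b, x)) = (b, A • x)

end Bundles

/-! ### Cohomogeneity one actions -/

/-- The real vector space of pairs of complex matrices (of sizes `n+1` and `2`) that contains
`SU(n+1) × SU(2)` as a compact submanifold. -/
abbrev MatPair (n : ℕ) : Type := (Fin (n + 1) → Fin (n + 1) → ℂ) × (Fin 2 → Fin 2 → ℂ)

/-- The inclusion of `SU(n+1) × SU(2)` into the space of pairs of matrices. -/
def G.toMatPair {n : ℕ} (g : G n) : MatPair n := (fun i j => g.1.1 i j, fun i j => g.2.1 i j)

section Actions

variable {E : Type*} [NormedAddCommGroup E] [NormedSpace ℝ E] {H : Type*} [TopologicalSpace H]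
  {E' : Type*} [NormedAddCommGroup E'] [NormedSpace ℝ E'] {H' : Type*} [TopologicalSpace H']

/-- Smoothness of a map `G × M → N`, where `G = SU(n+1) × SU(2)` is regarded as a submanifold of
the space of pairs of matrices: locally the map extends to a smooth map on an open set of
`MatPair n × M`. -/
def SmoothOnG {n : ℕ} (I : ModelWithCorners ℝ E H) (I' : ModelWithCorners ℝ E' H') {M N : Type*}
    [TopologicalSpace M] [ChartedSpace H M] [TopologicalSpace N] [ChartedSpace H' N]
    (f : G n → M → N) : Prop :=
  ∀ (g : G n) (x : M), ∃ F : MatPair n × M → N,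
    ContMDiffAt (𝓘(ℝ, MatPair n).prod I) I' ∞ F (g.toMatPair, x) ∧
    ∀ᶠ p in 𝓝 (g, x), F (p.1.toMatPair, p.2) = f p.1 p.2

/-- The action of the compact Lie group `G = SU(n+1) × SU(2)` on `M` is a cohomogeneity one
action: `M` is a closed connected manifold, the action is smooth and almost effective, and the
orbit space is one-dimensional, i.e. an interval or a circle. -/
structure IsCohomogeneityOne (n : ℕ) (I : ModelWithCorners ℝ E H) (M : Type*) [TopologicalSpace M]
    [ChartedSpace H M] [MulAction (G n) M] : Prop where
  compact_group : CompactSpace (G n)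
  isManifold : IsManifold I ∞ M
  boundaryless : I.Boundaryless
  compact : CompactSpace M
  hausdorff : T2Space M
  connected : ConnectedSpace M
  smooth : SmoothOnG I I (fun (g : G n) (x : M) => g • x)
  almost_effective : {g : G n | ∀ x : M, g • x = x}.Finite
  orbit_space : Nonempty (MulAction.orbitRel.Quotient (G n) M ≃ₜ unitInterval) ∨
    Nonempty (MulAction.orbitRel.Quotient (G n) M ≃ₜ Circle)

/-- `H ⊆ K₋, K₊ ⊆ Γ` is a group diagram of the action of `Γ` on `M`: there is a smooth curve whose
restriction to `[0, 1]` meets every orbit exactly once and identifies `[0, 1]` with the orbit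
space, with isotropy group `H` at interior points and `K₋`, `K₊` at the end points. -/
def IsGroupDiagram {Γ : Type*} [Group Γ] (I : ModelWithCorners ℝ E H) (M : Type*)
    [TopologicalSpace M] [ChartedSpace H M] [MulAction Γ M] (Hp Kminus Kplus : Subgroup Γ) : Prop :=
  ∃ c : ℝ → M, ContMDiff 𝓘(ℝ, ℝ) I ∞ c ∧
    (∃ h : unitInterval ≃ₜ MulAction.orbitRel.Quotient Γ M,
      ∀ t : unitInterval, h t = Quotient.mk'' (c t)) ∧
    MulAction.stabilizer Γ (c 0) = Kminus ∧ MulAction.stabilizer Γ (c 1) = Kplus ∧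
    ∀ t ∈ Ioo (0 : ℝ) 1, MulAction.stabilizer Γ (c t) = Hp

/-- The action is non-primitive, as witnessed by the proper closed subgroup `Λ`: for a group
diagram `H ⊆ K₋, K₊ ⊆ Γ`, the group `Λ` contains both `K₋` and `K₊`. -/
def IsNonPrimitiveVia {Γ : Type*} [Group Γ] [TopologicalSpace Γ] (I : ModelWithCorners ℝ E H)
    (M : Type*) [TopologicalSpace M] [ChartedSpace H M] [MulAction Γ M] (Λ : Subgroup Γ) : Prop :=
  IsClosed (Λ : Set Γ) ∧ Λ ≠ ⊤ ∧ ∃ Hp Kminus Kplus : Subgroup Γ,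
    IsGroupDiagram I M Hp Kminus Kplus ∧ Kminus ≤ Λ ∧ Kplus ≤ Λ

end Actions

/-! ### The induced space `HP^n ×_L G` -/

/-- `L` acts on `G` by `l • g = g l⁻¹`. -/
instance (n : ℕ) : MulAction (L n) (G n) where
  smul l g := g * (inclL n l)⁻¹
  one_smul g := by change g * (inclL n 1)⁻¹ = g; simp
  mul_smul l m g := by
    change g * (inclL n (l * m))⁻¹ = g * (inclL n m)⁻¹ * (inclL n l)⁻¹
    rw [map_mul, mul_inv_rev, mul_assoc]

/-- The quotient of `HP^n × G` by the action `l • (x, g) = (l • x, g l⁻¹)` of `L`. -/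
def Ind (n : ℕ) : Type := MulAction.orbitRel.Quotient (L n) (HP n × G n)

/-- The point `[x, g]`. -/
def Ind.mk {n : ℕ} (p : HP n × G n) : Ind n := Quotient.mk'' p

/-- The quotient topology. -/
instance (n : ℕ) : TopologicalSpace (Ind n) := TopologicalSpace.coinduced Ind.mk inferInstance

/-- `g • [x, h] = [x, g h]`. -/
instance (n : ℕ) : MulAction (G n) (Ind n) where
  smul g := Quotient.map' (fun p => (p.1, g * p.2)) (by
    rintro p q h
    obtain ⟨l, rfl⟩ := MulAction.orbitRel_apply.1 h
    refine MulAction.orbitRel_apply.2 ⟨l, Prod.ext rfl ?_⟩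
    change g * q.2 * _ = g * (q.2 * _)
    rw [mul_assoc])
  one_smul e := by
    induction e using Quotient.inductionOn' with
    | h p => change Ind.mk (p.1, 1 * p.2) = Ind.mk p; rw [one_mul]
  mul_smul g h e := by
    induction e using Quotient.inductionOn' with
    | h p => change Ind.mk (p.1, g * h * p.2) = Ind.mk (p.1, g * (h * p.2)); rw [mul_assoc]

end CohomOne

end

universe u v

open CohomOne

/-! Classification. A linear bundle is determined by its clutching map on an annulus, with values in
`Sp(n+1)/{±1}`. As `Sp(n+1)` is simply connected, there are two homotopy classes of such maps, told
apart by the sign picked up by a lift to `Sp(n+1)` along a loop. To lift smoothly, the action on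
lines is converted into conjugation of projection matrices (`HP.projMat_Sp_smul`). These projections
generate all matrix units when `n ≥ 1`, and the averaging identity `sum_conj_mul` recovers a real
multiple of `A` from conjugation by `A`. Hence smooth families lift locally, uniquely up to sign
(`IsLinearFamilyOn.exists_local_lift`, `Sp.eq_or_eq_neg_of_smul_eq`), and then over rectangles. On
an annulus one lifts along the exponential map and compares the lift with its translate by `2πi`. If
the sign is `+1`, the lift descends; if it is `-1`, it descends after multiplication by `e^{iθ/2}`,
which lifts the circle action on `HP^n` and has the same sign change (`IsLinearFamilyOn.dichotomy`).

A map from an annulus to `Sp(n+1)` extends over the disc after shrinking the annulus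
(`exists_extension`): column by column, a vector in a sphere misses a point for reasons of
dimension, can therefore be contracted, and is realized by explicit unitary quasi-reflections. Using
the extension to change one of two trivializations leaves as transition map either the identity or
the phase of the affine coordinate, that is, the product bundle or `HP^n ×_{S¹} SU(2)`. The latter
is not trivial, since a trivialization would give lifts over both discs whose quotient on the
equator is `±e^{it/2}`, which is not periodic.

Cohomogeneity one. The group `SU(n+1) × S¹` acts on `HP^n` through `U(n+1)`. Writing `v = a + bj`
and choosing the representative with `a ⊥ b` and `‖b‖ ≤ ‖a‖`, every point is moved to `[c e₀ + s e₁
j]` with `0 ≤ s ≤ c` (`exists_normal_form`). The norm of the moment map `v* i v` is invariant and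
takes the value `c² - s²` there, so it separates the orbits; the orbit space is an interval
parametrized by `curve`. The isotropy group of `[x, 1]` has second factor in the torus, so it lies
in `L`, and a computation with the upper left 2×2 block shows that it is constant at the interior
points (`smul_pairVec_eq`).

Induction. The map `[x, (A, s)] ↦ [Ax, s]` has inverse `[y, s] ↦ [y, (1, s)]`; its smoothness comes
from that of the action, and the smoothness of the inverse from local sections through each point.
-/

noncomputable section

namespace CohomOne

/-! ### Smooth maps into and out of quaternionic projective space -/

/-- The point `[v]` for `v ≠ 0` (a junk point for `v = 0`). -/
def HP.ofVec {n : ℕ} (v : Fin (n + 1) → ℍ) : HP n :=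
  open scoped Classical in if h : v ≠ 0 then HP.mk ⟨v, h⟩ else HP.mk (homog 0 0)

theorem HP.ofVec_of_ne {n : ℕ} {v : Fin (n + 1) → ℍ} (h : v ≠ 0) :
    HP.ofVec v = HP.mk ⟨v, h⟩ := dif_pos h

@[simp] theorem HP.ofVec_coe {n : ℕ} (v : NZ n) : HP.ofVec v.1 = HP.mk v := HP.ofVec_of_ne v.2

theorem HP.exists_ofVec {n : ℕ} (x : HP n) : ∃ v : Fin (n + 1) → ℍ, v ≠ 0 ∧ HP.ofVec v = x := by
  obtain ⟨v, rfl⟩ := HP.mk_surjective x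
  exact ⟨v.1, v.2, HP.ofVec_coe v⟩

theorem HP.ofVec_eq_iff {n : ℕ} {v w : Fin (n + 1) → ℍ} (hv : v ≠ 0) (hw : w ≠ 0) :
    HP.ofVec v = HP.ofVec w ↔ ∃ q : ℍ, q ≠ 0 ∧ ∀ i, v i = w i * q := by
  rw [HP.ofVec_of_ne hv, HP.ofVec_of_ne hw, HP.mk_eq_iff]

theorem HP.chart_mem_maximalAtlas {n : ℕ} (i : Fin (n + 1)) :
    HP.chart i ∈ IsManifold.maximalAtlas (modelHP n) ∞ (HP n) :=
  IsManifold.subset_maximalAtlas (mem_range_self i)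

/-- Homogeneous coordinates become a total map on a vector space, which reduces smoothness into `HP
n` to Euclidean calculus away from zero: near `v` the map is an inverse affine chart after `affine
i`, for any `i` with `v i ≠ 0`. -/
theorem contMDiffAt_ofVec {n : ℕ} {v : Fin (n + 1) → ℍ} (hv : v ≠ 0) :
    ContMDiffAt 𝓘(ℝ, Fin (n + 1) → ℍ) (modelHP n) ∞ HP.ofVec v := by
  obtain ⟨i, hi⟩ := Function.ne_iff.1 hv
  have h1 : ContMDiffAt 𝓘(ℝ, Fin (n + 1) → ℍ) 𝓘(ℝ, Fin n → ℍ) ∞ (affine i) v :=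
    (contDiffAt_affine i hi).contMDiffAt
  have h2 : ContMDiffAt 𝓘(ℝ, Fin n → ℍ) (modelHP n) ∞ (HP.chart i).symm (affine i v) :=
    contMDiffAt_symm_of_mem_maximalAtlas (HP.chart_mem_maximalAtlas i) (mem_univ _)
  refine (h2.comp v h1).congr_of_eventuallyEq ?_
  have : ∀ᶠ w : Fin (n + 1) → ℍ in 𝓝 v, w i ≠ 0 :=
    (continuous_apply i).continuousAt.eventually_ne hi
  filter_upwards [this] with w hw
  have hw0 : w ≠ 0 := fun h => hw (by rw [h]; rfl)
  rw [HP.ofVec_of_ne hw0]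
  have := (HP.chart i).left_inv (x := HP.mk ⟨w, hw0⟩) ((HP.rep_ne_iff i ⟨w, hw0⟩).2 hw)
  rw [← this]
  exact congrArg (HP.chart i).symm (HP.affine_rep i ⟨w, hw0⟩)

/-- Near every point there is a smooth choice of homogeneous coordinates. -/
theorem HP.exists_smooth_vec {n : ℕ} (x : HP n) : ∃ r : HP n → Fin (n + 1) → ℍ,
    ContMDiffAt (modelHP n) 𝓘(ℝ, Fin (n + 1) → ℍ) ∞ r x ∧ (∀ y, r y ≠ 0) ∧
      ∀ᶠ y in 𝓝 x, HP.ofVec (r y) = y := by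
  obtain ⟨i, hi⟩ := x.rep.exists_ne
  have hx : x ∈ (HP.chart i).source := hi
  refine ⟨fun y => (homog i (HP.chart i y)).1, ?_, fun y => (homog i _).2, ?_⟩
  · have h1 : ContMDiffAt (modelHP n) 𝓘(ℝ, Fin n → ℍ) ∞ (HP.chart i) x :=
      contMDiffAt_of_mem_maximalAtlas (HP.chart_mem_maximalAtlas i) hx
    have h2 : ContDiff ℝ ∞ fun u : Fin n → ℍ => (homog i u).1 :=
      contDiff_pi.2 (contDiff_homog i)
    exact h2.contMDiff.contMDiffAt.comp x h1
  · filter_upwards [(HP.chart i).open_source.mem_nhds hx] with y hy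
    rw [HP.ofVec_coe]
    exact (HP.chart i).left_inv hy

theorem mulVec_ne_zero {n : ℕ} (A : GLH n) {v : Fin (n + 1) → ℍ} (hv : v ≠ 0) :
    A.1 *ᵥ v ≠ 0 := (NZ.mulVec A ⟨v, hv⟩).2

theorem HP.GLH_smul_ofVec {n : ℕ} (A : GLH n) {v : Fin (n + 1) → ℍ} (hv : v ≠ 0) :
    A • HP.ofVec v = HP.ofVec (A.1 *ᵥ v) := by
  rw [HP.ofVec_of_ne hv, HP.smul_mk, HP.ofVec_of_ne (mulVec_ne_zero A hv)]; rfl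

theorem HP.Sp_smul_ofVec {n : ℕ} (A : Sp n) {v : Fin (n + 1) → ℍ} (hv : v ≠ 0) :
    A • HP.ofVec v = HP.ofVec (A.1 *ᵥ v) := HP.GLH_smul_ofVec (Unitary.toUnits A) hv

theorem Sp.mulVec_ne_zero {n : ℕ} (A : Sp n) {v : Fin (n + 1) → ℍ} (hv : v ≠ 0) :
    A.1 *ᵥ v ≠ 0 := CohomOne.mulVec_ne_zero (Unitary.toUnits A) hv

/-- The complex matrix `A`, regarded as a quaternionic matrix. -/
abbrev quatMat {m : ℕ} (A : Matrix (Fin m) (Fin m) ℂ) : Matrix (Fin m) (Fin m) ℍ :=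
  A.map fun c : ℂ => (c : ℍ)

theorem HP.SU_smul_ofVec {n : ℕ} (A : SU (n + 1)) {v : Fin (n + 1) → ℍ} (hv : v ≠ 0) :
    A • HP.ofVec v = HP.ofVec (quatMat A.1 *ᵥ v) := HP.GLH_smul_ofVec (SU.toGLH A) hv

theorem SU.mulVec_ne_zero {n : ℕ} (A : SU (n + 1)) {v : Fin (n + 1) → ℍ} (hv : v ≠ 0) :
    quatMat A.1 *ᵥ v ≠ 0 := CohomOne.mulVec_ne_zero (SU.toGLH A) hv

theorem HP.circle_smul_ofVec {n : ℕ} (z : Circle) {v : Fin (n + 1) → ℍ} (hv : v ≠ 0) :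
    z • HP.ofVec v = HP.ofVec (fun i => rot z (v i)) := by
  rw [HP.ofVec_of_ne hv, circle_smul_mk, ← HP.ofVec_coe]; rfl

/-! Projection matrices -/

/-- The sum of the squares of the norms of the entries. -/
def vecNormSq {n : ℕ} (v : Fin (n + 1) → ℍ) : ℝ := ∑ i, Quaternion.normSq (v i)

theorem vecNormSq_pos {n : ℕ} {v : Fin (n + 1) → ℍ} (hv : v ≠ 0) : 0 < vecNormSq v := by
  obtain ⟨i, hi⟩ := Function.ne_iff.1 hv
  refine Finset.sum_pos' (fun j _ => Quaternion.normSq_nonneg) ⟨i, Finset.mem_univ i, ?_⟩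
  exact lt_of_le_of_ne Quaternion.normSq_nonneg (Ne.symm (Quaternion.normSq_ne_zero.2 hi))

theorem vecNormSq_mul {n : ℕ} (v : Fin (n + 1) → ℍ) (q : ℍ) :
    vecNormSq (fun i => v i * q) = vecNormSq v * Quaternion.normSq q := by
  simp only [vecNormSq, map_mul, Finset.sum_mul]

theorem coe_vecNormSq {n : ℕ} (v : Fin (n + 1) → ℍ) :
    ((vecNormSq v : ℝ) : ℍ) = ∑ i, star (v i) * v i := by
  simp only [Quaternion.star_mul_self, vecNormSq]
  exact map_sum (⟨⟨fun r : ℝ => (r : ℍ), Quaternion.coe_zero⟩, Quaternion.coe_add⟩ : ℝ →+ ℍ) _ _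

theorem vecNormSq_eq_one_iff {n : ℕ} (v : Fin (n + 1) → ℍ) :
    vecNormSq v = 1 ↔ ∑ i, star (v i) * v i = 1 := by
  rw [← coe_vecNormSq, ← Quaternion.coe_one]
  exact Quaternion.coe_injective.eq_iff.symm

theorem Sp.vecNormSq_mulVec {n : ℕ} (A : Sp n) (v : Fin (n + 1) → ℍ) :
    vecNormSq (A.1 *ᵥ v) = vecNormSq v := by
  have h : ∀ w : Fin (n + 1) → ℍ, ((vecNormSq w : ℝ) : ℍ) = star w ⬝ᵥ w := fun w => coe_vecNormSq w
  have : ((vecNormSq (A.1 *ᵥ v) : ℝ) : ℍ) = ((vecNormSq v : ℝ) : ℍ) := by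
    rw [h, h, Matrix.star_mulVec, Matrix.dotProduct_mulVec, Matrix.vecMul_vecMul,
      ← Matrix.star_eq_conjTranspose, Unitary.star_mul_self_of_mem A.2, Matrix.vecMul_one]
  exact Quaternion.coe_injective this

/-- The matrix `v v* / |v|²`. -/
def vecProj {n : ℕ} (v : Fin (n + 1) → ℍ) : Matrix (Fin (n + 1)) (Fin (n + 1)) ℍ :=
  fun i j => (vecNormSq v)⁻¹ • (v i * star (v j))

/-- Since `(vq)(vq)* = |q|² vv*`, the normalized matrix depends only on the line of `v` and descends
to `HP n`. -/
theorem vecProj_mul {n : ℕ} (v : Fin (n + 1) → ℍ) {q : ℍ} (hq : q ≠ 0) :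
    vecProj (fun i => v i * q) = vecProj v := by
  ext1 i j
  have h : v i * q * star (v j * q) = Quaternion.normSq q • (v i * star (v j)) := by
    rw [star_mul, mul_assoc, ← mul_assoc q, Quaternion.self_mul_star, ← mul_assoc,
      Quaternion.mul_coe_eq_smul, smul_mul_assoc]
  simp only [vecProj]
  rw [vecNormSq_mul, h, smul_smul, mul_inv, mul_assoc,
    inv_mul_cancel₀ (Quaternion.normSq_ne_zero.2 hq), mul_one]

/-- The orthogonal projection onto the line `x`. -/
def HP.projMat {n : ℕ} (x : HP n) : Matrix (Fin (n + 1)) (Fin (n + 1)) ℍ := vecProj x.rep.1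

theorem HP.projMat_ofVec {n : ℕ} {v : Fin (n + 1) → ℍ} (hv : v ≠ 0) :
    (HP.ofVec v).projMat = vecProj v := by
  rw [HP.ofVec_of_ne hv]
  obtain ⟨q, hq, h⟩ := HP.mk_eq_iff.1 (HP.mk_rep (HP.mk ⟨v, hv⟩))
  rw [HP.projMat, ← vecProj_mul v hq]
  congr 1; funext i; exact h i

/-- If `v j ≠ 0`, the `j`-th column of the projection is a nonzero right multiple of `v`, so the
matrix recovers the line. -/
theorem HP.projMat_injective {n : ℕ} : Function.Injective (HP.projMat (n := n)) := by
  intro x y h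
  obtain ⟨v, hv, rfl⟩ := x.exists_ofVec
  obtain ⟨w, hw, rfl⟩ := y.exists_ofVec
  rw [HP.projMat_ofVec hv, HP.projMat_ofVec hw] at h
  obtain ⟨j, hj⟩ := Function.ne_iff.1 hv
  have hj' : v j ≠ 0 := hj
  have h2 := inv_ne_zero (vecNormSq_pos hv).ne'
  have h4 : ∀ i, v i = w i * ((vecNormSq w)⁻¹ • star (w j) *
      ((vecNormSq v)⁻¹ • star (v j))⁻¹) := by
    intro i
    have h1 := congrFun (congrFun h i) j
    simp only [vecProj, ← mul_smul_comm] at h1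
    rw [← mul_assoc, ← h1, mul_assoc, mul_inv_cancel₀, mul_one]
    exact smul_ne_zero h2 (star_ne_zero.2 hj')
  refine (HP.ofVec_eq_iff hv hw).2 ⟨_, fun h0 => hj' ?_, h4⟩
  rw [h4 j, h0, mul_zero]

/-- The action turns into conjugation, where the sign ambiguity of `A` disappears. Recovering `A`
from its action on lines passes through this identity. -/
theorem HP.projMat_Sp_smul {n : ℕ} (A : Sp n) (x : HP n) :
    (A • x).projMat = A.1 * x.projMat * star A.1 := by
  obtain ⟨v, hv, rfl⟩ := x.exists_ofVec
  rw [HP.Sp_smul_ofVec A hv, HP.projMat_ofVec (Sp.mulVec_ne_zero A hv), HP.projMat_ofVec hv]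
  have h : ∀ w : Fin (n + 1) → ℍ, vecProj w = (vecNormSq w)⁻¹ • Matrix.vecMulVec w (star w) :=
    fun w => rfl
  rw [h, h, Sp.vecNormSq_mulVec, Matrix.mul_smul, Matrix.smul_mul, Matrix.mul_vecMulVec,
    Matrix.vecMulVec_mul, Matrix.star_mulVec, Matrix.star_eq_conjTranspose]

theorem contDiff_quatNormSq : ContDiff ℝ ∞ fun q : ℍ => Quaternion.normSq q := by
  have : (fun q : ℍ => Quaternion.normSq q) = fun q => ‖q‖ ^ 2 := by
    funext q; rw [Quaternion.normSq_eq_norm_mul_self, sq]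
  rw [this]; exact contDiff_norm_sq ℝ

theorem contDiff_quatStar : ContDiff ℝ ∞ fun q : ℍ => star q :=
  (LinearMap.toContinuousLinearMap
    (⟨⟨star, star_add⟩, fun r q => Quaternion.star_smul r q⟩ : ℍ →ₗ[ℝ] ℍ)).contDiff

theorem contDiff_vecNormSq {n : ℕ} : ContDiff ℝ ∞ (vecNormSq (n := n)) := by
  unfold vecNormSq
  exact ContDiff.sum fun i _ => contDiff_quatNormSq.comp (contDiff_apply ℝ ℍ i)

theorem contDiffAt_vecProj {n : ℕ} {v : Fin (n + 1) → ℍ} (hv : v ≠ 0) (i j : Fin (n + 1)) :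
    ContDiffAt ℝ ∞ (fun w => vecProj w i j) v := by
  unfold vecProj
  refine ContDiffAt.smul (contDiff_vecNormSq.contDiffAt.inv (vecNormSq_pos hv).ne') ?_
  exact (contDiff_apply ℝ ℍ i).contDiffAt.mul
    (contDiff_quatStar.comp (contDiff_apply ℝ ℍ j)).contDiffAt

theorem HP.contMDiff_projMat {n : ℕ} (i j : Fin (n + 1)) :
    ContMDiff (modelHP n) 𝓘(ℝ, ℍ) ∞ fun x : HP n => x.projMat i j := by
  intro x
  obtain ⟨r, hr, hr0, hre⟩ := x.exists_smooth_vec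
  refine ((contDiffAt_vecProj (hr0 x) i j).contMDiffAt.comp x hr).congr_of_eventuallyEq ?_
  filter_upwards [hre] with y hy
  change y.projMat i j = vecProj (r y) i j
  rw [← HP.projMat_ofVec (hr0 y), hy]

theorem HP.continuous_projMat {n : ℕ} : Continuous (HP.projMat (n := n)) :=
  continuous_matrix fun i j => (HP.contMDiff_projMat i j).continuous

/-! ### Topology of quaternionic projective space -/

instance (n : ℕ) : T2Space (HP n) := T2Space.of_injective_continuous
  HP.projMat_injective HP.continuous_projMat

theorem HP.continuousOn_ofVec {n : ℕ} : ContinuousOn (HP.ofVec (n := n)) {0}ᶜ :=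
  fun _ hv => (contMDiffAt_ofVec hv).continuousAt.continuousWithinAt

instance (n : ℕ) : CompactSpace (HP n) := by
  -- The norm here is the supremum norm; its unit sphere is compact and meets every quaternionic
  -- line.
  have : (univ : Set (HP n)) = HP.ofVec '' Metric.sphere (0 : Fin (n + 1) → ℍ) 1 := by
    refine (eq_univ_of_forall fun x => ?_).symm
    obtain ⟨v, hv, rfl⟩ := x.exists_ofVec
    have hn : (‖v‖⁻¹ : ℝ) ≠ 0 := inv_ne_zero (norm_ne_zero_iff.2 hv)
    have h0 : ‖v‖⁻¹ • v ≠ 0 := smul_ne_zero hn hv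
    refine ⟨‖v‖⁻¹ • v, ?_, ?_⟩
    · rw [mem_sphere_zero_iff_norm, norm_smul, norm_inv, norm_norm,
        inv_mul_cancel₀ (norm_ne_zero_iff.2 hv)]
    · refine (HP.ofVec_eq_iff h0 hv).2 ⟨((‖v‖⁻¹ : ℝ) : ℍ),
        fun h => hn (Quaternion.coe_injective (h.trans Quaternion.coe_zero.symm)), fun i => ?_⟩
      rw [Quaternion.mul_coe_eq_smul]; rfl
  refine ⟨?_⟩
  rw [this]
  refine (isCompact_sphere _ _).image_of_continuousOn (HP.continuousOn_ofVec.mono ?_)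
  rintro v hv rfl
  simp at hv

instance (n : ℕ) : ConnectedSpace (HP n) := by
  have hc : IsConnected ({0}ᶜ : Set (Fin (n + 1) → ℍ)) := by
    refine isConnected_compl_singleton_of_one_lt_rank ?_ 0
    refine Module.one_lt_rank_of_one_lt_finrank ?_
    rw [Module.finrank_pi_fintype]
    simp only [Quaternion.finrank_eq_four, Finset.sum_const, Finset.card_univ, Fintype.card_fin,
      smul_eq_mul]
    omega
  have := hc.image _ HP.continuousOn_ofVec
  have h2 : HP.ofVec '' {0}ᶜ = (univ : Set (HP n)) :=
    eq_univ_of_forall fun x => x.exists_ofVec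
  rw [h2] at this
  exact connectedSpace_iff_univ.2 this

/-! ### Lifting families of linear maps of `HP^n` to `Sp(n+1)` -/

/-- The quaternion `a + b i + c j + d k`. -/
def quatMk (a b c d : ℝ) : ℍ := ⟨a, b, c, d⟩

@[simp] theorem re_quatMk (a b c d : ℝ) : (quatMk a b c d).re = a := rfl
@[simp] theorem imI_quatMk (a b c d : ℝ) : (quatMk a b c d).imI = b := rfl
@[simp] theorem imJ_quatMk (a b c d : ℝ) : (quatMk a b c d).imJ = c := rfl
@[simp] theorem imK_quatMk (a b c d : ℝ) : (quatMk a b c d).imK = d := rfl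

/-- The basis `1, i, j, k` of the quaternions. -/
def quatBasis : Fin 4 → ℍ :=
  ![quatMk 1 0 0 0, quatMk 0 1 0 0, quatMk 0 0 1 0, quatMk 0 0 0 1]

theorem normSq_quatBasis (u : Fin 4) : Quaternion.normSq (quatBasis u) = 1 := by
  fin_cases u <;> simp [quatBasis, Quaternion.normSq_def']

/-- Each of `i, j, k` commutes with two of the four basis elements and anticommutes with the other
two, so its conjugates cancel; only the real part survives. -/
theorem sum_quatBasis_conj (b : ℍ) :
    ∑ u, quatBasis u * b * star (quatBasis u) = ((4 * b.re : ℝ) : ℍ) := by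
  rw [Fin.sum_univ_four]
  ext <;> simp [quatBasis]
  ring

/-- Sandwiching `B` between `E_ij(u)` and its adjoint isolates the entry `B_jj` and places it at
`(i, i)`; averaging over `u` leaves its real part. The result is a real scalar matrix, hence
central, which is what makes the argument work over the noncommutative `ℍ`. -/
theorem sum_single_conj {m : ℕ} (B : Matrix (Fin m) (Fin m) ℍ) :
    ∑ u, ∑ i, ∑ j, Matrix.single i j (quatBasis u) * B * star (Matrix.single i j (quatBasis u)) =
      (4 * ∑ j, (B j j).re) • (1 : Matrix (Fin m) (Fin m) ℍ) := by
  have h : ∀ u i j, Matrix.single i j (quatBasis u) * B *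
      star (Matrix.single i j (quatBasis u)) =
      Matrix.single i i (quatBasis u * B j j * star (quatBasis u)) := by
    intro u i j
    rw [Matrix.star_eq_conjTranspose, Matrix.conjTranspose_single, Matrix.single_mul_mul_single]
  simp only [h]
  ext1 a b
  simp only [Matrix.sum_apply, Matrix.smul_apply, Matrix.one_apply]
  rw [Finset.sum_comm]
  have h2 : ∀ i, ∑ u, ∑ j, Matrix.single i i (quatBasis u * B j j * star (quatBasis u)) a b =
      if i = a ∧ i = b then ((4 * ∑ j, (B j j).re : ℝ) : ℍ) else 0 := by
    intro i
    rw [Finset.sum_comm]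
    simp only [Matrix.single_apply]
    split_ifs with hi
    · simp only [sum_quatBasis_conj]
      rw [Finset.mul_sum]
      exact (map_sum (⟨⟨fun r : ℝ => (r : ℍ), Quaternion.coe_zero⟩, Quaternion.coe_add⟩ :
        ℝ →+ ℍ) _ _).symm
    · simp
  simp only [h2]
  by_cases hab : a = b
  · subst hab
    simp only [and_self, Finset.sum_ite_eq', Finset.mem_univ, if_true]
    rw [← Quaternion.coe_mul_eq_smul, mul_one]
  · rw [if_neg hab, smul_zero]
    refine Finset.sum_eq_zero fun i _ => if_neg ?_
    rintro ⟨rfl, rfl⟩; exact hab rfl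

theorem HP.projMat_ofVec_single {n : ℕ} (i : Fin (n + 1)) :
    (HP.ofVec (Pi.single i 1 : Fin (n + 1) → ℍ)).projMat = Matrix.single i i 1 := by
  have h0 : (Pi.single i 1 : Fin (n + 1) → ℍ) ≠ 0 := by simp
  have h1 : vecNormSq (Pi.single i 1 : Fin (n + 1) → ℍ) = 1 := by
    rw [vecNormSq, Finset.sum_eq_single i] <;> simp +contextual
  rw [HP.projMat_ofVec h0]
  ext1 a b
  simp only [vecProj, h1, inv_one, one_smul, Pi.single_apply, Matrix.single_apply]
  by_cases ha : a = i
  · by_cases hb : b = i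
    · simp [ha, hb]
    · simp [ha, hb, Ne.symm hb]
  · simp [ha, Ne.symm ha]

/-- The projections onto the points of `HP^n` generate the matrix algebra, if `n ≥ 1`. -/
theorem HP.projMat_induction {n : ℕ} (hn : 1 ≤ n)
    {p : Matrix (Fin (n + 1)) (Fin (n + 1)) ℍ → Prop} (hproj : ∀ x : HP n, p x.projMat)
    (hmul : ∀ X Y, p X → p Y → p (X * Y)) (hsmul : ∀ (r : ℝ) X, p X → p (r • X))
    (i j : Fin (n + 1)) (u : Fin 4) : p (Matrix.single i j (quatBasis u)) := by
  have h1 : ∀ i : Fin (n + 1), p (Matrix.single i i 1) := fun i => by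
    rw [← HP.projMat_ofVec_single]; exact hproj _
  -- The projection onto the line of `e_i + e_j a` has `(i, j)` entry proportional to `a*`; the
  -- factors `E_ii` on the left and `E_jj` on the right cut it out.
  have h2 : ∀ (i j : Fin (n + 1)) (a : ℍ), i ≠ j → Quaternion.normSq a = 1 →
      p (Matrix.single i j (star a)) := by
    intro i j a hij ha
    set v : Fin (n + 1) → ℍ := Function.update (Pi.single i 1) j a with hv
    have hvi : v i = 1 := by rw [hv, Function.update_of_ne hij, Pi.single_eq_same]
    have hvj : v j = a := by rw [hv, Function.update_self]
    have hv0 : v ≠ 0 := fun h => by simpa [hvi] using congrFun h i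
    have hN : (vecNormSq v) ≠ 0 := (vecNormSq_pos hv0).ne'
    have key : Matrix.single i j (star a) =
        vecNormSq v • (Matrix.single i i 1 * (HP.ofVec v).projMat * Matrix.single j j 1) := by
      rw [HP.projMat_ofVec hv0, Matrix.single_mul_mul_single, vecProj, hvi, hvj, Matrix.smul_single,
        one_mul, one_mul, mul_one, smul_smul, mul_inv_cancel₀ hN, one_smul]
    rw [key]
    exact hsmul _ _ (hmul _ _ (hmul _ _ (h1 i) (hproj _)) (h1 j))
  have h3 : ∀ (i j : Fin (n + 1)) (a : ℍ), i ≠ j → Quaternion.normSq a = 1 →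
      p (Matrix.single i j a) := by
    intro i j a hij ha
    rw [← star_star a]
    exact h2 i j _ hij (by rw [Quaternion.normSq_star, ha])
  by_cases hij : i = j
  · subst hij
    -- Diagonal units are products `E_ik(u) E_ki(1)` through a second index `k`. For `n = 0` the
    -- only projection is the identity.
    have : Nontrivial (Fin (n + 1)) := Fin.nontrivial_iff_two_le.2 (by omega)
    obtain ⟨k, hk⟩ := exists_ne i
    have := hmul _ _ (h3 i k _ hk.symm (normSq_quatBasis u)) (h3 k i 1 hk (by simp))
    rwa [Matrix.single_mul_single_same, mul_one] at this
  · exact h3 i j _ hij (normSq_quatBasis u)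

/-- `A ↦ 4 Re tr(A* C) A` depends only on conjugation by `A`. -/
theorem sum_conj_mul {n : ℕ} (A C : Matrix (Fin (n + 1)) (Fin (n + 1)) ℍ) :
    ∑ u, ∑ i, ∑ j, (A * Matrix.single i j (quatBasis u) * star A) * C *
      star (Matrix.single i j (quatBasis u)) = (4 * ∑ j, ((star A * C) j j).re) • A := by
  have := congrArg (A * ·) (sum_single_conj (star A * C))
  simp only [Matrix.mul_smul, mul_one, Finset.mul_sum] at this
  rw [← Finset.mul_sum] at this
  rw [← this]
  simp only [mul_assoc]

theorem Sp.star_mul {n : ℕ} (A : Sp n) : star A.1 * A.1 = 1 := (Unitary.mem_iff.1 A.2).1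

theorem Sp.mul_star {n : ℕ} (A : Sp n) : A.1 * star A.1 = 1 := (Unitary.mem_iff.1 A.2).2

theorem Sp.conj_mul {n : ℕ} (A : Sp n) (X Y : Matrix (Fin (n + 1)) (Fin (n + 1)) ℍ) :
    A.1 * (X * Y) * star A.1 = A.1 * X * star A.1 * (A.1 * Y * star A.1) := by
  rw [mul_assoc (A.1 * X), ← mul_assoc (star A.1), ← mul_assoc (star A.1), Sp.star_mul, one_mul]
  simp only [mul_assoc]

theorem Sp.sum_normSq_row {n : ℕ} (A : Sp n) (i : Fin (n + 1)) :
    ∑ j, Quaternion.normSq (A.1 i j) = 1 := by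
  have h := congrFun (congrFun (Sp.mul_star A) i) i
  rw [Matrix.mul_apply, Matrix.one_apply_eq] at h
  simp only [Matrix.star_apply, Quaternion.self_mul_star] at h
  refine Quaternion.coe_injective (Eq.trans ?_ (h.trans Quaternion.coe_one.symm))
  exact map_sum (⟨⟨fun r : ℝ => (r : ℍ), Quaternion.coe_zero⟩, Quaternion.coe_add⟩ : ℝ →+ ℍ) _ _

theorem Sp.coe_neg {n : ℕ} (A : Sp n) : (-A).1 = -A.1 := rfl

theorem Sp.neg_smul {n : ℕ} (A : Sp n) (x : HP n) : (-A) • x = A • x := by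
  obtain ⟨v, hv, rfl⟩ := x.exists_ofVec
  rw [HP.Sp_smul_ofVec _ hv, HP.Sp_smul_ofVec _ hv,
    HP.ofVec_eq_iff (Sp.mulVec_ne_zero _ hv) (Sp.mulVec_ne_zero _ hv)]
  refine ⟨-1, by simp, fun i => ?_⟩
  rw [Sp.coe_neg, Matrix.neg_mulVec]; simp

/-- Only `±A` acts in the same way as `A` on `HP^n`. -/
theorem Sp.eq_or_eq_neg_of_smul_eq {n : ℕ} (hn : 1 ≤ n) {A B : Sp n}
    (h : ∀ x : HP n, A • x = B • x) : A = B ∨ A = -B := by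
  have hX := HP.projMat_induction hn
    (p := fun X => A.1 * X * star A.1 = B.1 * X * star B.1)
    (fun x => by rw [← HP.projMat_Sp_smul, h, HP.projMat_Sp_smul])
    (fun X Y hX hY => by rw [Sp.conj_mul, Sp.conj_mul, hX, hY])
    (fun r X hX => by
      simp only [Matrix.mul_smul, Matrix.smul_mul, hX])
  -- Taking `C = A`, the averaged sum is `4(n+1) A`. Conjugation by `B` agrees with that by `A`, so
  -- the same sum is also a real multiple of `B`; as rows have norm `1`, the factor is `±1`.
  have h1 := sum_conj_mul A.1 A.1
  simp only [hX] at h1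
  rw [sum_conj_mul, Sp.star_mul] at h1
  simp only [Matrix.one_apply_eq, Quaternion.re_one, Finset.sum_const, Finset.card_univ,
    Fintype.card_fin, nsmul_eq_mul, mul_one] at h1
  have hm : 4 * ((n + 1 : ℕ) : ℝ) ≠ 0 := by positivity
  generalize 4 * ∑ j, ((star B.1 * A.1) j j).re = c at h1
  generalize 4 * ((n + 1 : ℕ) : ℝ) = m at h1 hm
  have h2 : A.1 = (m⁻¹ * c) • B.1 := by
    rw [mul_smul, h1, smul_smul, inv_mul_cancel₀ hm, one_smul]
  have h3 : (m⁻¹ * c) * (m⁻¹ * c) = 1 := by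
    have := Sp.sum_normSq_row A 0
    rw [h2] at this
    simp only [Matrix.smul_apply, Quaternion.normSq_smul, ← Finset.mul_sum,
      Sp.sum_normSq_row B 0, mul_one] at this
    rw [← sq]; exact this
  rcases mul_self_eq_one_iff.1 h3 with h4 | h4
  · left; refine Subtype.ext (h2.trans ?_); rw [h4, one_smul]
  · right; refine Subtype.ext (h2.trans ?_); rw [h4, neg_one_smul, Sp.coe_neg]

/-! ### Smooth families of linear maps and their local lifts -/

/-- Entrywise smoothness of a family of matrices in `Sp(n+1)`. -/
def SmoothSpOn {n : ℕ} (h : ℂ → Sp n) (U : Set ℂ) : Prop :=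
  ∀ i j, ContDiffOn ℝ ∞ (fun z => (h z).1 i j) U

/-- A smooth family of linear maps of `HP^n`, without a choice of matrices. -/
structure IsLinearFamilyOn {n : ℕ} (F : ℂ → HP n → HP n) (U : Set ℂ) : Prop where
  smooth : ContMDiffOn (𝓘(ℝ, ℂ).prod (modelHP n)) (modelHP n) ∞
    (fun p : ℂ × HP n => F p.1 p.2) (U ×ˢ univ)
  linear : ∀ z ∈ U, ∃ A : Sp n, ∀ x, F z x = A • x

/-- `h` lifts the family `F` over `U`. -/
def IsLiftOn {n : ℕ} (F : ℂ → HP n → HP n) (h : ℂ → Sp n) (U : Set ℂ) : Prop :=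
  SmoothSpOn h U ∧ ∀ z ∈ U, ∀ x, F z x = h z • x

theorem contDiffOn_matMul {m : ℕ} {U : Set ℂ} {X Y : ℂ → Matrix (Fin m) (Fin m) ℍ}
    (hX : ∀ i j, ContDiffOn ℝ ∞ (fun z => X z i j) U)
    (hY : ∀ i j, ContDiffOn ℝ ∞ (fun z => Y z i j) U) (i j : Fin m) :
    ContDiffOn ℝ ∞ (fun z => (X z * Y z) i j) U := by
  simp only [Matrix.mul_apply]
  exact ContDiffOn.sum fun k _ => (hX i k).mul (hY k j)

/-- Matrices `A z` are chosen pointwise, without any continuity. With `c z = 4 Re tr(A(z)* A(z₀))`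
the product `c z • A z` depends only on conjugation by `A z`, so it is smooth; normalizing it near
`z₀`, where `c ≠ 0`, gives the lift. -/
theorem IsLinearFamilyOn.exists_local_lift {n : ℕ} (hn : 1 ≤ n) {F : ℂ → HP n → HP n} {U : Set ℂ}
    (hU : IsOpen U) (hF : IsLinearFamilyOn F U) {z₀ : ℂ} (hz₀ : z₀ ∈ U) :
    ∃ V : Set ℂ, IsOpen V ∧ z₀ ∈ V ∧ V ⊆ U ∧ ∃ h : ℂ → Sp n, IsLiftOn F h V := by
  classical
  have hA : ∃ A : ℂ → Sp n, ∀ z ∈ U, ∀ x, F z x = A z • x := by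
    choose! A hA using hF.linear
    exact ⟨A, hA⟩
  obtain ⟨A, hA⟩ := hA
  have hX := HP.projMat_induction hn
    (p := fun X => ∀ i j, ContDiffOn ℝ ∞ (fun z => ((A z).1 * X * star (A z).1) i j) U)
    (fun x i j => by
      have h1 : ContMDiffOn 𝓘(ℝ, ℂ) (𝓘(ℝ, ℂ).prod (modelHP n)) ∞ (fun z : ℂ => (z, x)) U :=
        contMDiffOn_id.prodMk contMDiffOn_const
      have h2 := (HP.contMDiff_projMat i j).comp_contMDiffOn
        (hF.smooth.comp h1 fun z hz => ⟨hz, mem_univ _⟩)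
      refine (contMDiffOn_iff_contDiffOn.1 h2).congr fun z hz => ?_
      rw [← HP.projMat_Sp_smul, ← hA z hz]; rfl)
    (fun X Y hX hY i j => by
      refine (contDiffOn_matMul hX hY i j).congr fun z _ => ?_
      rw [Sp.conj_mul])
    (fun r X hX i j => by
      simp only [Matrix.mul_smul, Matrix.smul_mul, Matrix.smul_apply]
      exact (hX i j).const_smul r)
  set c : ℂ → ℝ := fun z => 4 * ∑ j, ((star (A z).1 * (A z₀).1) j j).re with hc
  have hS : ∀ i j, ContDiffOn ℝ ∞ (fun z => (c z • (A z).1) i j) U := by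
    intro a b
    have h1 : ∀ z, c z • (A z).1 = ∑ u, ∑ i, ∑ j,
        ((A z).1 * Matrix.single i j (quatBasis u) * star (A z).1) * (A z₀).1 *
          star (Matrix.single i j (quatBasis u)) := fun z => (sum_conj_mul _ _).symm
    refine ContDiffOn.congr (f := fun z => ∑ u, ∑ i, ∑ j,
        (((A z).1 * Matrix.single i j (quatBasis u) * star (A z).1) * (A z₀).1 *
          star (Matrix.single i j (quatBasis u)) : Matrix _ _ ℍ) a b) ?_ fun z _ => ?_
    · refine ContDiffOn.sum fun u _ => ContDiffOn.sum fun i _ => ContDiffOn.sum fun j _ => ?_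
      refine contDiffOn_matMul (Y := fun _ => star (Matrix.single i j (quatBasis u)))
        (fun a b => ?_) (fun _ _ => contDiffOn_const) a b
      exact contDiffOn_matMul (Y := fun _ => (A z₀).1) (hX i j u)
        (fun _ _ => contDiffOn_const) a b
    · rw [h1]; simp only [Matrix.sum_apply]
  -- `c` itself may jump in sign with the choice of `A`, but `c²` is the squared norm of a row of
  -- the smooth matrix `c • A`.
  have hc2 : ContDiffOn ℝ ∞ (fun z => c z ^ 2) U := by
    have h1 : ∀ z, c z ^ 2 = ∑ j, Quaternion.normSq ((c z • (A z).1) 0 j) := by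
      intro z
      simp only [Matrix.smul_apply, Quaternion.normSq_smul, ← Finset.mul_sum,
        Sp.sum_normSq_row, mul_one]
    simp only [h1]
    exact ContDiffOn.sum fun j _ => contDiff_quatNormSq.comp_contDiffOn (hS 0 j)
  -- Where `c ≠ 0`, dividing `c • A` by `|c| = √(c²)` leaves `±A`, which acts in the same way as
  -- `A`.
  refine ⟨U ∩ (fun z => c z ^ 2) ⁻¹' Ioi 0, hc2.continuousOn.isOpen_inter_preimage hU isOpen_Ioi,
    ⟨hz₀, ?_⟩, inter_subset_left, fun z => if c z < 0 then -A z else A z, ?_, ?_⟩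
  · have : c z₀ = 4 * ((n + 1 : ℕ) : ℝ) := by
      simp only [hc, Sp.star_mul, Matrix.one_apply_eq,
        Quaternion.re_one, Finset.sum_const, Finset.card_univ, Fintype.card_fin, nsmul_eq_mul,
        mul_one]
    change 0 < c z₀ ^ 2
    rw [this]; positivity
  · intro i j
    have h1 : ContDiffOn ℝ ∞ (fun z => (Real.sqrt (c z ^ 2))⁻¹)
        (U ∩ (fun z => c z ^ 2) ⁻¹' Ioi 0) := by
      refine ContDiffOn.inv ?_ fun z hz => (Real.sqrt_pos.2 hz.2).ne'
      exact (hc2.mono inter_subset_left).sqrt fun z hz => (ne_of_gt hz.2)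
    refine (h1.smul ((hS i j).mono inter_subset_left)).congr fun z hz => ?_
    have hz' : c z ≠ 0 := fun h => by
      have := hz.2; simp [h] at this
    change (if c z < 0 then -A z else A z).1 i j = (Real.sqrt (c z ^ 2))⁻¹ • c z • (A z).1 i j
    rw [Real.sqrt_sq_eq_abs, smul_smul]
    split_ifs with hneg
    · rw [abs_of_neg hneg, inv_neg, neg_mul, inv_mul_cancel₀ hz', neg_one_smul]; rfl
    · rw [abs_of_nonneg (not_lt.1 hneg), inv_mul_cancel₀ hz', one_smul]
  · intro z hz x
    rw [hA z hz.1]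
    change _ = (if c z < 0 then -A z else A z) • x
    split_ifs
    · rw [Sp.neg_smul]
    · rfl

/-! ### Induction over intervals and rectangles -/

open scoped ComplexConjugate
open Complex (reProdIm mem_reProdIm)

/-- A connectedness argument, with `Q x y` read as a property of the open interval from `x` to `y`.
The right ends that can be reached from slightly left of `a` form a set that contains `a`, is closed
by merging with a local interval at a limit point, and is open to the right because of the margin
`ε`. -/
theorem interval_induction {Q : ℝ → ℝ → Prop} {a b : ℝ} (hab : a ≤ b)
    (mono : ∀ x y x' y', x ≤ x' → y' ≤ y → Q x y → Q x' y')
    (loc : ∀ x ∈ Icc a b, ∃ δ > 0, Q (x - δ) (x + δ))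
    (merge : ∀ x y x' y', x < x' → x' < y → y < y' → Q x y → Q x' y' → Q x y') :
    ∃ ε > 0, Q (a - ε) (b + ε) := by
  set s : Set ℝ := {x | ∃ ε > 0, Q (a - ε) (x + ε)} with hs
  suffices h : Icc a b ⊆ s from h (right_mem_Icc.2 hab)
  refine IsClosed.Icc_subset_of_forall_mem_nhdsWithin ?_ (loc a (left_mem_Icc.2 hab)) ?_
  · refine isClosed_of_closure_subset fun x hx => ?_
    have hxI : x ∈ Icc a b := isClosed_Icc.closure_subset (closure_mono inter_subset_right hx)
    refine ⟨?_, hxI⟩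
    obtain ⟨δ, hδ, hQ⟩ := loc x hxI
    obtain ⟨y, ⟨⟨ε, hε, hy⟩, hyI⟩, hxy⟩ := Metric.mem_closure_iff.1 hx δ hδ
    rw [Real.dist_eq, abs_lt] at hxy
    set ε' := min ε (δ / 2) with hε'
    have h1 : 0 < ε' := by positivity
    have h2 : ε' ≤ ε := min_le_left _ _
    have h3 : ε' ≤ δ / 2 := min_le_right _ _
    rcases le_or_gt x y with hle | hlt
    · exact ⟨ε, hε, mono _ _ _ _ le_rfl (by linarith) hy⟩
    · have h4 : Q (a - ε') (y + ε') := mono _ _ _ _ (by linarith) (by linarith) hy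
      -- The left end is cut off so as to lie strictly to the right of `a - ε'`, as merging demands.
      have h5 : Q (max (x - δ) (a - ε' / 2)) (x + δ) :=
        mono _ _ _ _ (le_max_left _ _) le_rfl hQ
      have h6 := merge _ _ _ _ (lt_max_of_lt_right (by linarith))
        (max_lt (by linarith) (by linarith [hyI.1])) (by linarith) h4 h5
      exact ⟨ε', h1, mono _ _ _ _ le_rfl (by linarith) h6⟩
  · rintro x ⟨⟨ε, hε, hx⟩, -⟩
    filter_upwards [mem_nhdsWithin_of_mem_nhds (Iio_mem_nhds (show x < x + ε / 2 by linarith))]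
      with y hy
    exact ⟨ε / 2, by positivity, mono _ _ _ _ (by linarith) (by linarith [mem_Iio.1 hy]) hx⟩

theorem reProdIm_mono {s s' t t' : Set ℝ} (hs : s ⊆ s') (ht : t ⊆ t') :
    s ×ℂ t ⊆ s' ×ℂ t' := fun _ h => ⟨hs h.1, ht h.2⟩

theorem isOpen_reProdIm {s t : Set ℝ} (hs : IsOpen s) (ht : IsOpen t) : IsOpen (s ×ℂ t) :=
  hs.reProdIm ht

/-- The interval argument is run twice: along each horizontal line, where the height of the strip
may shrink at every merge, and then over the heights, with whole strips as pieces. -/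
theorem rect_induction {P : Set ℂ → Prop} {a b c d : ℝ} (hab : a ≤ b) (hcd : c ≤ d)
    (mono : ∀ U V, U ⊆ V → P V → P U)
    (loc : ∀ z ∈ Icc a b ×ℂ Icc c d, ∃ U ∈ 𝓝 z, P U)
    (mergex : ∀ x y x' y' c d : ℝ, x < x' → x' < y → y < y' → P (Ioo x y ×ℂ Ioo c d) →
      P (Ioo x' y' ×ℂ Ioo c d) → P (Ioo x y' ×ℂ Ioo c d))
    (mergey : ∀ x y x' y' c d : ℝ, x < x' → x' < y → y < y' → P (Ioo c d ×ℂ Ioo x y) →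
      P (Ioo c d ×ℂ Ioo x' y') → P (Ioo c d ×ℂ Ioo x y')) :
    ∃ ε > 0, P (Ioo (a - ε) (b + ε) ×ℂ Ioo (c - ε) (d + ε)) := by
  have hloc : ∀ x ∈ Icc a b, ∀ y ∈ Icc c d, ∃ δ > 0,
      P (Ioo (x - δ) (x + δ) ×ℂ Ioo (y - δ) (y + δ)) := by
    intro x hx y hy
    obtain ⟨U, hU, hP⟩ := loc ⟨x, y⟩ ⟨hx, hy⟩
    obtain ⟨r, hr, hrU⟩ := Metric.mem_nhds_iff.1 hU
    refine ⟨r / 2, by positivity, mono _ _ (fun z hz => hrU ?_) hP⟩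
    obtain ⟨⟨h1, h2⟩, h3, h4⟩ := hz
    have h5 : |(z - ⟨x, y⟩ : ℂ).re| < r / 2 := by
      rw [Complex.sub_re, abs_lt]; constructor <;> simp only <;> linarith
    have h6 : |(z - ⟨x, y⟩ : ℂ).im| < r / 2 := by
      rw [Complex.sub_im, abs_lt]; constructor <;> simp only <;> linarith
    rw [Metric.mem_ball, dist_eq_norm]
    linarith [Complex.norm_le_abs_re_add_abs_im (z - ⟨x, y⟩ : ℂ)]
  have hrow : ∀ y ∈ Icc c d, ∃ δ > 0, ∃ ε > 0,
      P (Ioo (a - ε) (b + ε) ×ℂ Ioo (y - δ) (y + δ)) := by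
    intro y hy
    obtain ⟨ε, hε, δ, hδ, h⟩ := interval_induction
      (Q := fun x x' => ∃ δ > 0, P (Ioo x x' ×ℂ Ioo (y - δ) (y + δ))) hab
      (fun x z x' z' h1 h2 ⟨δ, hδ, h⟩ =>
        ⟨δ, hδ, mono _ _ (reProdIm_mono (Ioo_subset_Ioo h1 h2) Subset.rfl) h⟩)
      (fun x hx => by
        obtain ⟨δ, hδ, h⟩ := hloc x hx y hy
        exact ⟨δ, hδ, δ, hδ, h⟩)
      (fun x z x' z' h1 h2 h3 ⟨δ, hδ, h⟩ ⟨δ', hδ', h'⟩ => by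
        refine ⟨min δ δ', lt_min hδ hδ', mergex _ _ _ _ _ _ h1 h2 h3
          (mono _ _ (reProdIm_mono Subset.rfl (Ioo_subset_Ioo ?_ ?_)) h)
          (mono _ _ (reProdIm_mono Subset.rfl (Ioo_subset_Ioo ?_ ?_)) h')⟩ <;>
        linarith [min_le_left δ δ', min_le_right δ δ'])
    exact ⟨δ, hδ, ε, hε, h⟩
  obtain ⟨δ, hδ, ε, hε, h⟩ := interval_induction
    (Q := fun y y' => ∃ ε > 0, P (Ioo (a - ε) (b + ε) ×ℂ Ioo y y')) hcd
    (fun x z x' z' h1 h2 ⟨δ, hδ, h⟩ =>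
      ⟨δ, hδ, mono _ _ (reProdIm_mono Subset.rfl (Ioo_subset_Ioo h1 h2)) h⟩)
    hrow
    (fun x z x' z' h1 h2 h3 ⟨δ, hδ, h⟩ ⟨δ', hδ', h'⟩ => by
      refine ⟨min δ δ', lt_min hδ hδ', mergey _ _ _ _ _ _ h1 h2 h3
        (mono _ _ (reProdIm_mono (Ioo_subset_Ioo ?_ ?_) Subset.rfl) h)
        (mono _ _ (reProdIm_mono (Ioo_subset_Ioo ?_ ?_) Subset.rfl) h')⟩ <;>
      linarith [min_le_left δ δ', min_le_right δ δ'])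
  refine ⟨min δ ε, lt_min hδ hε,
    mono _ _ (reProdIm_mono (Ioo_subset_Ioo ?_ ?_) (Ioo_subset_Ioo ?_ ?_)) h⟩ <;>
  linarith [min_le_left δ ε, min_le_right δ ε]

/-! ### Lifts over rectangles -/

theorem SmoothSpOn.mono {n : ℕ} {h : ℂ → Sp n} {U V : Set ℂ} (hh : SmoothSpOn h U) (hV : V ⊆ U) :
    SmoothSpOn h V := fun i j => (hh i j).mono hV

theorem SmoothSpOn.congr {n : ℕ} {h h' : ℂ → Sp n} {U : Set ℂ} (hh : SmoothSpOn h U)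
    (he : ∀ z ∈ U, h' z = h z) : SmoothSpOn h' U :=
  fun i j => (hh i j).congr fun z hz => by rw [he z hz]

theorem SmoothSpOn.neg {n : ℕ} {h : ℂ → Sp n} {U : Set ℂ} (hh : SmoothSpOn h U) :
    SmoothSpOn (fun z => -h z) U := fun i j => (hh i j).neg

theorem SmoothSpOn.mul {n : ℕ} {h h' : ℂ → Sp n} {U : Set ℂ} (hh : SmoothSpOn h U)
    (hh' : SmoothSpOn h' U) : SmoothSpOn (fun z => h z * h' z) U :=
  contDiffOn_matMul (X := fun z => (h z).1) (Y := fun z => (h' z).1) hh hh'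

theorem Sp.coe_inv {n : ℕ} (A : Sp n) : (A⁻¹).1 = star A.1 := rfl

theorem SmoothSpOn.inv {n : ℕ} {h : ℂ → Sp n} {U : Set ℂ} (hh : SmoothSpOn h U) :
    SmoothSpOn (fun z => (h z)⁻¹) U :=
  fun i j => contDiff_quatStar.comp_contDiffOn (hh j i)

theorem SmoothSpOn.comp {n : ℕ} {h : ℂ → Sp n} {U V : Set ℂ} (hh : SmoothSpOn h U)
    {φ : ℂ → ℂ} (hφ : ContDiffOn ℝ ∞ φ V) (hm : MapsTo φ V U) :
    SmoothSpOn (fun z => h (φ z)) V := fun i j => (hh i j).comp hφ hm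

theorem SmoothSpOn.union {n : ℕ} {h : ℂ → Sp n} {U V : Set ℂ} (hU : SmoothSpOn h U)
    (hV : SmoothSpOn h V) (oU : IsOpen U) (oV : IsOpen V) : SmoothSpOn h (U ∪ V) :=
  fun i j => (hU i j).union_of_isOpen (hV i j) oU oV

theorem SmoothSpOn.continuousOn {n : ℕ} {h : ℂ → Sp n} {U : Set ℂ} (hh : SmoothSpOn h U) :
    ContinuousOn (fun z => (h z).1) U :=
  continuousOn_pi.2 fun i => continuousOn_pi.2 fun j => (hh i j).continuousOn

/-- Two continuous families in `Sp(n+1)` that agree up to sign agree up to a global sign. -/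
theorem Sp.eq_or_eq_neg_of_isPreconnected {n : ℕ} {X : Type*} [TopologicalSpace X]
    {h h' : X → Sp n} {U : Set X}
    (hU : IsPreconnected U) (hc : ContinuousOn (fun z => (h z).1) U)
    (hc' : ContinuousOn (fun z => (h' z).1) U) (hs : ∀ z ∈ U, h z = h' z ∨ h z = -h' z) :
    (∀ z ∈ U, h z = h' z) ∨ ∀ z ∈ U, h z = -h' z := by
  have hn : (((n + 1 : ℕ) : ℝ)) ≠ 0 := by positivity
  set s : X → ℝ := fun z => (((n + 1 : ℕ) : ℝ))⁻¹ * ∑ j, ((star (h' z).1 * (h z).1) j j).re with hsd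
  have h1 : ∀ z, h z = h' z → s z = 1 := by
    intro z hz
    simp only [hsd, hz, Sp.star_mul, Matrix.one_apply_eq, Quaternion.re_one, Finset.sum_const,
      Finset.card_univ, Fintype.card_fin, nsmul_eq_mul, mul_one]
    exact inv_mul_cancel₀ hn
  have h2 : ∀ z, h z = -h' z → s z = -1 := by
    intro z hz
    simp only [hsd, hz, Sp.coe_neg, Sp.star_mul, Matrix.neg_apply,
      Matrix.one_apply_eq, Quaternion.re_neg, Quaternion.re_one, Finset.sum_const,
      Finset.card_univ, Fintype.card_fin, nsmul_eq_mul, mul_neg, mul_one]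
    rw [inv_mul_cancel₀ hn]
  have hcs : ContinuousOn s U := by
    refine continuousOn_const.mul (continuousOn_finsetSum _ fun j _ => ?_)
    have : ContinuousOn (fun z => star (h' z).1 * (h z).1) U := hc'.star.mul hc
    exact Quaternion.continuous_re.comp_continuousOn
      (continuousOn_pi.1 (continuousOn_pi.1 this j) j)
  have hsq : EqOn (s ^ 2) 1 U := fun z hz => by
    rcases hs z hz with h | h
    · simp [h1 z h]
    · simp [h2 z h]
  rcases hU.eq_one_or_eq_neg_one_of_sq_eq hcs hsq with h | h
  · left; intro z hz
    refine (hs z hz).resolve_right fun h' => ?_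
    have := h hz
    rw [h2 z h'] at this; norm_num at this
  · right; intro z hz
    refine (hs z hz).resolve_left fun h' => ?_
    have := h hz
    rw [h1 z h'] at this; norm_num at this

theorem IsLiftOn.mono {n : ℕ} {F : ℂ → HP n → HP n} {h : ℂ → Sp n} {U V : Set ℂ}
    (hh : IsLiftOn F h U) (hV : V ⊆ U) : IsLiftOn F h V :=
  ⟨hh.1.mono hV, fun z hz => hh.2 z (hV hz)⟩

theorem IsLiftOn.eq_or_eq_neg {n : ℕ} (hn : 1 ≤ n) {F : ℂ → HP n → HP n} {h h' : ℂ → Sp n}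
    {U : Set ℂ} (hU : IsPreconnected U) (hh : IsLiftOn F h U) (hh' : IsLiftOn F h' U) :
    (∀ z ∈ U, h z = h' z) ∨ ∀ z ∈ U, h z = -h' z :=
  Sp.eq_or_eq_neg_of_isPreconnected hU hh.1.continuousOn hh'.1.continuousOn fun z hz =>
    Sp.eq_or_eq_neg_of_smul_eq hn fun x => (hh.2 z hz x).symm.trans (hh'.2 z hz x)

/-- On a connected overlap two lifts differ by one global sign. Negating the second lift if
necessary does not change its action and makes the two agree, so they glue. -/
theorem exists_isLiftOn_union {n : ℕ} (hn : 1 ≤ n) {F : ℂ → HP n → HP n} {U V : Set ℂ}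
    (oU : IsOpen U) (oV : IsOpen V) (hUV : IsPreconnected (U ∩ V))
    (hU : ∃ h, IsLiftOn F h U) (hV : ∃ h, IsLiftOn F h V) : ∃ h, IsLiftOn F h (U ∪ V) := by
  classical
  obtain ⟨h, hh⟩ := hU
  obtain ⟨h', hh'⟩ := hV
  have key : ∃ h'', IsLiftOn F h'' V ∧ ∀ z ∈ U ∩ V, h z = h'' z := by
    rcases (hh.mono inter_subset_left).eq_or_eq_neg hn hUV (hh'.mono inter_subset_right) with e | e
    · exact ⟨h', hh', e⟩
    · exact ⟨fun z => -h' z, ⟨hh'.1.neg, fun z hz x => by rw [Sp.neg_smul, hh'.2 z hz x]⟩, e⟩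
  obtain ⟨h'', hh'', he⟩ := key
  have e1 : ∀ z ∈ U, (if z ∈ U then h z else h'' z) = h z := fun z hz => if_pos hz
  have e2 : ∀ z ∈ V, (if z ∈ U then h z else h'' z) = h'' z := fun z hz => by
    split_ifs with hzU
    · exact he z ⟨hzU, hz⟩
    · rfl
  refine ⟨fun z => if z ∈ U then h z else h'' z,
    (hh.1.congr e1).union (hh''.1.congr e2) oU oV, fun z hz x => ?_⟩
  rcases hz with hz | hz
  · simp only [e1 z hz, hh.2 z hz]
  · simp only [e2 z hz, hh''.2 z hz]

theorem isPreconnected_rect (a b c d : ℝ) : IsPreconnected (Ioo a b ×ℂ Ioo c d) :=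
  (((convex_Ioo a b).linear_preimage Complex.reLm).inter
    ((convex_Ioo c d).linear_preimage Complex.imLm)).isPreconnected

/-- Rectangles are glued along rectangles, so every overlap is connected and no sign obstruction
arises. The margin `ε` later provides the overlap strip over which a period is closed up. -/
theorem IsLinearFamilyOn.exists_lift_rect {n : ℕ} (hn : 1 ≤ n) {F : ℂ → HP n → HP n} {W : Set ℂ}
    (hW : IsOpen W) (hF : IsLinearFamilyOn F W) {a b c d : ℝ} (hab : a ≤ b) (hcd : c ≤ d)
    (hK : Icc a b ×ℂ Icc c d ⊆ W) :
    ∃ ε > 0, ∃ h : ℂ → Sp n, IsLiftOn F h (Ioo (a - ε) (b + ε) ×ℂ Ioo (c - ε) (d + ε)) := by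
  refine rect_induction (P := fun U => ∃ h : ℂ → Sp n, IsLiftOn F h U) hab hcd ?_ ?_ ?_ ?_
  · rintro U V hUV ⟨h, hh⟩; exact ⟨h, hh.mono hUV⟩
  · intro z hz
    obtain ⟨V, oV, hzV, -, h⟩ := hF.exists_local_lift hn hW (hK hz)
    exact ⟨V, oV.mem_nhds hzV, h⟩
  · intro x y x' y' c d h1 h2 h3 hU hV
    have oU := isOpen_reProdIm (isOpen_Ioo (a := x) (b := y)) (isOpen_Ioo (a := c) (b := d))
    have oV := isOpen_reProdIm (isOpen_Ioo (a := x') (b := y')) (isOpen_Ioo (a := c) (b := d))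
    have hc : IsPreconnected ((Ioo x y ×ℂ Ioo c d) ∩ (Ioo x' y' ×ℂ Ioo c d)) := by
      convert isPreconnected_rect x' y c d using 1
      ext z; simp only [mem_inter_iff, mem_reProdIm, mem_Ioo]
      constructor
      · rintro ⟨⟨⟨_, _⟩, _⟩, ⟨_, _⟩, _⟩; refine ⟨⟨?_, ?_⟩, ?_⟩ <;> assumption
      · rintro ⟨⟨_, _⟩, h⟩; refine ⟨⟨⟨?_, ?_⟩, h⟩, ⟨?_, ?_⟩, h⟩ <;> linarith
    obtain ⟨h, hh⟩ := exists_isLiftOn_union hn oU oV hc hU hV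
    refine ⟨h, hh.mono ?_⟩
    rintro z ⟨⟨h4, h5⟩, h6⟩
    rcases lt_or_ge z.re y with h7 | h7
    · exact Or.inl ⟨⟨h4, h7⟩, h6⟩
    · exact Or.inr ⟨⟨h2.trans_le h7, h5⟩, h6⟩
  · intro x y x' y' c d h1 h2 h3 hU hV
    have oU := isOpen_reProdIm (isOpen_Ioo (a := c) (b := d)) (isOpen_Ioo (a := x) (b := y))
    have oV := isOpen_reProdIm (isOpen_Ioo (a := c) (b := d)) (isOpen_Ioo (a := x') (b := y'))
    have hc : IsPreconnected ((Ioo c d ×ℂ Ioo x y) ∩ (Ioo c d ×ℂ Ioo x' y')) := by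
      convert isPreconnected_rect c d x' y using 1
      ext z; simp only [mem_inter_iff, mem_reProdIm, mem_Ioo]
      constructor
      · rintro ⟨⟨_, _, _⟩, _, _, _⟩; refine ⟨?_, ?_, ?_⟩ <;> assumption
      · rintro ⟨h, _, _⟩; refine ⟨⟨h, ?_, ?_⟩, h, ?_, ?_⟩ <;> linarith
    obtain ⟨h, hh⟩ := exists_isLiftOn_union hn oU oV hc hU hV
    refine ⟨h, hh.mono ?_⟩
    rintro z ⟨h6, h4, h5⟩
    rcases lt_or_ge z.im y with h7 | h7
    · exact Or.inl ⟨h6, h4, h7⟩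
    · exact Or.inr ⟨h6, h2.trans_le h7, h5⟩

/-! ### Extending maps from an annulus to `Sp(n+1)` over the disc -/

/-- The matrix `1 - u c u*`. -/
def quasiReflection {n : ℕ} (u : Fin (n + 1) → ℍ) (c : ℍ) :
    Matrix (Fin (n + 1)) (Fin (n + 1)) ℍ :=
  fun i j => (if i = j then 1 else 0) - u i * c * star (u j)

/-- For fixed `u` these matrices are closed under products and adjoints, so unitarity becomes an
equation between quaternions, `c + c* = c |u|² c*`, together with its mirror image. -/
theorem quasiReflection_mul {n : ℕ} (u : Fin (n + 1) → ℍ) (c c' : ℍ) :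
    quasiReflection u c * quasiReflection u c' =
      quasiReflection u (c + c' - c * ((vecNormSq u : ℝ) : ℍ) * c') := by
  ext1 i j
  rw [Matrix.mul_apply]
  simp only [quasiReflection, mul_sub, sub_mul, Finset.sum_sub_distrib, ite_mul, mul_ite, one_mul,
    mul_one, zero_mul, mul_zero, Finset.sum_ite_eq, Finset.sum_ite_eq', Finset.mem_univ, if_true]
  have h : ∑ k, u i * c * star (u k) * (u k * c' * star (u j)) =
      u i * (c * ((vecNormSq u : ℝ) : ℍ) * c') * star (u j) := by
    rw [coe_vecNormSq]
    simp only [Finset.mul_sum, Finset.sum_mul, mul_assoc]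
  rw [h, mul_add, add_mul]
  abel

theorem star_quasiReflection {n : ℕ} (u : Fin (n + 1) → ℍ) (c : ℍ) :
    star (quasiReflection u c) = quasiReflection u (star c) := by
  ext1 i j
  simp only [Matrix.star_apply, quasiReflection, star_sub, star_mul, star_star, mul_assoc]
  congr 1
  by_cases h : i = j
  · subst h; simp
  · rw [if_neg h, if_neg (Ne.symm h), star_zero]

theorem quasiReflection_zero {n : ℕ} (u : Fin (n + 1) → ℍ) : quasiReflection u 0 = 1 := by
  ext1 i j
  simp [quasiReflection, Matrix.one_apply]

theorem quasiReflection_mulVec {n : ℕ} (u : Fin (n + 1) → ℍ) (c : ℍ) (v : Fin (n + 1) → ℍ)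
    (i : Fin (n + 1)) :
    (quasiReflection u c *ᵥ v) i = v i - u i * (c * ∑ j, star (u j) * v j) := by
  simp only [quasiReflection, Matrix.mulVec, dotProduct, sub_mul, Finset.sum_sub_distrib, ite_mul,
    one_mul, zero_mul, Finset.sum_ite_eq, Finset.mem_univ, if_true, Finset.mul_sum, mul_assoc]

/-- For unit vectors `p`, `w`, the quasi-reflection that takes `p` to `w`. -/
def rotTo {n : ℕ} (p w : Fin (n + 1) → ℍ) : Matrix (Fin (n + 1)) (Fin (n + 1)) ℍ :=
  quasiReflection (w - p) (1 - ∑ j, star (w j) * p j)⁻¹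

/-- With `d = 1 - w*p` this reads `|w - p|² = d + d*`, which is what makes `c = d⁻¹` solve the
unitarity equation for `u = w - p`. It also shows that `d` vanishes only if `w = p`. -/
theorem coe_vecNormSq_sub {n : ℕ} {p w : Fin (n + 1) → ℍ} (hp : vecNormSq p = 1)
    (hw : vecNormSq w = 1) : ((vecNormSq (w - p) : ℝ) : ℍ) =
      (1 - ∑ j, star (w j) * p j) + star (1 - ∑ j, star (w j) * p j) := by
  rw [vecNormSq_eq_one_iff] at hp hw
  rw [coe_vecNormSq]
  simp only [Pi.sub_apply, star_sub, mul_sub, sub_mul, Finset.sum_sub_distrib, star_one, star_sum,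
    star_mul, star_star, hp, hw]
  abel

theorem one_sub_inner_ne_zero {n : ℕ} {p w : Fin (n + 1) → ℍ} (hp : vecNormSq p = 1)
    (hw : vecNormSq w = 1) (hpw : w ≠ p) : 1 - ∑ j, star (w j) * p j ≠ 0 := by
  intro h
  have := coe_vecNormSq_sub hp hw
  rw [h, star_zero, add_zero] at this
  exact (vecNormSq_pos (sub_ne_zero.2 hpw)).ne' (Quaternion.coe_injective this)

theorem rotTo_self {n : ℕ} (p : Fin (n + 1) → ℍ) : rotTo p p = 1 := by
  ext1 i j
  simp [rotTo, quasiReflection, Matrix.one_apply]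

theorem rotTo_mem {n : ℕ} {p w : Fin (n + 1) → ℍ} (hp : vecNormSq p = 1)
    (hw : vecNormSq w = 1) : rotTo p w ∈ unitary (Matrix (Fin (n + 1)) (Fin (n + 1)) ℍ) := by
  by_cases hpw : w = p
  · rw [hpw, rotTo_self]; exact one_mem _
  have hd := one_sub_inner_ne_zero hp hw hpw
  have hN := coe_vecNormSq_sub hp hw
  rw [Unitary.mem_iff, rotTo, star_quasiReflection, quasiReflection_mul, quasiReflection_mul, hN]
  generalize 1 - ∑ j, star (w j) * p j = d at hd
  have hd' : star d ≠ 0 := star_ne_zero.2 hd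
  rw [star_inv₀]
  constructor
  · rw [← quasiReflection_zero (w - p)]; congr 1
    rw [mul_add, add_mul, mul_assoc, mul_inv_cancel₀ hd, mul_one, inv_mul_cancel₀ hd', one_mul,
      sub_self]
  · rw [← quasiReflection_zero (w - p)]; congr 1
    rw [mul_add, add_mul, inv_mul_cancel₀ hd, one_mul, mul_assoc, mul_inv_cancel₀ hd', mul_one,
      add_comm, sub_self]

/-- For `u = w - p` and `d = 1 - w*p` one has `u*p = -d`, hence `p - u d⁻¹ (u*p) = p + u = w`. -/
theorem rotTo_mulVec {n : ℕ} {p w : Fin (n + 1) → ℍ} (hp : vecNormSq p = 1)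
    (hw : vecNormSq w = 1) : rotTo p w *ᵥ p = w := by
  by_cases hpw : w = p
  · rw [hpw, rotTo_self, Matrix.one_mulVec]
  have hd := one_sub_inner_ne_zero hp hw hpw
  funext i
  have h : ∑ j, star ((w - p) j) * p j = -(1 - ∑ j, star (w j) * p j) := by
    rw [vecNormSq_eq_one_iff] at hp
    simp only [Pi.sub_apply, star_sub, sub_mul, Finset.sum_sub_distrib, hp]
    abel
  rw [rotTo, quasiReflection_mulVec, h, mul_neg, inv_mul_cancel₀ hd, Pi.sub_apply]
  simp

/-- Such an `e_i` is orthogonal to `w - p`. In the reduction column by column this keeps the columns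
already treated. -/
theorem rotTo_mulVec_single {n : ℕ} {p w : Fin (n + 1) → ℍ} {i : Fin (n + 1)}
    (hp : p i = 0) (hw : w i = 0) : rotTo p w *ᵥ (Pi.single i 1) = Pi.single i 1 := by
  funext j
  have h : ∑ j, star ((w - p) j) * (Pi.single i 1 : Fin (n + 1) → ℍ) j = 0 := by
    rw [Finset.sum_eq_single i]
    · simp [hp, hw]
    · intro b _ hb; simp [hb]
    · simp
  rw [rotTo, quasiReflection_mulVec, h, mul_zero, mul_zero, sub_zero]

/-- A matrix, as an element of `Sp(n+1)` (`1` if it is not unitary). -/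
def toSp {n : ℕ} (M : Matrix (Fin (n + 1)) (Fin (n + 1)) ℍ) : Sp n :=
  open scoped Classical in if h : M ∈ unitary _ then ⟨M, h⟩ else 1

theorem coe_toSp {n : ℕ} {M : Matrix (Fin (n + 1)) (Fin (n + 1)) ℍ} (h : M ∈ unitary _) :
    (toSp M).1 = M := by rw [toSp, dif_pos h]

/-- The quaternion `1 - w*p` to be inverted vanishes exactly at `w = p`; this is why the vectors are
required to miss a point of the sphere. -/
theorem contDiffOn_rotTo {n : ℕ} {p : Fin (n + 1) → ℍ} {w : ℂ → Fin (n + 1) → ℍ} {U : Set ℂ}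
    (hp : vecNormSq p = 1) (hw : ∀ z ∈ U, vecNormSq (w z) = 1) (hpw : ∀ z ∈ U, w z ≠ p)
    (hs : ∀ j, ContDiffOn ℝ ∞ (fun z => w z j) U) (i j : Fin (n + 1)) :
    ContDiffOn ℝ ∞ (fun z => rotTo p (w z) i j) U := by
  unfold rotTo quasiReflection
  have hu : ∀ j, ContDiffOn ℝ ∞ (fun z => (w z - p) j) U := fun j => (hs j).sub contDiffOn_const
  refine contDiffOn_const.sub (((hu i).mul ?_).mul (contDiff_quatStar.comp_contDiffOn (hu j)))
  have hd : ContDiffOn ℝ ∞ (fun z => 1 - ∑ j, star (w z j) * p j) U :=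
    contDiffOn_const.sub (ContDiffOn.sum fun j _ =>
      (contDiff_quatStar.comp_contDiffOn (hs j)).mul contDiffOn_const)
  intro z hz
  exact (contDiffAt_quatInv (one_sub_inner_ne_zero hp (hw z hz) (hpw z hz))).comp_contDiffWithinAt
    z (hd z hz)

/-! ### Extension of sphere-valued and of `Sp(n+1)`-valued maps over the disc -/

/-- A smooth map from a surface to the quaternions misses some unit quaternion up to positive
multiples. -/
theorem exists_unit_forall_ne {U : Set ℂ} (hU : IsOpen U) {f : ℂ → ℍ} (hf : ContDiffOn ℝ ∞ f U) :
    ∃ q : ℍ, Quaternion.normSq q = 1 ∧ ∀ z ∈ U, f z ≠ q := by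
  -- The cone over the image has a 3-dimensional parameter space, so its Hausdorff dimension is less
  -- than 4. A nonzero quaternion off the cone, once normalized, is missed by `f`.
  set g : ℂ × ℝ → ℍ := fun p => p.2 • f p.1
  have hg : ContDiffOn ℝ ∞ g (U ×ˢ univ) :=
    contDiffOn_snd.smul (hf.comp contDiffOn_fst fun p hp => hp.1)
  have hdim : dimH (g '' (U ×ˢ univ)) < Module.finrank ℝ ℍ := by
    have h1 : dimH (g '' (U ×ˢ univ)) ≤ dimH (U ×ˢ (univ : Set ℝ)) := by
      refine dimH_image_le_of_locally_lipschitzOn fun p hp => ?_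
      have : ContDiffAt ℝ 1 g p :=
        (hg.contDiffAt ((hU.prod isOpen_univ).mem_nhds hp)).of_le (by simp)
      obtain ⟨K, t, ht, hl⟩ := this.exists_lipschitzOnWith
      exact ⟨K, t, mem_nhdsWithin_of_mem_nhds ht, hl⟩
    refine (h1.trans (dimH_mono (subset_univ _))).trans_lt ?_
    rw [Real.dimH_univ_eq_finrank, Module.finrank_prod, Complex.finrank_real_complex,
      Module.finrank_self, Quaternion.finrank_eq_four]
    norm_num
  obtain ⟨q, hq, hq0⟩ := (dense_compl_of_dimH_lt_finrank hdim).inter_open_nonempty {0}ᶜ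
    isOpen_compl_singleton ⟨1, by simp⟩
  have hn : ‖q‖ ≠ 0 := norm_ne_zero_iff.2 hq
  refine ⟨‖q‖⁻¹ • q, ?_, fun z hz h => hq0 ⟨(z, ‖q‖), ⟨hz, mem_univ _⟩, ?_⟩⟩
  · rw [Quaternion.normSq_smul, Quaternion.normSq_eq_norm_mul_self]
    field_simp
  · change ‖q‖ • f z = q
    rw [h, smul_smul, mul_inv_cancel₀ hn, one_smul]

theorem vecNormSq_smul {n : ℕ} (r : ℝ) (v : Fin (n + 1) → ℍ) :
    vecNormSq (r • v) = r ^ 2 * vecNormSq v := by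
  simp only [vecNormSq, Pi.smul_apply, Quaternion.normSq_smul, Finset.mul_sum]

/-- A unit vector moved along the segment to `-p` and normalized does not vanish and does not
become `p`. -/
theorem segment_ne {n : ℕ} {p w : Fin (n + 1) → ℍ} (hp : vecNormSq p = 1) (hw : vecNormSq w = 1)
    (hpw : w ≠ p) {t s : ℝ} (h0 : 0 ≤ t) (h1 : t ≤ 1) (hs : 0 ≤ s) :
    (1 - t) • w - t • p ≠ s • p := by
  intro h
  have h2 : (1 - t) • w = (s + t) • p := by rw [add_smul, ← h]; abel
  have h3 := congrArg vecNormSq h2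
  rw [vecNormSq_smul, vecNormSq_smul, hp, hw, mul_one, mul_one] at h3
  have h4 : 1 - t = s + t := by
    rwa [sq_eq_sq₀ (by linarith) (by linarith)] at h3
  have h5 : s + t ≠ 0 := by intro h5; linarith
  rw [h4] at h2
  exact hpw (smul_right_injective _ h5 h2)

/-- The annulus between the circles of radius `r` and `2`. -/
def annulus (r : ℝ) : Set ℂ := {z | r < ‖z‖ ∧ ‖z‖ < 2}

theorem isOpen_annulus (r : ℝ) : IsOpen (annulus r) :=
  (isOpen_lt continuous_const continuous_norm).inter (isOpen_lt continuous_norm continuous_const)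

theorem annulus_mono {r r' : ℝ} (h : r ≤ r') : annulus r' ⊆ annulus r :=
  fun _ hz => ⟨h.trans_lt hz.1, hz.2⟩

theorem annulus_subset_ball (r : ℝ) : annulus r ⊆ Metric.ball 0 2 :=
  fun z hz => by simpa using hz.2

/-- Extension of a map to the sphere that misses a point. -/
theorem exists_extension_vec {n : ℕ} {p : Fin (n + 1) → ℍ} (hp : vecNormSq p = 1)
    {w : ℂ → Fin (n + 1) → ℍ} {r : ℝ} (hr0 : 0 ≤ r) (hr : r < 1)
    (hw : ∀ z ∈ annulus r, vecNormSq (w z) = 1) (hpw : ∀ z ∈ annulus r, w z ≠ p)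
    (hs : ∀ j, ContDiffOn ℝ ∞ (fun z => w z j) (annulus r)) :
    ∃ W : ℂ → Fin (n + 1) → ℍ, (∀ j, ContDiffOn ℝ ∞ (fun z => W z j) (Metric.ball 0 2)) ∧
      (∀ z ∈ Metric.ball (0 : ℂ) 2, vecNormSq (W z) = 1) ∧
      (∀ z ∈ Metric.ball (0 : ℂ) 2, W z ≠ p) ∧
      (∀ i, p i = 0 → (∀ z ∈ annulus r, w z i = 0) → ∀ z ∈ Metric.ball (0 : ℂ) 2, W z i = 0) ∧
      ∃ r', r ≤ r' ∧ r' < 1 ∧ ∀ z ∈ annulus r', W z = w z := by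
  obtain ⟨r₁, h1, h1'⟩ := exists_between hr
  obtain ⟨r₂, h2, h2'⟩ := exists_between h1'
  -- Here `r < r₁ < r₂ < 1`, and the cutoff is `1` up to radius `r₁` and `0` from `r₂` on. So `c`
  -- below is `w` outside, slides along segments towards `-p`, and is constantly `-p` inside, where
  -- nothing is known about `w`.
  set β : ContDiffBump (0 : ℂ) := ⟨r₁, r₂, hr0.trans_lt h1, h2⟩
  have hβ1 : ∀ z : ℂ, ‖z‖ ≤ r₁ → β z = 1 := fun z hz =>
    β.one_of_mem_closedBall (by simpa using hz)
  have hβ0 : ∀ z : ℂ, r₂ ≤ ‖z‖ → β z = 0 := fun z hz =>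
    β.zero_of_le_dist (by simpa using hz)
  set c : ℂ → Fin (n + 1) → ℍ := fun z => (1 - β z) • w z - β z • p with hc
  have hcase : ∀ z ∈ Metric.ball (0 : ℂ) 2, z ∈ annulus r ∨ ‖z‖ < r₁ := by
    intro z hz
    rcases lt_or_ge ‖z‖ r₁ with h | h
    · exact Or.inr h
    · exact Or.inl ⟨h1.trans_le h, by simpa using hz⟩
  have hcin : ∀ z : ℂ, ‖z‖ < r₁ → c z = -p := by
    intro z hz; simp [hc, hβ1 z hz.le]
  have hcne : ∀ z ∈ Metric.ball (0 : ℂ) 2, ∀ s : ℝ, 0 ≤ s → c z ≠ s • p := by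
    intro z hz s hs
    rcases hcase z hz with h | h
    · exact segment_ne hp (hw z h) (hpw z h) β.nonneg β.le_one hs
    · rw [hcin z h]
      intro h3
      have h4 : (s + 1) • p = 0 := by rw [add_smul, ← h3, one_smul]; abel
      have h5 : p ≠ 0 := by rintro rfl; simp [vecNormSq] at hp
      rcases smul_eq_zero.1 h4 with h6 | h6
      · linarith
      · exact h5 h6
  have hc0 : ∀ z ∈ Metric.ball (0 : ℂ) 2, 0 < vecNormSq (c z) := fun z hz =>
    vecNormSq_pos fun h => hcne z hz 0 le_rfl (by rw [h, zero_smul])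
  have hcs : ∀ j, ContDiffOn ℝ ∞ (fun z => c z j) (Metric.ball 0 2) := by
    intro j
    have a1 : ContDiffOn ℝ ∞ (fun z => c z j) (annulus r) :=
      ((contDiffOn_const.sub β.contDiff.contDiffOn).smul (hs j)).sub
        (β.contDiff.contDiffOn.smul contDiffOn_const)
    have a2 : ContDiffOn ℝ ∞ (fun z => c z j) (Metric.ball 0 r₁) :=
      (contDiffOn_const (c := -p j)).congr fun z hz => by
        rw [hcin z (by simpa using hz)]; rfl
    refine (a1.union_of_isOpen a2 (isOpen_annulus r) Metric.isOpen_ball).mono fun z hz => ?_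
    rcases hcase z hz with h | h
    · exact Or.inl h
    · exact Or.inr (by simpa using h)
  refine ⟨fun z => (Real.sqrt (vecNormSq (c z)))⁻¹ • c z, ?_, ?_, ?_, ?_, r₂, (h1.trans h2).le,
    h2', ?_⟩
  · intro j
    have h3 : ContDiffOn ℝ ∞ (fun z => vecNormSq (c z)) (Metric.ball 0 2) :=
      contDiff_vecNormSq.comp_contDiffOn (contDiffOn_pi.2 hcs)
    exact ((h3.sqrt fun z hz => (hc0 z hz).ne').inv
      fun z hz => (Real.sqrt_pos.2 (hc0 z hz)).ne').smul (hcs j)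
  · intro z hz
    rw [vecNormSq_smul, inv_pow, Real.sq_sqrt (hc0 z hz).le, inv_mul_cancel₀ (hc0 z hz).ne']
  · intro z hz h
    have h4 := (Real.sqrt_pos.2 (hc0 z hz)).ne'
    refine hcne z hz _ (Real.sqrt_nonneg (vecNormSq (c z))) ?_
    rw [← h, smul_smul, mul_inv_cancel₀ h4, one_smul]
  · intro i hpi hwi z hz
    rcases hcase z hz with h | h
    · simp [hc, hpi, hwi z h]
    · simp [hcin z h, hpi]
  · intro z hz
    have h3 : c z = w z := by simp [hc, hβ0 z hz.1.le]
    simp only [h3, hw z ⟨(h1.trans h2).trans hz.1, hz.2⟩, Real.sqrt_one, inv_one, one_smul]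

theorem Sp.mulVec_single {n : ℕ} (A : Sp n) (i j : Fin (n + 1)) :
    (A.1 *ᵥ (Pi.single i 1)) j = A.1 j i := by
  rw [Matrix.mulVec_single_one]; rfl

theorem Sp.vecNormSq_col {n : ℕ} (A : Sp n) (i : Fin (n + 1)) :
    vecNormSq (fun j => A.1 j i) = 1 := by
  have : (fun j => A.1 j i) = A.1 *ᵥ (Pi.single i 1) := by
    funext j; rw [Sp.mulVec_single]
  rw [this, Sp.vecNormSq_mulVec, vecNormSq, Finset.sum_eq_single i] <;> simp +contextual

/-- The `(i, k)` entry of `A*A = 1` pairs the column `A e_i = e_i` with column `k`, which yields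
`A_ik`. -/
theorem Sp.row_of_col {n : ℕ} {A : Sp n} {i k : Fin (n + 1)} (hik : i ≠ k)
    (h : A.1 *ᵥ (Pi.single i 1) = Pi.single i 1) : A.1 i k = 0 := by
  have h1 := congrFun (congrFun (Sp.star_mul A) i) k
  rw [Matrix.mul_apply, Matrix.one_apply_ne hik, Finset.sum_eq_single i] at h1
  · rw [Matrix.star_apply, ← Sp.mulVec_single A i i, h, Pi.single_eq_same, star_one, one_mul] at h1
    exact h1
  · intro b _ hb
    rw [Matrix.star_apply, ← Sp.mulVec_single A i b, h, Pi.single_eq_of_ne hb, star_zero, zero_mul]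
  · simp

/-- Induction on the number `m` of columns that may still differ from the standard basis. The first
such column, a vector in a sphere, is extended over the disc as `W`; an extendable family `g` with
`g e_k = W` that fixes the earlier basis vectors is divided out, and `g⁻¹ h` fixes one vector more.
-/
theorem exists_extension_aux {n : ℕ} (m : ℕ) : ∀ (h : ℂ → Sp n) (r : ℝ), 0 ≤ r → r < 1 →
    SmoothSpOn h (annulus r) →
    (∀ i : Fin (n + 1), (i : ℕ) + m < n + 1 → ∀ z ∈ annulus r,
      (h z).1 *ᵥ (Pi.single i 1) = Pi.single i 1) →
    ∃ f : ℂ → Sp n, SmoothSpOn f (Metric.ball 0 2) ∧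
      ∃ r', r ≤ r' ∧ r' < 1 ∧ ∀ z ∈ annulus r', f z = h z := by
  induction m with
  | zero =>
    intro h r hr0 hr _ hfix
    refine ⟨fun _ => 1, fun i j => contDiffOn_const, r, le_rfl, hr, fun z hz => ?_⟩
    refine Subtype.ext ?_
    ext1 j i
    rw [← Sp.mulVec_single (h z), hfix i (by omega) z hz, ← Sp.mulVec_single]
    change ((1 : Matrix _ _ ℍ) *ᵥ _) j = _
    rw [Matrix.one_mulVec]
  | succ m ih =>
    intro h r hr0 hr hs hfix
    -- Excludes truncation in `n - m`; for such `m` no vector is assumed to be fixed.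
    by_cases hm : n + 1 ≤ m
    · exact ih h r hr0 hr hs fun i hi => absurd hi (by omega)
    set k : Fin (n + 1) := ⟨n - m, by omega⟩ with hk
    have hlt : ∀ i : Fin (n + 1), (i : ℕ) + (m + 1) < n + 1 ↔ i < k := by
      intro i; rw [Fin.lt_def]; simp only [hk]; omega
    obtain ⟨q, hq, hqne⟩ := exists_unit_forall_ne (isOpen_annulus r) (hs k k)
    set p : Fin (n + 1) → ℍ := Pi.single k q with hpd
    set e : Fin (n + 1) → ℍ := Pi.single k 1 with hed
    have hp : vecNormSq p = 1 := by
      rw [vecNormSq, Finset.sum_eq_single k] <;> simp +contextual [hpd, hq]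
    have he : vecNormSq e = 1 := by
      rw [vecNormSq, Finset.sum_eq_single k] <;> simp +contextual [hed]
    have hpi : ∀ i, i < k → p i = 0 := fun i hi => Pi.single_eq_of_ne hi.ne _
    have hei : ∀ i, i < k → e i = 0 := fun i hi => Pi.single_eq_of_ne hi.ne _
    obtain ⟨W, hWs, hW1, hWp, hW0, r₁, hr1, hr1', hWe⟩ := exists_extension_vec hp hr0 hr
      (w := fun z j => (h z).1 j k) (fun z _ => Sp.vecNormSq_col _ _)
      (fun z hz h' => hqne z hz (by simpa [hpd] using congrFun h' k)) (fun j => hs j k)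
    have hWi : ∀ i, i < k → ∀ z ∈ Metric.ball (0 : ℂ) 2, W z i = 0 := fun i hi =>
      hW0 i (hpi i hi) fun z hz => Sp.row_of_col hi.ne (hfix i ((hlt i).2 hi) z hz)
    -- A direct rotation from `e` to `W z` would be singular where `W z = e`. So the constant `S`
    -- moves `e` to the missed vector `p`, and `R z` moves `p` to `W z`, which is smooth throughout.
    set S : Sp n := toSp (rotTo e p) with hS
    have hSc : S.1 = rotTo e p := coe_toSp (rotTo_mem he hp)
    set R : ℂ → Sp n := fun z => toSp (rotTo p (W z)) with hR
    have hRc : ∀ z ∈ Metric.ball (0 : ℂ) 2, (R z).1 = rotTo p (W z) := fun z hz =>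
      coe_toSp (rotTo_mem hp (hW1 z hz))
    have hRs : SmoothSpOn R (Metric.ball 0 2) := fun i j =>
      (contDiffOn_rotTo hp hW1 hWp hWs i j).congr fun z hz => by rw [hRc z hz]
    have hSs : SmoothSpOn (fun _ => S) (Metric.ball 0 2) := fun i j => contDiffOn_const
    set g : ℂ → Sp n := fun z => R z * S with hg
    have hgs : SmoothSpOn g (Metric.ball 0 2) := hRs.mul hSs
    have hgi : ∀ i, i < k → ∀ z ∈ Metric.ball (0 : ℂ) 2,
        (g z).1 *ᵥ (Pi.single i 1) = Pi.single i 1 := by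
      intro i hi z hz
      change ((R z).1 * S.1) *ᵥ _ = _
      rw [← Matrix.mulVec_mulVec, hSc, rotTo_mulVec_single (hei i hi) (hpi i hi), hRc z hz,
        rotTo_mulVec_single (hpi i hi) (hWi i hi z hz)]
    have hgk : ∀ z ∈ Metric.ball (0 : ℂ) 2, (g z).1 *ᵥ e = W z := by
      intro z hz
      change ((R z).1 * S.1) *ᵥ _ = _
      rw [← Matrix.mulVec_mulVec, hSc, rotTo_mulVec he hp, hRc z hz, rotTo_mulVec hp (hW1 z hz)]
    have hinv : ∀ (A : Sp n) (v v' : Fin (n + 1) → ℍ), A.1 *ᵥ v = v' → (A⁻¹).1 *ᵥ v' = v := by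
      intro A v v' hv
      rw [← hv, Matrix.mulVec_mulVec, Sp.coe_inv, Sp.star_mul, Matrix.one_mulVec]
    obtain ⟨f, hf, r₂, h2, h2', hfe⟩ := ih (fun z => (g z)⁻¹ * h z) r₁ (hr0.trans hr1) hr1'
      ((hgs.mono (annulus_subset_ball r₁)).inv.mul (hs.mono (annulus_mono hr1))) (by
        intro i hi z hz
        have hzb := annulus_subset_ball r₁ hz
        have hza := annulus_mono hr1 hz
        change (((g z)⁻¹).1 * (h z).1) *ᵥ _ = _
        rw [← Matrix.mulVec_mulVec]
        have hik : i ≤ k := by rw [Fin.le_def]; simp only [hk]; omega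
        rcases hik.lt_or_eq with hik | rfl
        · rw [hfix i ((hlt i).2 hik) z hza]
          exact hinv _ _ _ (hgi i hik z hzb)
        · refine hinv _ _ _ ((hgk z hzb).trans ?_)
          rw [hWe z hz]
          funext j; rw [Sp.mulVec_single])
    refine ⟨fun z => g z * f z, hgs.mul hf, r₂, hr1.trans h2, h2', fun z hz => ?_⟩
    change g z * f z = h z
    rw [hfe z hz, mul_inv_cancel_left]

/-- As `Sp(n+1)` is simply connected, a smooth map from an annulus to `Sp(n+1)` extends, up to
shrinking the annulus, to a disc. -/
theorem exists_extension {n : ℕ} {h : ℂ → Sp n} {r : ℝ} (hr0 : 0 ≤ r) (hr : r < 1)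
    (hh : SmoothSpOn h (annulus r)) : ∃ f : ℂ → Sp n, SmoothSpOn f (Metric.ball 0 2) ∧
      ∃ r', r ≤ r' ∧ r' < 1 ∧ ∀ z ∈ annulus r', f z = h z :=
  exists_extension_aux (n + 1) h r hr0 hr hh fun i hi => absurd hi (by omega)

/-! ### The two affine charts of `S²` -/

/-- The sign of the `k`-th affine chart of `S²`. -/
def chartSign (k : Fin 2) : ℝ := if k = 0 then 1 else -1

/-- The affine coordinate on `S²` minus a pole. -/
def sphereCoord (k : Fin 2) (b : S2) : ℂ :=
  ⟨b.1 0 / (1 + chartSign k * b.1 2), chartSign k * b.1 1 / (1 + chartSign k * b.1 2)⟩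

/-- The sphere minus a pole. -/
def sphereBase (k : Fin 2) : Set S2 := {b | 1 + chartSign k * b.1 2 ≠ 0}

/-- The inverse of the affine coordinate. -/
def spherePt (k : Fin 2) (ζ : ℂ) : S2 := hopf (sec k ζ)

theorem fin_two_add_one_add_one (k : Fin 2) : k + 1 + 1 = k := by fin_cases k <;> rfl

/-- Makes the sphere minus a pole the locus where the `k`-th entry of the first column is nonzero,
which is the domain of the trivialization `Tot.triv k`. -/
theorem hopf_base (k : Fin 2) (s : SU 2) :
    1 + chartSign k * (hopf s).1 2 = 2 * Complex.normSq (s.1 k 0) := by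
  have h := SU2.normSq_col s
  change 1 + chartSign k * (Complex.normSq (s.1 0 0) - Complex.normSq (s.1 1 0)) = _
  fin_cases k
  · simp [chartSign]; linarith
  · simp [chartSign]; linarith

theorem hopf_mem_base (k : Fin 2) (s : SU 2) : hopf s ∈ sphereBase k ↔ s.1 k 0 ≠ 0 := by
  rw [sphereBase, mem_ofPred_eq, hopf_base]
  simp

/-- Identifies `S²` with the complex projective line: stereographic coordinates are ratios of the
entries of a Hopf representative. In particular the two coordinates are reciprocal. -/
theorem coord_hopf (k : Fin 2) (s : SU 2) (h : s.1 k 0 ≠ 0) :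
    sphereCoord k (hopf s) = s.1 (k + 1) 0 / s.1 k 0 := by
  have hb := hopf_base k s
  have hN : Complex.normSq (s.1 k 0) ≠ 0 := by simpa using h
  have h0 : (hopf s).1 0 = 2 * (star (s.1 0 0) * s.1 1 0).re := rfl
  have h1 : (hopf s).1 1 = 2 * (star (s.1 0 0) * s.1 1 0).im := rfl
  apply Complex.ext
  · simp only [sphereCoord]
    rw [hb, h0, Complex.div_re]
    fin_cases k
    · simp [Complex.normSq_apply] at hN ⊢
      field_simp
    · simp [Complex.normSq_apply] at hN ⊢
      field_simp
  · simp only [sphereCoord]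
    rw [hb, h1, Complex.div_im]
    fin_cases k
    · simp [Complex.normSq_apply, chartSign] at hN ⊢
      field_simp
      ring
    · simp [Complex.normSq_apply, chartSign] at hN ⊢
      field_simp
      ring

theorem spherePt_mem (k : Fin 2) (ζ : ℂ) : spherePt k ζ ∈ sphereBase k :=
  (hopf_mem_base k _).2 (sec_self_ne k ζ)

theorem coord_spherePt (k : Fin 2) (ζ : ℂ) : sphereCoord k (spherePt k ζ) = ζ := by
  rw [spherePt, coord_hopf k _ (sec_self_ne k ζ)]
  exact congrArg Prod.snd (trivCoord_sec (n := 0) k (HP.ofVec 0) ζ)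

/-- The square roots in `sec k ζ` enter the Hopf map only in pairs, leaving rational expressions
whose smoothness is visible. -/
theorem spherePt_apply (k : Fin 2) (ζ : ℂ) : (spherePt k ζ).1 =
    !₂[2 * ζ.re / (1 + Complex.normSq ζ), chartSign k * (2 * ζ.im) / (1 + Complex.normSq ζ),
      chartSign k * (1 - Complex.normSq ζ) / (1 + Complex.normSq ζ)] := by
  have hN : 0 < 1 + Complex.normSq ζ := by have := Complex.normSq_nonneg ζ; linarith
  have hs := sqrt_pos ζ
  have hsq : Real.sqrt (1 + Complex.normSq ζ) ^ 2 = 1 + Complex.normSq ζ := Real.sq_sqrt hN.le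
  have h1 := sec_self k ζ
  have h2 := sec_other k ζ
  have hN' := hN.ne'
  simp only [spherePt, hopf]
  congr 1
  rw [div_eq_mul_inv, ← Complex.ofReal_inv] at h2
  have hi : (Real.sqrt (1 + Complex.normSq ζ))⁻¹ * (Real.sqrt (1 + Complex.normSq ζ))⁻¹ =
      (1 + Complex.normSq ζ)⁻¹ := by rw [← mul_inv, ← sq, hsq]
  simp only [div_eq_mul_inv, ← hi] at h2 ⊢
  generalize (Real.sqrt (1 + Complex.normSq ζ))⁻¹ = t at h1 h2
  obtain rfl | rfl : k = 0 ∨ k = 1 := by fin_cases k <;> simp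
  · rw [zero_add] at h2
    rw [h1, h2]
    funext i
    fin_cases i <;> simp [chartSign, Complex.normSq_apply] <;> ring
  · change (sec 1 ζ).1 0 0 = _ at h2
    rw [h1, h2]
    funext i
    fin_cases i <;> simp [chartSign, Complex.normSq_apply] <;> ring

theorem spherePt_coord (k : Fin 2) {b : S2} (hb : b ∈ sphereBase k) :
    spherePt k (sphereCoord k b) = b := by
  have hs : b.1 0 ^ 2 + b.1 1 ^ 2 + b.1 2 ^ 2 = 1 := by
    have h := b.2
    rw [mem_sphere_zero_iff_norm, EuclideanSpace.norm_eq, Real.sqrt_eq_one,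
      Fin.sum_univ_three] at h
    simpa only [Real.norm_eq_abs, sq_abs] using h
  have hb' : 1 + chartSign k * b.1 2 ≠ 0 := hb
  have hk : chartSign k ^ 2 = 1 := by unfold chartSign; split_ifs <;> norm_num
  have hN : 1 + Complex.normSq (sphereCoord k b) = 2 / (1 + chartSign k * b.1 2) := by
    rw [Complex.normSq_apply]
    simp only [sphereCoord]
    field_simp
    linear_combination hs + (b.1 1 ^ 2 + b.1 2 ^ 2) * hk
  have hN2 : 1 - Complex.normSq (sphereCoord k b) =
      2 * (chartSign k * b.1 2) / (1 + chartSign k * b.1 2) := by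
    have : 1 - Complex.normSq (sphereCoord k b) =
      2 - (1 + Complex.normSq (sphereCoord k b)) := by ring
    rw [this, hN]; field_simp; ring
  ext1
  rw [spherePt_apply, hN, hN2]
  ext i
  fin_cases i
  · simp [sphereCoord]; field_simp
  · simp [sphereCoord]; field_simp; linear_combination b.1 1 * hk
  · simp; field_simp; linear_combination b.1 2 * hk

theorem hopf_surjective_of_mem {k : Fin 2} {b : S2} (hb : b ∈ sphereBase k) :
    ∃ s : SU 2, hopf s = b ∧ s.1 k 0 ≠ 0 :=
  ⟨sec k (sphereCoord k b), spherePt_coord k hb, sec_self_ne _ _⟩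

theorem sphereBase_cover (b : S2) : b ∈ sphereBase 0 ∨ b ∈ sphereBase 1 := by
  by_contra! h
  simp only [sphereBase, mem_ofPred_eq, not_not, chartSign] at h
  norm_num at h
  linarith [h.1, h.2]

theorem mem_sphereBase_other {k : Fin 2} {b : S2} (hb : b ∈ sphereBase k) :
    b ∈ sphereBase (k + 1) ↔ sphereCoord k b ≠ 0 := by
  obtain ⟨s, rfl, hs⟩ := hopf_surjective_of_mem hb
  rw [hopf_mem_base, coord_hopf k s hs]
  simp [hs]

theorem sphereCoord_other {k : Fin 2} {b : S2} (hb : b ∈ sphereBase k)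
    (hb' : b ∈ sphereBase (k + 1)) : sphereCoord (k + 1) b = (sphereCoord k b)⁻¹ := by
  obtain ⟨s, rfl, hs⟩ := hopf_surjective_of_mem hb
  rw [coord_hopf k s hs, coord_hopf (k + 1) s ((hopf_mem_base _ _).1 hb'), inv_div,
    fin_two_add_one_add_one]

theorem contMDiff_sphere_apply (i : Fin 3) :
    ContMDiff modelS2 𝓘(ℝ, ℝ) ∞ fun b : S2 => b.1 i := by
  have : Fact (Module.finrank ℝ (EuclideanSpace ℝ (Fin 3)) = 2 + 1) := ⟨finrank_euclideanSpace_fin⟩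
  have h1 : ContMDiff modelS2 𝓘(ℝ, EuclideanSpace ℝ (Fin 3)) ∞
      ((↑) : S2 → EuclideanSpace ℝ (Fin 3)) := contMDiff_coe_sphere
  have h2 : ContDiff ℝ ∞ fun v : EuclideanSpace ℝ (Fin 3) => v i :=
    (EuclideanSpace.proj (𝕜 := ℝ) i).contDiff
  exact h2.contMDiff.comp h1

theorem isOpen_sphereBase (k : Fin 2) : IsOpen (sphereBase k) :=
  isOpen_ne_fun (continuous_const.add (continuous_const.mul
    (contMDiff_sphere_apply 2).continuous)) continuous_const

theorem contMDiffOn_sphereCoord (k : Fin 2) :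
    ContMDiffOn modelS2 𝓘(ℝ, ℂ) ∞ (sphereCoord k) (sphereBase k) := by
  intro b hb
  refine ContMDiffAt.contMDiffWithinAt ?_
  have hb' : 1 + chartSign k * b.1 2 ≠ 0 := hb
  have h : ContDiffAt ℝ ∞ (fun v : ℝ × ℝ × ℝ => Complex.equivRealProdCLM.symm
      (v.1 / (1 + chartSign k * v.2.2), chartSign k * v.2.1 / (1 + chartSign k * v.2.2)))
      (b.1 0, b.1 1, b.1 2) := by
    have h1 : ContDiffAt ℝ ∞ (fun v : ℝ × ℝ × ℝ => v.1 / (1 + chartSign k * v.2.2))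
        (b.1 0, b.1 1, b.1 2) :=
      ContDiffAt.div (by fun_prop) (by fun_prop) hb'
    have h2 : ContDiffAt ℝ ∞ (fun v : ℝ × ℝ × ℝ => chartSign k * v.2.1 / (1 + chartSign k * v.2.2))
        (b.1 0, b.1 1, b.1 2) :=
      ContDiffAt.div (by fun_prop) (by fun_prop) hb'
    exact Complex.equivRealProdCLM.symm.contDiff.contDiffAt.comp _ (h1.prodMk h2)
  have h3 := ((contMDiff_sphere_apply 0).prodMk_space
    ((contMDiff_sphere_apply 1).prodMk_space (contMDiff_sphere_apply 2))).contMDiffAt (x := b)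
  exact h.contMDiffAt.comp b h3

theorem contMDiff_spherePt (k : Fin 2) : ContMDiff 𝓘(ℝ, ℂ) modelS2 ∞ (spherePt k) := by
  have : Fact (Module.finrank ℝ (EuclideanSpace ℝ (Fin 3)) = 2 + 1) := ⟨finrank_euclideanSpace_fin⟩
  have h : ContDiff ℝ ∞ fun ζ : ℂ => (spherePt k ζ).1 := by
    simp only [spherePt_apply]
    have hn : ContDiff ℝ ∞ fun ζ : ℂ => Complex.normSq ζ := by
      simp only [Complex.normSq_apply]
      exact (Complex.reCLM.contDiff.mul Complex.reCLM.contDiff).add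
        (Complex.imCLM.contDiff.mul Complex.imCLM.contDiff)
    have hN : ∀ ζ : ℂ, 1 + Complex.normSq ζ ≠ 0 := fun ζ => by
      have := Complex.normSq_nonneg ζ; positivity
    have hre : ContDiff ℝ ∞ fun ζ : ℂ => ζ.re := Complex.reCLM.contDiff
    have him : ContDiff ℝ ∞ fun ζ : ℂ => ζ.im := Complex.imCLM.contDiff
    refine contDiff_euclidean.2 fun i => ?_
    fin_cases i
    · exact ContDiff.div (contDiff_const.mul hre) (contDiff_const.add hn) hN
    · exact ContDiff.div (contDiff_const.mul (contDiff_const.mul him)) (contDiff_const.add hn) hN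
    · exact ContDiff.div (contDiff_const.mul (contDiff_const.sub hn)) (contDiff_const.add hn) hN
  exact ContMDiff.codRestrict_sphere h.contMDiff fun ζ => (spherePt k ζ).2

/-! ### Linear trivializations of linear `HP^n`-bundles -/

section Bundles

variable {n : ℕ} {E : Type*} [NormedAddCommGroup E] [NormedSpace ℝ E] {H : Type*}
  [TopologicalSpace H] {I : ModelWithCorners ℝ E H} {M : Type*} [TopologicalSpace M]
  [ChartedSpace H M] {E' : Type*} [NormedAddCommGroup E'] [NormedSpace ℝ E'] {H' : Type*}
  [TopologicalSpace H'] {I' : ModelWithCorners ℝ E' H'} {M' : Type*} [TopologicalSpace M']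
  [ChartedSpace H' M']

/-- A smooth linear trivialization over a set, with total functions. -/
structure LinTriv (B : LinearHPBundle n I M) (V : Set S2) where
  /-- the inverse trivialization -/
  inv : S2 → HP n → M
  /-- the fibre coordinate -/
  coord : M → HP n
  smooth_inv : ContMDiffOn (modelS2.prod (modelHP n)) I ∞ (fun p : S2 × HP n => inv p.1 p.2)
    (V ×ˢ univ)
  smooth_coord : ContMDiffOn I (modelHP n) ∞ coord (B.proj ⁻¹' V)
  proj_inv : ∀ b ∈ V, ∀ x, B.proj (inv b x) = b
  coord_inv : ∀ b ∈ V, ∀ x, coord (inv b x) = x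
  inv_coord : ∀ m, B.proj m ∈ V → inv (B.proj m) (coord m) = m
  linear : ∀ e ∈ B.atlas, ∀ b ∈ V ∩ e.baseSet, ∃ A : Sp n, ∀ x, e (inv b x) = (b, A • x)

theorem LinearHPBundle.contMDiff_proj (B : LinearHPBundle n I M) :
    ContMDiff I modelS2 ∞ B.proj := by
  intro m
  obtain ⟨e, he, hb⟩ := B.cover (B.proj m)
  have hm : m ∈ e.source := e.mem_source.2 hb
  have h1 := (B.smooth e he).contMDiffAt (e.open_source.mem_nhds hm)
  refine (contMDiffAt_fst.comp m h1).congr_of_eventuallyEq ?_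
  filter_upwards [e.open_source.mem_nhds hm] with m' hm'
  exact (e.coe_fst hm').symm

variable {B : LinearHPBundle n I M} {B' : LinearHPBundle n I' M'} {V V' : Set S2}

/-- An admissible local trivialization. -/
def LinTriv.ofMem {e : Bundle.Trivialization (HP n) B.proj} (he : e ∈ B.atlas) :
    LinTriv B e.baseSet where
  inv b x := e.toOpenPartialHomeomorph.symm (b, x)
  coord m := (e m).2
  smooth_inv := by
    have h := B.smooth_symm e he
    rw [e.target_eq] at h
    exact h
  smooth_coord := by
    have h := B.smooth e he
    rw [e.source_eq] at h
    exact contMDiff_snd.comp_contMDiffOn h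
  proj_inv b hb x := e.proj_symm_apply (e.mem_target.2 hb)
  coord_inv b hb x := by rw [e.apply_symm_apply (e.mem_target.2 hb)]
  inv_coord m hm := by
    rw [← e.coe_fst (e.mem_source.2 hm)]
    exact e.toOpenPartialHomeomorph.left_inv (e.mem_source.2 hm)
  linear e' he' b hb := B.linear e he e' he' b hb

/-- Restriction of a linear trivialization. -/
def LinTriv.restrict (T : LinTriv B V) (h : V' ⊆ V) : LinTriv B V' where
  inv := T.inv
  coord := T.coord
  smooth_inv := T.smooth_inv.mono (prod_mono h Subset.rfl)
  smooth_coord := T.smooth_coord.mono (preimage_mono h)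
  proj_inv b hb := T.proj_inv b (h hb)
  coord_inv b hb := T.coord_inv b (h hb)
  inv_coord m hm := T.inv_coord m (h hm)
  linear e he b hb := T.linear e he b ⟨h hb.1, hb.2⟩

/-- A smooth family of linear maps parametrized by a part of `S²`, with its inverse. -/
structure IsSphereFamilyOn (F G : S2 → HP n → HP n) (V : Set S2) : Prop where
  smooth : ContMDiffOn (modelS2.prod (modelHP n)) (modelHP n) ∞
    (fun p : S2 × HP n => F p.1 p.2) (V ×ˢ univ)
  smooth_inv : ContMDiffOn (modelS2.prod (modelHP n)) (modelHP n) ∞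
    (fun p : S2 × HP n => G p.1 p.2) (V ×ˢ univ)
  inv_left : ∀ b ∈ V, ∀ x, G b (F b x) = x
  inv_right : ∀ b ∈ V, ∀ x, F b (G b x) = x
  linear : ∀ b ∈ V, ∃ A : Sp n, ∀ x, F b x = A • x

theorem IsSphereFamilyOn.comp {F G : S2 → HP n → HP n} (h : IsSphereFamilyOn F G V)
    {φ : S2 → S2} (hφ : ContMDiffOn modelS2 modelS2 ∞ φ V') (hm : MapsTo φ V' V) :
    IsSphereFamilyOn (fun b => F (φ b)) (fun b => G (φ b)) V' where
  smooth := h.smooth.comp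
    (f := fun p : S2 × HP n => (φ p.1, p.2))
    ((hφ.comp contMDiffOn_fst fun _ hp => hp.1).prodMk contMDiffOn_snd)
    fun _ hp => ⟨hm hp.1, mem_univ _⟩
  smooth_inv := h.smooth_inv.comp
    (f := fun p : S2 × HP n => (φ p.1, p.2))
    ((hφ.comp contMDiffOn_fst fun _ hp => hp.1).prodMk contMDiffOn_snd)
    fun _ hp => ⟨hm hp.1, mem_univ _⟩
  inv_left _ hb := h.inv_left _ (hm hb)
  inv_right _ hb := h.inv_right _ (hm hb)
  linear _ hb := h.linear _ (hm hb)

/-- The transition maps between two linear trivializations. -/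
theorem LinTriv.transition (T : LinTriv B V) (T' : LinTriv B V') :
    IsSphereFamilyOn (fun b x => T'.coord (T.inv b x)) (fun b x => T.coord (T'.inv b x))
      (V ∩ V') where
  smooth := T'.smooth_coord.comp (T.smooth_inv.mono (prod_mono inter_subset_left Subset.rfl))
    fun p hp => by
      change B.proj _ ∈ V'
      rw [T.proj_inv _ hp.1.1]; exact hp.1.2
  smooth_inv := T.smooth_coord.comp (T'.smooth_inv.mono (prod_mono inter_subset_right Subset.rfl))
    fun p hp => by
      change B.proj _ ∈ V
      rw [T'.proj_inv _ hp.1.2]; exact hp.1.1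
  inv_left b hb x := by
    have h := T'.inv_coord (T.inv b x) (by rw [T.proj_inv b hb.1]; exact hb.2)
    rw [T.proj_inv b hb.1] at h
    rw [h, T.coord_inv b hb.1]
  inv_right b hb x := by
    have h := T.inv_coord (T'.inv b x) (by rw [T'.proj_inv b hb.2]; exact hb.1)
    rw [T'.proj_inv b hb.2] at h
    rw [h, T'.coord_inv b hb.2]
  linear b hb := by
    -- Linearity is known only relative to admissible charts, so both trivializations are compared
    -- with one such chart at `b`.
    obtain ⟨e, he, hbe⟩ := B.cover b
    obtain ⟨A, hA⟩ := T.linear e he b ⟨hb.1, hbe⟩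
    obtain ⟨A', hA'⟩ := T'.linear e he b ⟨hb.2, hbe⟩
    refine ⟨A'⁻¹ * A, fun x => ?_⟩
    have h := T'.inv_coord (T.inv b x) (by rw [T.proj_inv b hb.1]; exact hb.2)
    rw [T.proj_inv b hb.1] at h
    have h1 := hA' (T'.coord (T.inv b x))
    rw [h, hA] at h1
    rw [mul_smul, eq_inv_smul_iff]
    exact (congrArg Prod.snd h1).symm

theorem LinTriv.inv_transition (T : LinTriv B V) (T' : LinTriv B V') {b : S2} (hb : b ∈ V)
    (hb' : b ∈ V') (x : HP n) : T'.inv b (T'.coord (T.inv b x)) = T.inv b x := by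
  have h := T'.inv_coord (T.inv b x) (by rw [T.proj_inv b hb]; exact hb')
  rwa [T.proj_inv b hb] at h

/-- Change of a linear trivialization by a family of linear maps. -/
def LinTriv.twist (T : LinTriv B V) {F G : S2 → HP n → HP n} (h : IsSphereFamilyOn F G V) :
    LinTriv B V where
  inv b x := T.inv b (F b x)
  coord m := G (B.proj m) (T.coord m)
  smooth_inv := T.smooth_inv.comp (f := fun p : S2 × HP n => (p.1, F p.1 p.2))
    (contMDiffOn_fst.prodMk h.smooth) fun p hp => ⟨hp.1, mem_univ _⟩
  smooth_coord := h.smooth_inv.comp (f := fun m => (B.proj m, T.coord m))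
    (B.contMDiff_proj.contMDiffOn.prodMk T.smooth_coord) fun p hp => ⟨hp, mem_univ _⟩
  proj_inv b hb x := T.proj_inv b hb _
  coord_inv b hb x := by rw [T.proj_inv b hb, T.coord_inv b hb, h.inv_left b hb]
  inv_coord m hm := by rw [h.inv_right _ hm, T.inv_coord m hm]
  linear e he b hb := by
    obtain ⟨A, hA⟩ := T.linear e he b hb
    obtain ⟨A', hA'⟩ := h.linear b hb.1
    exact ⟨A * A', fun x => by rw [hA, hA', mul_smul]⟩

theorem LinTriv.coord_eq_of_inv_eq (T : LinTriv B V) (T' : LinTriv B V')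
    (h : ∀ b ∈ V ∩ V', ∀ x, T.inv b x = T'.inv b x) {m : M} (hm : B.proj m ∈ V ∩ V') :
    T.coord m = T'.coord m := by
  have h1 := T'.inv_coord m hm.2
  rw [← h _ hm] at h1
  conv_lhs => rw [← h1]
  exact T.coord_inv _ hm.1 _

theorem isOpen_preimage_proj (B : LinearHPBundle n I M) (oV : IsOpen V) :
    IsOpen (B.proj ⁻¹' V) := oV.preimage B.contMDiff_proj.continuous

theorem LinTriv.exists_union (T : LinTriv B V) (T' : LinTriv B V') (oV : IsOpen V)
    (oV' : IsOpen V') (h : ∀ b ∈ V ∩ V', ∀ x, T.inv b x = T'.inv b x) :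
    Nonempty (LinTriv B (V ∪ V')) := by
  classical
  set inv : S2 → HP n → M := fun b => if b ∈ V then T.inv b else T'.inv b with hinv
  set coord : M → HP n := fun m => if B.proj m ∈ V then T.coord m else T'.coord m with hcoord
  have i1 : ∀ b ∈ V, inv b = T.inv b := fun b hb => if_pos hb
  have i2 : ∀ b ∈ V', inv b = T'.inv b := fun b hb => by
    by_cases hV : b ∈ V
    · rw [i1 b hV]; funext x; exact h b ⟨hV, hb⟩ x
    · exact if_neg hV
  have c1 : ∀ m, B.proj m ∈ V → coord m = T.coord m := fun m hm => if_pos hm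
  have c2 : ∀ m, B.proj m ∈ V' → coord m = T'.coord m := fun m hm => by
    by_cases hV : B.proj m ∈ V
    · rw [c1 m hV]; exact T.coord_eq_of_inv_eq T' h ⟨hV, hm⟩
    · exact if_neg hV
  refine ⟨inv, coord, ?_, ?_, ?_, ?_, ?_, ?_⟩
  · rw [union_prod]
    refine ContMDiffOn.union_of_isOpen (T.smooth_inv.congr fun p hp => ?_)
      (T'.smooth_inv.congr fun p hp => ?_) (oV.prod isOpen_univ) (oV'.prod isOpen_univ)
    · rw [i1 _ hp.1]
    · rw [i2 _ hp.1]
  · rw [preimage_union]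
    exact ContMDiffOn.union_of_isOpen (T.smooth_coord.congr fun p hp => c1 p hp)
      (T'.smooth_coord.congr fun p hp => c2 p hp) (isOpen_preimage_proj B oV)
      (isOpen_preimage_proj B oV')
  · rintro b (hb | hb) x
    · rw [i1 b hb, T.proj_inv b hb]
    · rw [i2 b hb, T'.proj_inv b hb]
  · rintro b (hb | hb) x
    · rw [i1 b hb, c1 _ (by rw [T.proj_inv b hb]; exact hb), T.coord_inv b hb]
    · rw [i2 b hb, c2 _ (by rw [T'.proj_inv b hb]; exact hb), T'.coord_inv b hb]
  · rintro m (hm | hm)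
    · rw [i1 _ hm, c1 m hm, T.inv_coord m hm]
    · rw [i2 _ hm, c2 m hm, T'.inv_coord m hm]
  · rintro e he b ⟨hb | hb, hbe⟩
    · rw [i1 b hb]; exact T.linear e he b ⟨hb, hbe⟩
    · rw [i2 b hb]; exact T'.linear e he b ⟨hb, hbe⟩

/-! ### Triviality over rectangles in an affine chart -/

/-- Two linear trivializations can be joined if their common domain is a smooth retract. -/
theorem LinTriv.exists_union_of_retraction (T : LinTriv B V) (T' : LinTriv B V') {W : Set S2}
    (oW : IsOpen W) (oV' : IsOpen V') (hW : W ⊆ V) {φ : S2 → S2}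
    (hφ : ContMDiffOn modelS2 modelS2 ∞ φ V') (hm : MapsTo φ V' (V ∩ V'))
    (hφW : ∀ b ∈ W ∩ V', φ b = b) : Nonempty (LinTriv B (W ∪ V')) := by
  -- The transition map from `T` to `T'` lives on the overlap only; composition with `φ` extends it
  -- over all of `V'`. Where `φ` is the identity, the twisted `T'` coincides with `T`.
  refine (T.restrict hW).exists_union (T'.twist ((T.transition T').comp hφ hm)) oW oV' ?_
  intro b hb x
  change T.inv b x = T'.inv b (T'.coord (T.inv (φ b) x))
  rw [hφW b hb, T.inv_transition T' (hW hb.1) hb.2]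

/-- Supplies the retraction for gluing: everything to the right of `x'` is pushed into the overlap
`(x', y)`, while points left of `c` stay fixed. -/
theorem exists_smooth_squeeze {x' y : ℝ} (h : x' < y) : ∃ c, x' < c ∧ c < y ∧
    ∃ φ : ℝ → ℝ, ContDiff ℝ ∞ φ ∧ (∀ t < c, φ t = t) ∧ ∀ t, x' < t → x' < φ t ∧ φ t < y := by
  set δ := (y - x') / 3 with hδ
  have hδ0 : 0 < δ := by positivity
  set c := x' + δ with hc
  -- The map interpolates from the identity to the constant `c`. During the transition its value
  -- stays between `c` and `t < c + δ < y`.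
  refine ⟨c, by linarith, by linarith,
    fun t => t + Real.smoothTransition ((t - c) / δ) * (c - t), ?_, ?_, ?_⟩
  · have h1 : ContDiff ℝ ∞ Real.smoothTransition := Real.smoothTransition.contDiff
    have h2 : ContDiff ℝ ∞ fun t : ℝ => Real.smoothTransition ((t - c) / δ) :=
      h1.comp (by fun_prop)
    fun_prop
  · intro t ht
    have : Real.smoothTransition ((t - c) / δ) = 0 :=
      Real.smoothTransition.zero_of_nonpos (div_nonpos_of_nonpos_of_nonneg (by linarith) hδ0.le)
    simp only [this]; ring
  · intro t ht
    have h0 := Real.smoothTransition.nonneg ((t - c) / δ)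
    have h1 := Real.smoothTransition.le_one ((t - c) / δ)
    rcases le_or_gt (c + δ) t with h2 | h2
    · have : Real.smoothTransition ((t - c) / δ) = 1 :=
        Real.smoothTransition.one_of_one_le ((one_le_div hδ0).2 (by linarith))
      simp only [this]; constructor <;> linarith
    · rcases le_or_gt t c with h3 | h3
      · have : Real.smoothTransition ((t - c) / δ) = 0 :=
          Real.smoothTransition.zero_of_nonpos
            (div_nonpos_of_nonpos_of_nonneg (by linarith) hδ0.le)
        simp only [this]; constructor <;> linarith
      · constructor <;> nlinarith

/-- The part of the sphere over a set of affine coordinates. -/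
def chartSet (k : Fin 2) (U : Set ℂ) : Set S2 := sphereBase k ∩ sphereCoord k ⁻¹' U

theorem isOpen_chartSet (k : Fin 2) {U : Set ℂ} (hU : IsOpen U) : IsOpen (chartSet k U) :=
  (contMDiffOn_sphereCoord k).continuousOn.isOpen_inter_preimage (isOpen_sphereBase k) hU

theorem chartSet_mono (k : Fin 2) {U U' : Set ℂ} (h : U ⊆ U') : chartSet k U ⊆ chartSet k U' :=
  inter_subset_inter_right _ (preimage_mono h)

/-- Transports a retraction of the plane to the sphere through the affine chart. -/
theorem LinTriv.exists_chartSet_union {k : Fin 2} {U U' W : Set ℂ} (oW : IsOpen W)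
    (oU' : IsOpen U') (hW : W ⊆ U) {φ : ℂ → ℂ} (hφ : ContDiff ℝ ∞ φ)
    (hm : MapsTo φ U' (U ∩ U')) (hφW : ∀ z ∈ W ∩ U', φ z = z)
    (h : Nonempty (LinTriv B (chartSet k U))) (h' : Nonempty (LinTriv B (chartSet k U'))) :
    Nonempty (LinTriv B (chartSet k (W ∪ U'))) := by
  obtain ⟨T⟩ := h
  obtain ⟨T'⟩ := h'
  have : chartSet k (W ∪ U') = chartSet k W ∪ chartSet k U' := by
    rw [chartSet, preimage_union, inter_union_distrib_left]; rfl
  rw [this]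
  refine T.exists_union_of_retraction T' (isOpen_chartSet k oW) (isOpen_chartSet k oU')
    (chartSet_mono k hW) (φ := fun b => spherePt k (φ (sphereCoord k b))) ?_ ?_ ?_
  · exact (contMDiff_spherePt k).comp_contMDiffOn (hφ.contMDiff.comp_contMDiffOn
      ((contMDiffOn_sphereCoord k).mono inter_subset_left))
  · intro b hb
    have h1 := hm hb.2
    refine ⟨⟨spherePt_mem _ _, ?_⟩, spherePt_mem _ _, ?_⟩
    · change sphereCoord k _ ∈ U; rw [coord_spherePt]; exact h1.1
    · change sphereCoord k _ ∈ U'; rw [coord_spherePt]; exact h1.2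
  · intro b hb
    rw [hφW _ ⟨hb.1.2, hb.2.2⟩, spherePt_coord k hb.1.1]

/-- A linear bundle is trivial over a neighbourhood of every closed rectangle. -/
theorem LinearHPBundle.exists_linTriv (B : LinearHPBundle n I M) (k : Fin 2) {a b c d : ℝ}
    (hab : a ≤ b) (hcd : c ≤ d) :
    Nonempty (LinTriv B (chartSet k (Icc a b ×ℂ Icc c d))) := by
  obtain ⟨ε, hε, ⟨T⟩⟩ := rect_induction (P := fun U => Nonempty (LinTriv B (chartSet k U)))
    hab hcd (fun U V hUV ⟨T⟩ => ⟨T.restrict (chartSet_mono k hUV)⟩)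
    (fun z _ => by
      obtain ⟨e, he, hz⟩ := B.cover (spherePt k z)
      refine ⟨spherePt k ⁻¹' e.baseSet, (e.open_baseSet.preimage
        (contMDiff_spherePt k).continuous).mem_nhds hz, ⟨(LinTriv.ofMem he).restrict ?_⟩⟩
      intro b hb
      have := hb.2
      rwa [mem_preimage, mem_preimage, spherePt_coord k hb.1] at this)
    (fun x y x' y' c d h1 h2 h3 hT hT' => by
      obtain ⟨t, ht1, ht2, φ, hφ, hφt, hφm⟩ := exists_smooth_squeeze h2
      have hΦ : ContDiff ℝ ∞ fun z : ℂ => Complex.equivRealProdCLM.symm (φ z.re, z.im) :=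
        Complex.equivRealProdCLM.symm.contDiff.comp
          ((hφ.comp Complex.reCLM.contDiff).prodMk Complex.imCLM.contDiff)
      obtain ⟨T⟩ := LinTriv.exists_chartSet_union (k := k) (W := Ioo x t ×ℂ Ioo c d)
        (isOpen_reProdIm isOpen_Ioo isOpen_Ioo) (isOpen_reProdIm isOpen_Ioo isOpen_Ioo)
        (reProdIm_mono (Ioo_subset_Ioo le_rfl ht2.le) Subset.rfl) hΦ
        (fun z hz => by
          obtain ⟨⟨h4, h5⟩, h6⟩ := hz
          obtain ⟨h7, h8⟩ := hφm z.re h4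
          exact ⟨⟨⟨h1.trans h7, h8⟩, h6⟩, ⟨h7, h8.trans h3⟩, h6⟩)
        (fun z hz => Complex.ext (hφt z.re hz.1.1.2) rfl) hT hT'
      refine ⟨T.restrict (chartSet_mono k ?_)⟩
      rintro z ⟨⟨h4, h5⟩, h6⟩
      rcases lt_or_ge z.re t with h7 | h7
      · exact Or.inl ⟨⟨h4, h7⟩, h6⟩
      · exact Or.inr ⟨⟨ht1.trans_le h7, h5⟩, h6⟩)
    (fun x y x' y' c d h1 h2 h3 hT hT' => by
      obtain ⟨t, ht1, ht2, φ, hφ, hφt, hφm⟩ := exists_smooth_squeeze h2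
      have hΦ : ContDiff ℝ ∞ fun z : ℂ => Complex.equivRealProdCLM.symm (z.re, φ z.im) :=
        Complex.equivRealProdCLM.symm.contDiff.comp
          (Complex.reCLM.contDiff.prodMk (hφ.comp Complex.imCLM.contDiff))
      obtain ⟨T⟩ := LinTriv.exists_chartSet_union (k := k) (W := Ioo c d ×ℂ Ioo x t)
        (isOpen_reProdIm isOpen_Ioo isOpen_Ioo) (isOpen_reProdIm isOpen_Ioo isOpen_Ioo)
        (reProdIm_mono Subset.rfl (Ioo_subset_Ioo le_rfl ht2.le)) hΦ
        (fun z hz => by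
          obtain ⟨h6, h4, h5⟩ := hz
          obtain ⟨h7, h8⟩ := hφm z.im h4
          exact ⟨⟨h6, h1.trans h7, h8⟩, h6, h7, h8.trans h3⟩)
        (fun z hz => Complex.ext rfl (hφt z.im hz.1.2.2)) hT hT'
      refine ⟨T.restrict (chartSet_mono k ?_)⟩
      rintro z ⟨h6, h4, h5⟩
      rcases lt_or_ge z.im t with h7 | h7
      · exact Or.inl ⟨h6, h4, h7⟩
      · exact Or.inr ⟨h6, ht1.trans_le h7, h5⟩)
  refine ⟨T.restrict (chartSet_mono k (reProdIm_mono ?_ ?_))⟩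
  · intro t ht; constructor <;> linarith [ht.1, ht.2]
  · intro t ht; constructor <;> linarith [ht.1, ht.2]

/-! Bundles with the same transition maps are isomorphic -/

/-- The map of total spaces that is the identity in two pairs of trivializations. -/
def glueMap (T₀ : LinTriv B V) (T₁ : LinTriv B V') (T₀' : LinTriv B' V) (T₁' : LinTriv B' V') :
    M → M' :=
  open scoped Classical in fun m => if B.proj m ∈ V then T₀'.inv (B.proj m) (T₀.coord m)
    else T₁'.inv (B.proj m) (T₁.coord m)

theorem glueMap_of_mem (T₀ : LinTriv B V) (T₁ : LinTriv B V') (T₀' : LinTriv B' V)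
    (T₁' : LinTriv B' V') {m : M} (hm : B.proj m ∈ V) :
    glueMap T₀ T₁ T₀' T₁' m = T₀'.inv (B.proj m) (T₀.coord m) := if_pos hm

/-- Equality of the transition maps says precisely that the two local formulas agree over `V ∩ V'`,
so the case distinction in `glueMap` is harmless. -/
theorem glueMap_of_mem' (T₀ : LinTriv B V) (T₁ : LinTriv B V') (T₀' : LinTriv B' V)
    (T₁' : LinTriv B' V')
    (h : ∀ b ∈ V ∩ V', ∀ x, T₁.coord (T₀.inv b x) = T₁'.coord (T₀'.inv b x))
    {m : M} (hm : B.proj m ∈ V') :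
    glueMap T₀ T₁ T₀' T₁' m = T₁'.inv (B.proj m) (T₁.coord m) := by
  by_cases hV : B.proj m ∈ V
  · rw [glueMap_of_mem _ _ _ _ hV, ← T₀'.inv_transition T₁' hV hm, ← h _ ⟨hV, hm⟩,
      T₀.inv_coord m hV]
  · exact if_neg hV

theorem contMDiff_glueMap (T₀ : LinTriv B V) (T₁ : LinTriv B V') (T₀' : LinTriv B' V)
    (T₁' : LinTriv B' V') (oV : IsOpen V) (oV' : IsOpen V') (hcov : ∀ b, b ∈ V ∨ b ∈ V')
    (h : ∀ b ∈ V ∩ V', ∀ x, T₁.coord (T₀.inv b x) = T₁'.coord (T₀'.inv b x)) :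
    ContMDiff I I' ∞ (glueMap T₀ T₁ T₀' T₁') := by
  refine contMDiff_of_contMDiffOn_union_of_isOpen (s := B.proj ⁻¹' V) (t := B.proj ⁻¹' V')
    ((T₀'.smooth_inv.comp (f := fun m => (B.proj m, T₀.coord m))
      (B.contMDiff_proj.contMDiffOn.prodMk T₀.smooth_coord) fun m hm => ⟨hm, mem_univ _⟩).congr
      fun m hm => glueMap_of_mem T₀ T₁ T₀' T₁' hm)
    ((T₁'.smooth_inv.comp (f := fun m => (B.proj m, T₁.coord m))
      (B.contMDiff_proj.contMDiffOn.prodMk T₁.smooth_coord) fun m hm => ⟨hm, mem_univ _⟩).congr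
      fun m hm => glueMap_of_mem' T₀ T₁ T₀' T₁' h hm)
    (eq_univ_of_forall fun m => hcov _) (isOpen_preimage_proj B oV) (isOpen_preimage_proj B oV')

theorem proj_glueMap (T₀ : LinTriv B V) (T₁ : LinTriv B V') (T₀' : LinTriv B' V)
    (T₁' : LinTriv B' V') (hcov : ∀ b, b ∈ V ∨ b ∈ V')
    (h : ∀ b ∈ V ∩ V', ∀ x, T₁.coord (T₀.inv b x) = T₁'.coord (T₀'.inv b x)) (m : M) :
    B'.proj (glueMap T₀ T₁ T₀' T₁' m) = B.proj m := by
  rcases hcov (B.proj m) with hm | hm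
  · rw [glueMap_of_mem _ _ _ _ hm, T₀'.proj_inv _ hm]
  · rw [glueMap_of_mem' _ _ _ _ h hm, T₁'.proj_inv _ hm]

theorem glueMap_glueMap (T₀ : LinTriv B V) (T₁ : LinTriv B V') (T₀' : LinTriv B' V)
    (T₁' : LinTriv B' V') (hcov : ∀ b, b ∈ V ∨ b ∈ V')
    (h : ∀ b ∈ V ∩ V', ∀ x, T₁.coord (T₀.inv b x) = T₁'.coord (T₀'.inv b x)) (m : M) :
    glueMap T₀' T₁' T₀ T₁ (glueMap T₀ T₁ T₀' T₁' m) = m := by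
  have hp := proj_glueMap T₀ T₁ T₀' T₁' hcov h m
  have h' := fun b hb x => (h b hb x).symm
  rcases hcov (B.proj m) with hm | hm
  · rw [glueMap_of_mem _ _ _ _ (by rwa [hp]), hp, glueMap_of_mem _ _ _ _ hm, T₀'.coord_inv _ hm,
      T₀.inv_coord m hm]
  · rw [glueMap_of_mem' _ _ _ _ h' (by rwa [hp]), hp, glueMap_of_mem' _ _ _ _ h hm,
      T₁'.coord_inv _ hm, T₁.inv_coord m hm]

/-- The map that identifies `T` with `T'` is, in admissible charts, a composite of two linear
transitions. -/
theorem LinTriv.exists_linear_conj (T : LinTriv B V) (T' : LinTriv B' V)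
    {e : Bundle.Trivialization (HP n) B.proj} (he : e ∈ B.atlas)
    {e' : Bundle.Trivialization (HP n) B'.proj} (he' : e' ∈ B'.atlas) {b : S2} (hb : b ∈ V)
    (hbe : b ∈ e.baseSet ∩ e'.baseSet) : ∃ A : Sp n, ∀ x : HP n,
      e' (T'.inv b (T.coord (e.toOpenPartialHomeomorph.symm (b, x)))) = (b, A • x) := by
  obtain ⟨A, hA⟩ := ((LinTriv.ofMem he).transition T).linear b ⟨hbe.1, hb⟩
  obtain ⟨A', hA'⟩ := T'.linear e' he' b ⟨hb, hbe.2⟩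
  refine ⟨A' * A, fun x => ?_⟩
  rw [hA', mul_smul]
  exact congrArg (fun y => (b, A' • y)) (hA x)

/-- Linear bundles with trivializations over the same two sets and the same transition maps are
isomorphic. -/
theorem LinearHPBundle.isomorphic_of_transition_eq (T₀ : LinTriv B V) (T₁ : LinTriv B V')
    (T₀' : LinTriv B' V) (T₁' : LinTriv B' V') (oV : IsOpen V) (oV' : IsOpen V')
    (hcov : ∀ b, b ∈ V ∨ b ∈ V')
    (h : ∀ b ∈ V ∩ V', ∀ x, T₁.coord (T₀.inv b x) = T₁'.coord (T₀'.inv b x)) :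
    B.Isomorphic B' := by
  have h' := fun b hb x => (h b hb x).symm
  refine ⟨⟨⟨glueMap T₀ T₁ T₀' T₁', glueMap T₀' T₁' T₀ T₁, glueMap_glueMap _ _ _ _ hcov h,
    glueMap_glueMap _ _ _ _ hcov h'⟩, contMDiff_glueMap _ _ _ _ oV oV' hcov h,
    contMDiff_glueMap _ _ _ _ oV oV' hcov h'⟩, proj_glueMap _ _ _ _ hcov h, ?_⟩
  intro e he e' he' b hb
  have hp : ∀ x, B.proj (e.toOpenPartialHomeomorph.symm (b, x)) = b := fun x =>
    e.proj_symm_apply (e.mem_target.2 hb.1)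
  change ∃ A : Sp n, ∀ x, e' (glueMap T₀ T₁ T₀' T₁' (e.toOpenPartialHomeomorph.symm (b, x))) = _
  rcases hcov b with hm | hm
  · obtain ⟨A, hA⟩ := T₀.exists_linear_conj T₀' he he' hm hb
    refine ⟨A, fun x => ?_⟩
    rw [glueMap_of_mem _ _ _ _ (by rwa [hp]), hp, hA]
  · obtain ⟨A, hA⟩ := T₁.exists_linear_conj T₁' he he' hm hb
    refine ⟨A, fun x => ?_⟩
    rw [glueMap_of_mem' _ _ _ _ h (by rwa [hp]), hp, hA]

end Bundles

/-! ### The product bundle -/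

/-- The trivialization of the product bundle. -/
def prodTriv (n : ℕ) : Bundle.Trivialization (HP n) (Prod.fst : S2 × HP n → S2) where
  toOpenPartialHomeomorph := OpenPartialHomeomorph.refl _
  baseSet := univ
  open_baseSet := isOpen_univ
  source_eq := by simp
  target_eq := by simp
  proj_toFun _ _ := rfl

/-- The product bundle. -/
def prodBundle (n : ℕ) : LinearHPBundle n (modelS2.prod (modelHP n)) (S2 × HP n) where
  proj := Prod.fst
  atlas := {prodTriv n}
  cover b := ⟨prodTriv n, rfl, mem_univ b⟩
  smooth e he := by rw [mem_singleton_iff.1 he]; exact contMDiffOn_id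
  smooth_symm e he := by rw [mem_singleton_iff.1 he]; exact contMDiffOn_id
  linear e he e' he' b _ := by
    rw [mem_singleton_iff.1 he, mem_singleton_iff.1 he']
    exact ⟨1, fun x => by rw [one_smul]; rfl⟩

/-- The trivialization of the product bundle over a subset. -/
def prodLinTriv (n : ℕ) (V : Set S2) : LinTriv (prodBundle n) V :=
  (LinTriv.ofMem (B := prodBundle n) (e := prodTriv n) rfl).restrict (subset_univ V)

theorem LinearHPBundle.isTrivial_of_isomorphic {n : ℕ} {E : Type*} [NormedAddCommGroup E]
    [NormedSpace ℝ E] {H : Type*} [TopologicalSpace H] {I : ModelWithCorners ℝ E H} {M : Type*}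
    [TopologicalSpace M] [ChartedSpace H M] {B : LinearHPBundle n I M}
    (h : B.Isomorphic (prodBundle n)) : B.IsTrivial := by
  obtain ⟨Φ, hΦ, hl⟩ := h
  exact ⟨Φ, hΦ, fun e he b hb => hl e he _ rfl b ⟨hb, mem_univ b⟩⟩

/-! ### Smoothness of the action of matrices -/

section smul

variable {E : Type*} [NormedAddCommGroup E] [NormedSpace ℝ E] {H : Type*} [TopologicalSpace H]
  {I : ModelWithCorners ℝ E H} {X : Type*} [TopologicalSpace X] [ChartedSpace H X] {n : ℕ}

/-- In homogeneous coordinates the action is polynomial. The matrices need not be invertible, so the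
lemma also applies off the group. -/
theorem contMDiffAt_ofVec_mulVec {A : X → Matrix (Fin (n + 1)) (Fin (n + 1)) ℍ}
    {r : X → Fin (n + 1) → ℍ} {p : X}
    (hA : ∀ i j, ContMDiffAt I 𝓘(ℝ, ℍ) ∞ (fun q => A q i j) p)
    (hr : ContMDiffAt I 𝓘(ℝ, Fin (n + 1) → ℍ) ∞ r p) (h0 : A p *ᵥ r p ≠ 0) :
    ContMDiffAt I (modelHP n) ∞ (fun q => HP.ofVec (A q *ᵥ r q)) p := by
  have hA' : ContMDiffAt I 𝓘(ℝ, Fin (n + 1) → Fin (n + 1) → ℍ) ∞ (fun q i j => A q i j) p :=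
    contMDiffAt_pi_space.2 fun i => contMDiffAt_pi_space.2 fun j => hA i j
  have hm : ContDiff ℝ ∞ fun q : (Fin (n + 1) → Fin (n + 1) → ℍ) × (Fin (n + 1) → ℍ) =>
      fun i => ∑ j, q.1 i j * q.2 j := by fun_prop
  exact (contMDiffAt_ofVec (v := A p *ᵥ r p) h0).comp p
    (hm.contMDiff.contMDiffAt.comp p (hA'.prodMk_space hr))

theorem contMDiffAt_Sp_smul {f : X → Sp n} {g : X → HP n} {p : X}
    (hf : ∀ i j, ContMDiffAt I 𝓘(ℝ, ℍ) ∞ (fun q => (f q).1 i j) p)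
    (hg : ContMDiffAt I (modelHP n) ∞ g p) :
    ContMDiffAt I (modelHP n) ∞ (fun q => f q • g q) p := by
  obtain ⟨r, hr, hr0, hre⟩ := (g p).exists_smooth_vec
  refine (contMDiffAt_ofVec_mulVec (A := fun q => (f q).1) (r := fun q => r (g q)) hf
    (hr.comp p hg) (Sp.mulVec_ne_zero _ (hr0 _))).congr_of_eventuallyEq ?_
  filter_upwards [hg.continuousAt.eventually hre] with q hq
  rw [← HP.Sp_smul_ofVec _ (hr0 _), hq]

end smul

theorem SmoothSpOn.contMDiffOn_smul {n : ℕ} {f : ℂ → Sp n} {U : Set ℂ} (hU : IsOpen U)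
    (hf : SmoothSpOn f U) {c : S2 → ℂ} {V : Set S2} (hc : ContMDiffOn modelS2 𝓘(ℝ, ℂ) ∞ c V)
    (hcV : MapsTo c V U) (hV : IsOpen V) :
    ContMDiffOn (modelS2.prod (modelHP n)) (modelHP n) ∞
      (fun p : S2 × HP n => f (c p.1) • p.2) (V ×ˢ univ) := by
  intro p hp
  refine ContMDiffAt.contMDiffWithinAt ?_
  refine contMDiffAt_Sp_smul (f := fun q : S2 × HP n => f (c q.1)) (fun i j => ?_)
    contMDiffAt_snd
  have h1 : ContMDiffAt modelS2 𝓘(ℝ, ℂ) ∞ c p.1 := hc.contMDiffAt (hV.mem_nhds hp.1)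
  have h2 := ((hf i j).contDiffAt (hU.mem_nhds (hcV hp.1))).contMDiffAt
  exact (h2.comp p.1 h1).comp p contMDiffAt_fst

theorem SmoothSpOn.sphereFamily {n : ℕ} {f : ℂ → Sp n} {U : Set ℂ} (hU : IsOpen U)
    (hf : SmoothSpOn f U) (k : Fin 2) :
    IsSphereFamilyOn (fun (b : S2) (x : HP n) => f (sphereCoord k b) • x)
      (fun (b : S2) (x : HP n) => (f (sphereCoord k b))⁻¹ • x) (chartSet k U) := by
  have hc : ContMDiffOn modelS2 𝓘(ℝ, ℂ) ∞ (sphereCoord k) (chartSet k U) :=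
    (contMDiffOn_sphereCoord k).mono inter_subset_left
  exact
    { smooth := hf.contMDiffOn_smul hU hc inter_subset_right (isOpen_chartSet k hU)
      smooth_inv := hf.inv.contMDiffOn_smul hU hc inter_subset_right (isOpen_chartSet k hU)
      inv_left := fun b _ x => inv_smul_smul (f (sphereCoord k b)) x
      inv_right := fun b _ x => smul_inv_smul (f (sphereCoord k b)) x
      linear := fun b _ => ⟨f (sphereCoord k b), fun x => rfl⟩ }

/-! ### The circle in `Sp(n+1)` -/

/-- The scalar matrix with entry a unit complex number. -/
def circleSp (n : ℕ) (μ : Circle) : Sp n :=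
  ⟨Matrix.scalar _ ((μ : ℂ) : ℍ), by
    have h : star ((μ : ℂ) : ℍ) * ((μ : ℂ) : ℍ) = 1 := by
      rw [Quaternion.star_mul_self, Quaternion.normSq_def']
      simp only [Quaternion.re_coeComplex, Quaternion.imI_coeComplex, Quaternion.imJ_coeComplex,
        Quaternion.imK_coeComplex]
      have := Circle.normSq_coe μ
      rw [Complex.normSq_apply] at this
      rw [← Quaternion.coe_one]; congr 1; linarith
    have h' : ((μ : ℂ) : ℍ) * star ((μ : ℂ) : ℍ) = 1 := by
      rw [Quaternion.self_mul_star, ← Quaternion.star_mul_self, h]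
    rw [Unitary.mem_iff, Matrix.star_eq_conjTranspose, Matrix.scalar_apply,
      Matrix.diagonal_conjTranspose, Matrix.diagonal_mul_diagonal, Matrix.diagonal_mul_diagonal,
      ← Matrix.diagonal_one]
    exact ⟨congrArg _ (funext fun _ => h), congrArg _ (funext fun _ => h')⟩⟩

/-- Lifting the circle action to `Sp n` needs a square root of `z`; this double valuedness is the
source of the non-trivial bundle. -/
theorem circle_smul_eq_circleSp {n : ℕ} {z μ : Circle} (h : μ * μ = z) (x : HP n) :
    z • x = circleSp n μ • x := by
  rw [circle_smul_eq h]
  change (circleToGLH μ : GLH n) • x = Unitary.toUnits (circleSp n μ) • x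
  congr 1
  exact Units.ext rfl

/-- Here `t` is half the angle of the acting circle element, so adding `π` is one full turn, over
which the lift changes sign. -/
theorem circleSp_exp_add_pi {n : ℕ} (t : ℝ) :
    circleSp n (Circle.exp (t + Real.pi)) = -circleSp n (Circle.exp t) := by
  refine Subtype.ext ?_
  rw [Sp.coe_neg]
  have : ((Circle.exp (t + Real.pi) : ℂ) : ℍ) = -((Circle.exp t : ℂ) : ℍ) := by
    rw [Circle.coe_exp, Circle.coe_exp]
    push_cast
    rw [add_mul, Complex.exp_add, Complex.exp_pi_mul_I, mul_neg_one]
    exact map_neg Quaternion.ofComplex _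
  change Matrix.scalar _ _ = -Matrix.scalar _ _
  rw [this, map_neg]

theorem contDiff_circleSp {n : ℕ} (i j : Fin (n + 1)) :
    ContDiff ℝ ∞ fun t : ℝ => (circleSp n (Circle.exp t)).1 i j := by
  have h1 : ContDiff ℝ ∞ fun t : ℝ => ((Circle.exp t : ℂ) : ℍ) := by
    simp only [Circle.coe_exp]
    refine contDiff_coeComplex.comp (ContDiff.cexp ?_)
    exact Complex.ofRealCLM.contDiff.mul contDiff_const
  by_cases hij : i = j
  · subst hij
    convert h1 using 2 with t
    exact Matrix.diagonal_apply_eq _ _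
  · convert contDiff_const (c := (0 : ℍ)) using 2 with t
    exact Matrix.diagonal_apply_ne _ hij

/-! ### Families over an annulus -/

/-- `log (-z) + πi` is a branch of the logarithm that is smooth across the negative axis; it exceeds
the principal one by `0` or by `2πi`. -/
theorem log_eq_of_neg_mem_slitPlane {z : ℂ} (hz : -z ∈ Complex.slitPlane) :
    Complex.log z = Complex.log (-z) + Real.pi * Complex.I ∨
      (Complex.log z = Complex.log (-z) - Real.pi * Complex.I) := by
  have h0 : -z ≠ 0 := Complex.slitPlane_ne_zero hz
  have e1 : Complex.exp (Complex.log (-z) + Real.pi * Complex.I) = z := by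
    rw [Complex.exp_add, Complex.exp_log h0, Complex.exp_pi_mul_I]; ring
  have e2 : Complex.exp (Complex.log (-z) - Real.pi * Complex.I) = z := by
    rw [Complex.exp_sub, Complex.exp_log h0, Complex.exp_pi_mul_I]; ring
  have h1 : -Real.pi < (Complex.log (-z)).im := Complex.neg_pi_lt_log_im _
  have h2 : (Complex.log (-z)).im ≤ Real.pi := Complex.log_im_le_pi _
  rcases le_or_gt (Complex.log (-z)).im 0 with h | h
  · left
    rw [← e1, Complex.log_exp, e1]
    · simp; linarith [Real.pi_pos]
    · simp; linarith
  · right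
    rw [← e2, Complex.log_exp, e2]
    · simp; linarith [Real.pi_pos]
    · simp; linarith

/-- A `2πi`-periodic family descends along the exponential map. -/
theorem SmoothSpOn.comp_log {n : ℕ} {f : ℂ → Sp n} {s ε : ℝ} (hε : 0 < ε)
    (hf : SmoothSpOn f (Ioo (-s) s ×ℂ Ioo (-Real.pi - ε) (Real.pi + ε)))
    (hper : ∀ w ∈ Ioo (-s) s ×ℂ Ioo (-Real.pi - ε) (-Real.pi + ε),
      f (w + 2 * Real.pi * Complex.I) = f w) :
    SmoothSpOn (fun z => f (Complex.log z)) {z | z ≠ 0 ∧ Real.log ‖z‖ ∈ Ioo (-s) s} := by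
  have hlog : ∀ z ∈ Complex.slitPlane, ContDiffAt ℝ ∞ Complex.log z := fun z hz =>
    (Complex.contDiffAt_log hz).restrict_scalars ℝ
  intro i j z hz
  refine ContDiffAt.contDiffWithinAt ?_
  have hopen : IsOpen (Ioo (-s) s ×ℂ Ioo (-Real.pi - ε) (Real.pi + ε)) :=
    isOpen_reProdIm isOpen_Ioo isOpen_Ioo
  by_cases hs : z ∈ Complex.slitPlane
  · have hm : Complex.log z ∈ Ioo (-s) s ×ℂ Ioo (-Real.pi - ε) (Real.pi + ε) := by
      refine ⟨?_, ?_, ?_⟩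
      · change (Complex.log z).re ∈ Ioo (-s) s; rw [Complex.log_re]; exact hz.2
      · linarith [Complex.neg_pi_lt_log_im z]
      · linarith [Complex.log_im_le_pi z]
    exact ((hf i j).contDiffAt (hopen.mem_nhds hm)).comp z (hlog z hs)
  · have hs' : -z ∈ Complex.slitPlane := by
      rw [Complex.mem_slitPlane_iff] at hs ⊢
      push Not at hs
      left
      have : z.re ≠ 0 := fun h => hz.1 (Complex.ext h hs.2)
      rw [Complex.neg_re]
      have := lt_of_le_of_ne hs.1 this
      linarith
    have him : (Complex.log (-z)).im = 0 := by
      rw [Complex.mem_slitPlane_iff] at hs hs'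
      push Not at hs
      rw [Complex.log_im, Complex.arg_eq_zero_iff]
      refine ⟨?_, by simp [hs.2]⟩
      rw [Complex.neg_re]; linarith [hs.1]
    -- Across the negative axis the principal logarithm jumps by `2πi`. It is replaced by the branch
    -- `log (-y) + πi`, and periodicity hides the difference from `f`; the margin `ε` keeps both
    -- values in the domain.
    have hg : ContDiffAt ℝ ∞ (fun y : ℂ => Complex.log (-y) + Real.pi * Complex.I) z :=
      ((hlog _ hs').comp z contDiff_neg.contDiffAt).add contDiffAt_const
    have hm : Complex.log (-z) + Real.pi * Complex.I ∈
        Ioo (-s) s ×ℂ Ioo (-Real.pi - ε) (Real.pi + ε) := by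
      refine ⟨?_, ?_, ?_⟩
      · simpa [Complex.log_re] using hz.2
      · simp [him]; linarith [Real.pi_pos]
      · simp [him]; linarith [Real.pi_pos]
    refine ContDiffAt.congr_of_eventuallyEq (((hf i j).contDiffAt (hopen.mem_nhds hm)).comp z hg) ?_
    have hc := hg.continuousAt.eventually ((isOpen_reProdIm
      (isOpen_Ioo (a := -s) (b := s)) (isOpen_Ioo (a := Real.pi - ε) (b := Real.pi + ε))).mem_nhds
      ⟨hm.1, by simp [him]; linarith, hm.2.2⟩)
    have hc' : ∀ᶠ y : ℂ in 𝓝 z, -y ∈ Complex.slitPlane :=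
      continuous_neg.continuousAt.eventually (Complex.isOpen_slitPlane.mem_nhds hs')
    filter_upwards [hc, hc'] with y hy hy'
    rcases log_eq_of_neg_mem_slitPlane hy' with h | h
    · simp only [h]; rfl
    · have h2 : Complex.log (-y) + Real.pi * Complex.I =
          Complex.log y + 2 * Real.pi * Complex.I := by rw [h]; ring
      change _ = (f (Complex.log (-y) + Real.pi * Complex.I)).1 i j
      rw [h2] at hy ⊢
      rw [hper]
      obtain ⟨h3, h4, h5⟩ := hy
      refine ⟨by simpa using h3, ?_, ?_⟩
      · simp at h4; linarith
      · simp at h5; linarith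

/-- A linear family over an annulus lifts to `Sp(n+1)`, if necessary after composition with the
family of circle actions. -/
theorem IsLinearFamilyOn.dichotomy {n : ℕ} (hn : 1 ≤ n) {F : ℂ → HP n → HP n}
    (hF : IsLinearFamilyOn F {z | 3⁻¹ < ‖z‖ ∧ ‖z‖ < 3}) :
    ∃ h : ℂ → Sp n, SmoothSpOn h (annulus 2⁻¹) ∧ ((∀ z ∈ annulus 2⁻¹, ∀ x, F z x = h z • x) ∨
      ∀ z ∈ annulus 2⁻¹, ∀ x, F z x = h z • (phase z)⁻¹ • x) := by
  set W : Set ℂ := {w | 3⁻¹ < ‖Complex.exp w‖ ∧ ‖Complex.exp w‖ < 3} with hW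
  have oW : IsOpen W := by
    have hc : Continuous fun w : ℂ => ‖Complex.exp w‖ := by fun_prop
    exact (isOpen_lt continuous_const hc).inter (isOpen_lt hc continuous_const)
  have hexp : ContDiff ℝ ∞ Complex.exp := Complex.contDiff_exp
  -- On the logarithmic cover the annulus becomes a strip, and a lift exists over a rectangle of
  -- height `2π` with some margin.
  have hG : IsLinearFamilyOn (fun w => F (Complex.exp w)) W :=
    ⟨hF.smooth.comp (f := fun p : ℂ × HP n => (Complex.exp p.1, p.2))
      ((hexp.contMDiff.comp contMDiff_fst).prodMk contMDiff_snd).contMDiffOn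
      fun p hp => ⟨hp.1, mem_univ _⟩, fun w hw => hF.linear _ hw⟩
  have hl2 : 0 < Real.log 2 := Real.log_pos (by norm_num)
  obtain ⟨ε, hε, h, hh⟩ := hG.exists_lift_rect hn oW (a := -Real.log 2) (b := Real.log 2)
    (c := -Real.pi) (d := Real.pi) (by linarith) (by linarith [Real.pi_pos]) (by
      rintro w ⟨⟨h1, h2⟩, -⟩
      have h3 : Real.exp (-Real.log 2) ≤ Real.exp w.re := Real.exp_le_exp.2 h1
      have h4 : Real.exp w.re ≤ Real.exp (Real.log 2) := Real.exp_le_exp.2 h2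
      rw [Real.exp_neg, Real.exp_log (by norm_num)] at h3
      rw [Real.exp_log (by norm_num)] at h4
      change 3⁻¹ < ‖Complex.exp w‖ ∧ ‖Complex.exp w‖ < 3
      rw [Complex.norm_exp]
      constructor
      · exact lt_of_lt_of_le (by norm_num) h3
      · linarith)
  set s := Real.log 2 + ε with hs
  have hs' : -Real.log 2 - ε = -s := by rw [hs]; ring
  rw [hs'] at hh
  have hsub : annulus 2⁻¹ ⊆ {z | z ≠ 0 ∧ Real.log ‖z‖ ∈ Ioo (-s) s} := by
    rintro z ⟨h1, h2⟩
    have h0 : 0 < ‖z‖ := lt_trans (by norm_num) h1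
    refine ⟨norm_pos_iff.1 h0, ?_, ?_⟩
    · have := Real.log_lt_log (by norm_num) h1
      rw [Real.log_inv] at this; linarith
    · have := Real.log_lt_log h0 h2; linarith
  have hlogm : ∀ z ∈ annulus 2⁻¹, Complex.log z ∈
      Ioo (-s) s ×ℂ Ioo (-Real.pi - ε) (Real.pi + ε) := by
    intro z hz
    refine ⟨?_, ?_, ?_⟩
    · change (Complex.log z).re ∈ Ioo (-s) s; rw [Complex.log_re]; exact (hsub hz).2
    · linarith [Complex.neg_pi_lt_log_im z]
    · linarith [Complex.log_im_le_pi z]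
  set R := Ioo (-s) s ×ℂ Ioo (-Real.pi - ε) (-Real.pi + ε) with hR
  have hR1 : R ⊆ Ioo (-s) s ×ℂ Ioo (-Real.pi - ε) (Real.pi + ε) :=
    reProdIm_mono Subset.rfl (Ioo_subset_Ioo le_rfl (by linarith [Real.pi_pos]))
  have hR2 : ∀ w ∈ R, w + 2 * Real.pi * Complex.I ∈
      Ioo (-s) s ×ℂ Ioo (-Real.pi - ε) (Real.pi + ε) := by
    rintro w ⟨h1, h2, h3⟩
    refine ⟨by simpa using h1, ?_, ?_⟩
    · simp at h2 ⊢; linarith [Real.pi_pos]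
    · simp at h3 ⊢; linarith
  -- Translation by the period gives a second lift of the same family near the lower edge. The sign
  -- between the two lifts is the monodromy of `F`.
  have hshift : IsLiftOn (fun w => F (Complex.exp w)) (fun w => h (w + 2 * Real.pi * Complex.I)) R :=
    ⟨hh.1.comp (contDiffOn_id.add contDiffOn_const) hR2, fun w hw x => by
      rw [← hh.2 _ (hR2 w hw) x]
      change F (Complex.exp w) x = F (Complex.exp (w + 2 * Real.pi * Complex.I)) x
      rw [Complex.exp_periodic]⟩
  have hex : ∀ z ∈ annulus 2⁻¹, ∀ x, F z x = h (Complex.log z) • x := by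
    intro z hz x
    rw [← hh.2 _ (hlogm z hz) x]
    change F z x = F (Complex.exp (Complex.log z)) x
    rw [Complex.exp_log (hsub hz).1]
  rcases hshift.eq_or_eq_neg hn (isPreconnected_rect _ _ _ _) (hh.mono hR1) with e | e
  · exact ⟨fun z => h (Complex.log z), (hh.1.comp_log hε e).mono hsub, Or.inl hex⟩
  -- For monodromy `-1`: the factor `e^{i Im w / 2}` also changes sign over a period, so the product
  -- is periodic. It lifts `F z` composed with the action of `phase z`.
  · set g : ℂ → Sp n := fun w => h w * circleSp n (Circle.exp (w.im / 2)) with hg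
    have hgs : SmoothSpOn g (Ioo (-s) s ×ℂ Ioo (-Real.pi - ε) (Real.pi + ε)) := by
      refine hh.1.mul fun i j => ContDiff.contDiffOn ?_
      exact (contDiff_circleSp i j).comp (Complex.imCLM.contDiff.div_const 2)
    have hgp : ∀ w ∈ R, g (w + 2 * Real.pi * Complex.I) = g w := by
      intro w hw
      have h1 : (w + 2 * Real.pi * Complex.I).im / 2 = w.im / 2 + Real.pi := by
        simp; ring
      simp only [hg]
      rw [e w hw, h1, circleSp_exp_add_pi, neg_mul_neg]
    refine ⟨fun z => g (Complex.log z), (hgs.comp_log hε hgp).mono hsub, Or.inr fun z hz x => ?_⟩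
    rw [hex z hz x]
    simp only [hg]
    rw [mul_smul, ← circle_smul_eq_circleSp (z := phase z), smul_inv_smul]
    rw [← Circle.exp_add, add_halves, Complex.log_im, phase]

/-! ### The bundle `HP^n ×_{S¹} SU(2) → S²` -/

theorem Tot.chart_mem_maximalAtlas {n : ℕ} (k : Fin 2) (i : Fin (n + 1)) :
    Tot.chart k i ∈ IsManifold.maximalAtlas (modelTot n) ∞ (Tot n) :=
  IsManifold.subset_maximalAtlas
    ⟨_, ⟨k, rfl⟩, _, ⟨_, ⟨i, rfl⟩, OpenPartialHomeomorph.refl ℂ, by simp, rfl⟩, rfl⟩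

/-- A chart of `HP^n × ℂ`. -/
def HP.prodChart {n : ℕ} (i : Fin (n + 1)) :
    OpenPartialHomeomorph (HP n × ℂ) (ModelProd (Fin n → ℍ) ℂ) :=
  (HP.chart i).prod (OpenPartialHomeomorph.refl ℂ)

theorem HP.prodChart_mem_maximalAtlas {n : ℕ} (i : Fin (n + 1)) :
    HP.prodChart i ∈
      IsManifold.maximalAtlas (modelTot n) ∞ (HP n × ℂ) :=
  IsManifold.subset_maximalAtlas ⟨_, ⟨i, rfl⟩, OpenPartialHomeomorph.refl ℂ, by simp, rfl⟩

/-- A chart of the total space is by construction the trivialization followed by a chart of `HP^n ×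
ℂ`, so in these charts the trivialization is the identity. -/
theorem Tot.contMDiffOn_triv {n : ℕ} (k : Fin 2) :
    ContMDiffOn (modelTot n) (modelTot n) ∞ (Tot.triv (n := n) k) (Tot.triv k).source := by
  intro m hm
  obtain ⟨i, hi⟩ := (Tot.triv k m).1.rep.exists_ne
  have hc : m ∈ (Tot.chart k i).source := ⟨hm, hi, mem_univ _⟩
  have h1 := (contMDiffOn_of_mem_maximalAtlas (Tot.chart_mem_maximalAtlas k i)).contMDiffAt
    ((Tot.chart k i).open_source.mem_nhds hc)
  have h2 := (contMDiffOn_symm_of_mem_maximalAtlas (HP.prodChart_mem_maximalAtlas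
    (n := n) i)).contMDiffAt (x := Tot.chart k i m)
    ((HP.prodChart i).open_target.mem_nhds ⟨mem_univ _, mem_univ _⟩)
  refine ((h2.comp m h1).congr_of_eventuallyEq ?_).contMDiffWithinAt
  filter_upwards [(Tot.chart k i).open_source.mem_nhds hc] with m' hm'
  exact ((HP.prodChart i).left_inv hm'.2).symm

theorem Tot.contMDiff_triv_symm {n : ℕ} (k : Fin 2) :
    ContMDiff (modelTot n) (modelTot n) ∞ (Tot.triv (n := n) k).symm := by
  intro p
  obtain ⟨i, hi⟩ := p.1.rep.exists_ne
  have hc : p ∈ (HP.prodChart i).source := ⟨hi, mem_univ _⟩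
  have h1 := (contMDiffOn_of_mem_maximalAtlas (HP.prodChart_mem_maximalAtlas
    (n := n) i)).contMDiffAt
    ((HP.prodChart i).open_source.mem_nhds hc)
  have h2 := (contMDiffOn_symm_of_mem_maximalAtlas (Tot.chart_mem_maximalAtlas k i)).contMDiffAt
    (x := HP.prodChart i p)
    ((Tot.chart k i).open_target.mem_nhds ⟨⟨mem_univ _, mem_univ _⟩, mem_univ _⟩)
  refine (h2.comp p h1).congr_of_eventuallyEq ?_
  filter_upwards [(HP.prodChart i).open_source.mem_nhds hc]
    with p' hp'
  exact congrArg _ ((HP.prodChart i).left_inv hp').symm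

theorem Tot.mem_triv_source {n : ℕ} (k : Fin 2) (p : HP n × SU 2) :
    Tot.mk p ∈ (Tot.triv k).source ↔ p.2.1 k 0 ≠ 0 := Tot.rep_ne_iff k p

theorem Tot.triv_mk {n : ℕ} {k : Fin 2} {p : HP n × SU 2} (h : p.2.1 k 0 ≠ 0) :
    Tot.triv k (Tot.mk p) = trivCoord k p := Tot.trivCoord_rep k p h

theorem Tot.triv_symm_apply {n : ℕ} (k : Fin 2) (y : HP n × ℂ) :
    (Tot.triv k).symm y = Tot.mk (y.1, sec k y.2) := rfl

theorem Tot.mem_triv_source_iff {n : ℕ} (k : Fin 2) (m : Tot n) :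
    m ∈ (Tot.triv k).source ↔ m.proj ∈ sphereBase k := by
  obtain ⟨p, rfl⟩ := Tot.mk_surjective m
  rw [Tot.mem_triv_source]
  exact (hopf_mem_base k p.2).symm

theorem Tot.triv_snd {n : ℕ} {k : Fin 2} {m : Tot n} (hm : m ∈ (Tot.triv k).source) :
    (Tot.triv k m).2 = sphereCoord k m.proj := by
  obtain ⟨p, rfl⟩ := Tot.mk_surjective m
  rw [Tot.mem_triv_source] at hm
  rw [Tot.triv_mk hm]
  exact (coord_hopf k p.2 hm).symm

theorem Tot.proj_eq {n : ℕ} {k : Fin 2} {m : Tot n} (hm : m ∈ (Tot.triv k).source) :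
    m.proj = spherePt k (Tot.triv k m).2 := by
  rw [Tot.triv_snd hm, spherePt_coord k ((Tot.mem_triv_source_iff k m).1 hm)]

theorem Tot.exists_mem_triv_source {n : ℕ} (m : Tot n) : ∃ k, m ∈ (Tot.triv k).source :=
  SU2.exists_ne m.rep.2

theorem Tot.contMDiff_proj {n : ℕ} : ContMDiff (modelTot n) modelS2 ∞ (Tot.proj (n := n)) := by
  intro m
  obtain ⟨k, hk⟩ := m.exists_mem_triv_source
  have h1 := (Tot.contMDiffOn_triv k).contMDiffAt ((Tot.triv k).open_source.mem_nhds hk)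
  have h2 : ContMDiffAt (modelTot n) modelS2 ∞ (fun m' => spherePt k (Tot.triv k m').2) m :=
    ((contMDiff_spherePt k).contMDiffAt.comp _ contMDiffAt_snd).comp m h1
  refine h2.congr_of_eventuallyEq ?_
  filter_upwards [(Tot.triv k).open_source.mem_nhds hk] with m' hm'
  exact Tot.proj_eq hm'

theorem Tot.contMDiffOn_bundle_coord {n : ℕ} (k : Fin 2) :
    ContMDiffOn (modelTot n) (modelS2.prod (modelHP n)) ∞
      (fun m : Tot n => (m.proj, (Tot.triv k m).1)) (Tot.triv k).source :=
  Tot.contMDiff_proj.contMDiffOn.prodMk (contMDiff_fst.comp_contMDiffOn (Tot.contMDiffOn_triv k))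

theorem Tot.contMDiffOn_bundle_inv {n : ℕ} (k : Fin 2) :
    ContMDiffOn (modelS2.prod (modelHP n)) (modelTot n) ∞
      (fun p : S2 × HP n => (Tot.triv k).symm (p.2, sphereCoord k p.1)) (sphereBase k ×ˢ univ) :=
  (Tot.contMDiff_triv_symm k).comp_contMDiffOn (contMDiffOn_snd.prodMk
    ((contMDiffOn_sphereCoord k).comp contMDiffOn_fst fun _ hp => hp.1))

/-- The local trivialization of `HP^n ×_{S¹} SU(2)` over the sphere minus a pole. -/
def Tot.bundleTriv {n : ℕ} (k : Fin 2) : Bundle.Trivialization (HP n) (Tot.proj (n := n)) where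
  toFun m := (m.proj, (Tot.triv k m).1)
  invFun p := (Tot.triv k).symm (p.2, sphereCoord k p.1)
  source := Tot.proj ⁻¹' sphereBase k
  target := sphereBase k ×ˢ univ
  map_source' m hm := ⟨hm, mem_univ _⟩
  map_target' p hp := by
    change spherePt k _ ∈ sphereBase k
    exact spherePt_mem _ _
  left_inv' m hm := by
    have hm' := (Tot.mem_triv_source_iff k m).2 hm
    change (Tot.triv k).symm ((Tot.triv k m).1, sphereCoord k m.proj) = m
    rw [← Tot.triv_snd hm']
    exact (Tot.triv k).left_inv hm'
  right_inv' p hp := by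
    refine Prod.ext ?_ ?_
    · change spherePt k _ = _
      exact spherePt_coord k hp.1
    · change (Tot.triv k ((Tot.triv k).symm (p.2, sphereCoord k p.1))).1 = p.2
      rw [(Tot.triv k).right_inv (mem_univ _)]
  open_source := (isOpen_sphereBase k).preimage Tot.contMDiff_proj.continuous
  open_target := (isOpen_sphereBase k).prod isOpen_univ
  continuousOn_toFun := (Tot.contMDiffOn_bundle_coord k).continuousOn.mono
    fun m hm => (Tot.mem_triv_source_iff k m).2 hm
  continuousOn_invFun := (Tot.contMDiffOn_bundle_inv k).continuousOn
  baseSet := sphereBase k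
  open_baseSet := isOpen_sphereBase k
  source_eq := rfl
  target_eq := rfl
  proj_toFun _ _ := rfl

theorem Tot.bundleTriv_mk {n : ℕ} {k : Fin 2} (x : HP n) {s : SU 2} (hs : s.1 k 0 ≠ 0) :
    Tot.bundleTriv k (Tot.mk (x, s)) = (hopf s, phase (s.1 k 0) • x) := by
  change (hopf s, (Tot.triv k (Tot.mk (x, s))).1) = _
  rw [Tot.triv_mk hs]; rfl

theorem exists_Sp_smul_eq_circle_smul {n : ℕ} (z : Circle) :
    ∃ A : Sp n, ∀ x : HP n, z • x = A • x :=
  ⟨_, circle_smul_eq_circleSp (halfAngle_mul_self z)⟩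

theorem Tot.exists_Sp_bundleTriv_mk {n : ℕ} {k : Fin 2} {s : SU 2} (hs : s.1 k 0 ≠ 0) :
    ∃ A : Sp n, ∀ x : HP n, Tot.bundleTriv k (Tot.mk (x, s)) = (hopf s, A • x) := by
  obtain ⟨A, hA⟩ := exists_Sp_smul_eq_circle_smul (n := n) (phase (s.1 k 0))
  exact ⟨A, fun x => by rw [Tot.bundleTriv_mk x hs, hA]⟩

/-- `HP^n ×_{S¹} SU(2)` as a linear `HP^n`-bundle over `S²`. -/
def totBundle (n : ℕ) : LinearHPBundle n (modelTot n) (Tot n) where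
  proj := Tot.proj
  atlas := range Tot.bundleTriv
  cover b := (sphereBase_cover b).elim (fun h => ⟨_, ⟨0, rfl⟩, h⟩) fun h => ⟨_, ⟨1, rfl⟩, h⟩
  smooth := by
    rintro _ ⟨k, rfl⟩
    exact (Tot.contMDiffOn_bundle_coord k).mono fun m hm => (Tot.mem_triv_source_iff k m).2 hm
  smooth_symm := by
    rintro _ ⟨k, rfl⟩
    exact Tot.contMDiffOn_bundle_inv k
  linear := by
    rintro _ ⟨k, rfl⟩ _ ⟨k', rfl⟩ b ⟨hb, hb'⟩
    have h := spherePt_coord k hb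
    have hs : (sec k (sphereCoord k b)).1 k' 0 ≠ 0 := by
      rw [← hopf_mem_base]
      change spherePt k (sphereCoord k b) ∈ sphereBase k'
      rw [h]
      exact hb'
    obtain ⟨A, hA⟩ := Tot.exists_Sp_bundleTriv_mk (n := n) hs
    refine ⟨A, fun x => ?_⟩
    change Tot.bundleTriv k' (Tot.mk (x, sec k (sphereCoord k b))) = _
    rw [hA]
    exact congrArg (·, A • x) h

/-- The trivialization of `HP^n ×_{S¹} SU(2)` over a part of the sphere minus a pole. -/
def totLinTriv (n : ℕ) (k : Fin 2) : LinTriv (totBundle n) (sphereBase k) :=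
  LinTriv.ofMem (B := totBundle n) ⟨k, rfl⟩

theorem totLinTriv_inv {n : ℕ} (k : Fin 2) (b : S2) (x : HP n) :
    (totLinTriv n k).inv b x = Tot.mk (x, sec k (sphereCoord k b)) := rfl

theorem phase_sec_other (k : Fin 2) (ζ : ℂ) : phase ((sec k ζ).1 (k + 1) 0) = phase ζ := by
  rw [sec_other, div_eq_mul_inv, ← Complex.ofReal_inv, phase_mul_pos (inv_pos.2 (sqrt_pos ζ))]

/-- Over a common base point the two sections differ by a torus element, namely the phase of the
entry that the second section normalizes to be positive; moving it to the fibre gives the factor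
`phase ζ`. -/
theorem Tot.mk_sec_other {n : ℕ} (k : Fin 2) (x : HP n) {ζ : ℂ} (h : ζ ≠ 0) :
    Tot.mk (x, sec k ζ) = Tot.mk (phase ζ • x, sec (k + 1) ζ⁻¹) := by
  have hs : (sec k ζ).1 (k + 1) 0 ≠ 0 := by
    rw [sec_other]
    exact div_ne_zero h (by exact_mod_cast (sqrt_pos ζ).ne')
  rw [← mk_sec_trivCoord (k + 1) (x, sec k ζ) hs]
  have h2 : (trivCoord (k + 1) (x, sec k ζ)).2 = ζ⁻¹ := by
    rw [trivCoord, ← coord_hopf (k + 1) _ hs]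
    have hb := spherePt_mem k ζ
    have := sphereCoord_other hb ((hopf_mem_base _ _).2 hs)
    rw [coord_spherePt] at this
    exact this
  rw [h2, trivCoord, phase_sec_other]

/-- The clutching map of the bundle: on the equator it runs once around the circle, hence half way
around in any lift to `Sp n`. -/
theorem totLinTriv_transition {n : ℕ} (k : Fin 2) {b : S2} (hb : b ∈ sphereBase k)
    (hb' : b ∈ sphereBase (k + 1)) (x : HP n) :
    (totLinTriv n (k + 1)).coord ((totLinTriv n k).inv b x) = phase (sphereCoord k b) • x := by
  have h0 := (mem_sphereBase_other hb).1 hb'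
  rw [totLinTriv_inv, Tot.mk_sec_other k x h0, ← sphereCoord_other hb hb', ← totLinTriv_inv,
    LinTriv.coord_inv _ b hb']

/-! Nontriviality -/

theorem Sp.ne_neg {n : ℕ} (A : Sp n) : A ≠ -A := by
  intro h
  have h1 : A.1 = -A.1 := by rw [← Sp.coe_neg, ← h]
  have h2 : A.1 = 0 := by
    ext1 i j
    have h3 : A.1 i j = -A.1 i j := congrFun (congrFun h1 i) j
    have h4 : (2 : ℝ) • A.1 i j = 0 := by rw [two_smul, ← eq_neg_iff_add_eq_zero]; exact h3
    exact (smul_eq_zero.1 h4).resolve_left two_ne_zero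
  have h3 := Sp.mul_star A
  rw [h2, zero_mul] at h3
  exact zero_ne_one (congrFun (congrFun h3 0) 0 : (0 : ℍ) = (1 : Matrix _ _ ℍ) 0 0)

theorem phase_circle (z : Circle) : phase z = z := by
  have h := phase_mul one_ne_zero z
  rw [one_mul] at h
  rw [h]
  have := phase_ofReal_pos one_pos
  rw [Complex.ofReal_one] at this
  rw [this, one_mul]

/-- A linear trivialization restricts to families of linear maps over the two charts, and each lifts
over a square that contains the unit disc. Comparing the lifts along the equator gives a continuous
sign between a periodic path and one that changes sign over a period. -/
theorem not_isTrivial_totBundle {n : ℕ} (hn : 1 ≤ n) : ¬ (totBundle n).IsTrivial := by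
  rintro ⟨Φ, hΦ, hlin⟩
  have hF : ∀ k, IsLinearFamilyOn (fun ζ (x : HP n) => (Φ (Tot.mk (x, sec k ζ))).2) univ := by
    intro k
    constructor
    · refine ContMDiff.contMDiffOn ?_
      exact contMDiff_snd.comp (Φ.contMDiff.comp ((Tot.contMDiff_triv_symm k).comp
        (contMDiff_snd.prodMk contMDiff_fst)))
    · intro ζ _
      obtain ⟨A, hA⟩ := hlin _ ⟨k, rfl⟩ (spherePt k ζ) (spherePt_mem k ζ)
      refine ⟨A, fun x => ?_⟩
      have := hA x
      change Φ (Tot.mk (x, sec k (sphereCoord k (spherePt k ζ)))) = _ at this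
      rw [coord_spherePt] at this
      rw [this]
  have hlift : ∀ k, ∃ ε > 0, ∃ h : ℂ → Sp n, IsLiftOn
      (fun ζ (x : HP n) => (Φ (Tot.mk (x, sec k ζ))).2) h
      (Ioo (-1 - ε) (1 + ε) ×ℂ Ioo (-1 - ε) (1 + ε)) := fun k =>
    (hF k).exists_lift_rect hn isOpen_univ (by norm_num) (by norm_num) (subset_univ _)
  choose ε hε h hh using hlift
  have hmem : ∀ k (t : ℝ), (Circle.exp t : ℂ) ∈
      Ioo (-1 - ε k) (1 + ε k) ×ℂ Ioo (-1 - ε k) (1 + ε k) := by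
    intro k t
    have h1 := abs_le.1 (Complex.abs_re_le_norm (Circle.exp t : ℂ))
    have h2 := abs_le.1 (Complex.abs_im_le_norm (Circle.exp t : ℂ))
    rw [Circle.norm_coe] at h1 h2
    have := hε k
    exact ⟨⟨by linarith [h1.1], by linarith [h1.2]⟩, ⟨by linarith [h2.1], by linarith [h2.2]⟩⟩
  have hc : ∀ k, Continuous fun t : ℝ => (h k (Circle.exp t)).1 := by
    intro k
    have h1 := (hh k).1.continuousOn
    refine continuous_iff_continuousAt.2 fun t => ?_
    have h2 := h1.continuousAt ((isOpen_reProdIm isOpen_Ioo isOpen_Ioo).mem_nhds (hmem k t))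
    exact ContinuousAt.comp (f := fun t : ℝ => (Circle.exp t : ℂ)) h2
      (by fun_prop)
  have hc1 : Continuous fun t : ℝ => (h 1 (Circle.exp (-t)) * circleSp n (Circle.exp (t / 2))).1 := by
    have h1 : Continuous fun t : ℝ => (circleSp n (Circle.exp t)).1 :=
      continuous_matrix fun i j => (contDiff_circleSp i j).continuous
    exact ((hc 1).comp continuous_neg).matrix_mul (h1.comp (continuous_id.div_const 2))
  -- A point of the equator has coordinates `e^{it}` and `e^{-it}` in the two charts, and the
  -- transition by `e^{it}` lifts to `e^{it/2}`.
  have key : ∀ t : ℝ, h 0 (Circle.exp t) = h 1 (Circle.exp (-t)) * circleSp n (Circle.exp (t / 2)) ∨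
      h 0 (Circle.exp t) = -(h 1 (Circle.exp (-t)) * circleSp n (Circle.exp (t / 2))) := by
    intro t
    refine Sp.eq_or_eq_neg_of_smul_eq hn fun x => ?_
    rw [← (hh 0).2 _ (hmem 0 t), mul_smul, ← circle_smul_eq_circleSp (z := Circle.exp t)
      (by rw [← Circle.exp_add, add_halves]), ← (hh 1).2 _ (hmem 1 (-t))]
    change (Φ (Tot.mk (x, sec 0 (Circle.exp t)))).2 =
      (Φ (Tot.mk (Circle.exp t • x, sec 1 (Circle.exp (-t))))).2
    rw [Tot.mk_sec_other 0 x (Circle.coe_ne_zero _), phase_circle, Circle.exp_neg, Circle.coe_inv]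
    rfl
  -- Between `t = 0` and `t = 2π` the values of `h 0` and `h 1` return while `e^{it/2}` changes
  -- sign. With one global sign this forces `h 0 1 = -h 0 1`.
  have e0 : Circle.exp (2 * Real.pi) = 1 := Circle.exp_two_pi
  have e1 : Circle.exp (-(2 * Real.pi)) = 1 := by rw [Circle.exp_neg, e0, inv_one]
  have e2 : circleSp n (Circle.exp (2 * Real.pi / 2)) = -circleSp n (Circle.exp (0 / 2)) := by
    rw [← circleSp_exp_add_pi]; congr 2; ring
  have hne := Sp.ne_neg (h 0 1)
  rcases Sp.eq_or_eq_neg_of_isPreconnected isPreconnected_univ (hc 0).continuousOn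
    hc1.continuousOn fun t _ => key t with H | H
  · have a := H 0 (mem_univ _)
    have b := H (2 * Real.pi) (mem_univ _)
    rw [e0, e1, e2, mul_neg] at b
    rw [neg_zero, Circle.exp_zero] at a
    rw [← a] at b
    exact hne b
  · have a := H 0 (mem_univ _)
    have b := H (2 * Real.pi) (mem_univ _)
    rw [e0, e1, e2, mul_neg] at b
    rw [neg_zero, Circle.exp_zero] at a
    rw [← a] at b
    exact hne b

/-! ### Classification of linear `HP^n`-bundles over `S²` -/

theorem phase_inv {z : ℂ} (hz : z ≠ 0) : phase z⁻¹ = (phase z)⁻¹ := by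
  have h1 := phase_ofReal_pos (inv_pos.2 (norm_pos_iff.2 hz))
  have h2 : z⁻¹ * (phase z : ℂ) = ((‖z‖⁻¹ : ℝ) : ℂ) := by
    rw [coe_phase hz]; push_cast; field_simp
  rw [← h2, phase_mul (inv_ne_zero hz)] at h1
  exact eq_inv_of_mul_eq_one_left h1

/-- The coordinates are reciprocal, so modulus at least `2` in chart 1 means modulus at most `1 <
r⁻¹` in chart 0. -/
theorem chartSet_cover {r : ℝ} (hr0 : 0 < r) (hr1 : r < 1) (b : S2) :
    b ∈ chartSet 0 (Metric.ball 0 r⁻¹) ∨ b ∈ chartSet 1 (Metric.ball 0 2) := by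
  have h1 : 1 < r⁻¹ := (one_lt_inv₀ hr0).2 hr1
  by_cases hb : b ∈ sphereBase 1
  · rcases lt_or_ge ‖sphereCoord 1 b‖ 2 with h | h
    · exact Or.inr ⟨hb, by simpa using h⟩
    · have h0 : sphereCoord 1 b ≠ 0 := by
        rw [← norm_pos_iff]; linarith
      have hb' : b ∈ sphereBase 0 := (mem_sphereBase_other hb).2 h0
      have hc : sphereCoord 0 b = (sphereCoord 1 b)⁻¹ := sphereCoord_other hb hb'
      refine Or.inl ⟨hb', ?_⟩
      rw [mem_preimage, mem_ball_zero_iff, hc, norm_inv]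
      exact (inv_le_one_of_one_le₀ (by linarith)).trans_lt h1
  · have hb' := (sphereBase_cover b).resolve_right hb
    have hc : sphereCoord 0 b = 0 := by
      by_contra h
      exact hb ((mem_sphereBase_other hb').2 h)
    refine Or.inl ⟨hb', ?_⟩
    rw [mem_preimage, hc]
    exact Metric.mem_ball_self (by linarith)

theorem ball_subset_reProdIm {r s : ℝ} (h : r ≤ s) :
    Metric.ball (0 : ℂ) r ⊆ Icc (-s) s ×ℂ Icc (-s) s := by
  intro z hz
  rw [mem_ball_zero_iff] at hz
  have h1 := abs_le.1 (Complex.abs_re_le_norm z)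
  have h2 := abs_le.1 (Complex.abs_im_le_norm z)
  exact ⟨⟨by linarith [h1.1], by linarith [h1.2]⟩, by linarith [h2.1], by linarith [h2.2]⟩

theorem spherePt_one_mem {z : ℂ} (h1 : 3⁻¹ < ‖z‖) (h2 : ‖z‖ < 3) :
    spherePt 1 z ∈ chartSet 0 (Icc (-3) 3 ×ℂ Icc (-3) 3) ∩
      chartSet 1 (Icc (-3) 3 ×ℂ Icc (-3) 3) := by
  have hb := spherePt_mem 1 z
  have hz : z ≠ 0 := by rw [← norm_pos_iff]; exact lt_trans (by norm_num) h1
  have hb' : spherePt 1 z ∈ sphereBase 0 :=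
    (mem_sphereBase_other hb).2 (by rwa [coord_spherePt])
  have hc : sphereCoord 0 (spherePt 1 z) = z⁻¹ := by
    have := sphereCoord_other hb hb'
    rwa [coord_spherePt] at this
  have h3 : ‖z⁻¹‖ < 3 := by
    rw [norm_inv]
    exact inv_lt_of_inv_lt₀ (by norm_num) h1
  refine ⟨⟨hb', ?_⟩, hb, ?_⟩
  · rw [mem_preimage, hc]
    exact ball_subset_reProdIm le_rfl (by simpa using h3)
  · rw [mem_preimage, coord_spherePt]
    exact ball_subset_reProdIm le_rfl (by simpa using h2)

/-- The radii are matched: discs of radius `r⁻¹` and `2` in reciprocal coordinates overlap in the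
annulus on which the extension agrees with the given lift. -/
theorem coord_mem_annulus {r : ℝ} (hr0 : 0 < r) {b : S2}
    (hb : b ∈ chartSet 0 (Metric.ball 0 r⁻¹) ∩ chartSet 1 (Metric.ball 0 2)) :
    sphereCoord 1 b ∈ annulus r := by
  obtain ⟨⟨h0, h1⟩, h2, h3⟩ := hb
  have hz : sphereCoord 1 b ≠ 0 := (mem_sphereBase_other h2).1 h0
  have hc : sphereCoord 0 b = (sphereCoord 1 b)⁻¹ := sphereCoord_other h2 h0
  rw [mem_preimage, mem_ball_zero_iff, hc, norm_inv] at h1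
  rw [mem_preimage, mem_ball_zero_iff] at h3
  exact ⟨(inv_lt_inv₀ (norm_pos_iff.2 hz) hr0).1 h1, h3⟩

/-- The bundle is trivial over large squares in both charts. The transition family over an annulus
equals a lift `h`, possibly times the inverse phase action. Extending `h` over the disc and
absorbing it into the second trivialization leaves one of two standard transition maps, which
determine the bundle. -/
theorem LinearHPBundle.isTrivial_or_isomorphic {n : ℕ} (hn : 1 ≤ n) {E : Type*}
    [NormedAddCommGroup E] [NormedSpace ℝ E] {H : Type*} [TopologicalSpace H]
    {I : ModelWithCorners ℝ E H} {M : Type*} [TopologicalSpace M] [ChartedSpace H M]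
    (B : LinearHPBundle n I M) : B.IsTrivial ∨ (totBundle n).Isomorphic B := by
  obtain ⟨T₀⟩ := B.exists_linTriv 0 (a := -3) (b := 3) (c := -3) (d := 3) (by norm_num)
    (by norm_num)
  obtain ⟨T₁⟩ := B.exists_linTriv 1 (a := -3) (b := 3) (c := -3) (d := 3) (by norm_num)
    (by norm_num)
  have hT := T₀.transition T₁
  have hF : IsLinearFamilyOn (fun z x => T₁.coord (T₀.inv (spherePt 1 z) x))
      {z | 3⁻¹ < ‖z‖ ∧ ‖z‖ < 3} :=
    ⟨hT.smooth.comp (f := fun p : ℂ × HP n => (spherePt 1 p.1, p.2))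
      (((contMDiff_spherePt 1).comp contMDiff_fst).prodMk contMDiff_snd).contMDiffOn
      fun p hp => ⟨spherePt_one_mem hp.1.1 hp.1.2, mem_univ _⟩,
    fun z hz => hT.linear _ (spherePt_one_mem hz.1 hz.2)⟩
  obtain ⟨h, hs, hh⟩ := hF.dichotomy hn
  obtain ⟨f, hf, r, hr, hr1, hfh⟩ := exists_extension (by norm_num) (by norm_num) hs
  have hr0 : 0 < r := lt_of_lt_of_le (by norm_num) hr
  have hV0 : chartSet 0 (Metric.ball 0 r⁻¹) ⊆ chartSet 0 (Icc (-3) 3 ×ℂ Icc (-3) 3) := by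
    refine chartSet_mono 0 (ball_subset_reProdIm ?_)
    rw [inv_le_comm₀ hr0 (by norm_num)]
    linarith
  have hV1 : chartSet 1 (Metric.ball 0 2) ⊆ chartSet 1 (Icc (-3) 3 ×ℂ Icc (-3) 3) :=
    chartSet_mono 1 (ball_subset_reProdIm (by norm_num))
  -- After the twist the transition map is `h⁻¹` times the old one, because the overlap of the
  -- shrunken charts lies where `f = h`.
  have htr : ∀ b ∈ chartSet 0 (Metric.ball 0 r⁻¹) ∩ chartSet 1 (Metric.ball 0 2), ∀ x,
      ((T₁.restrict hV1).twist (hf.sphereFamily Metric.isOpen_ball 1)).coord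
        ((T₀.restrict hV0).inv b x) =
      (h (sphereCoord 1 b))⁻¹ • T₁.coord (T₀.inv (spherePt 1 (sphereCoord 1 b)) x) := by
    intro b hb x
    change (f (sphereCoord 1 (B.proj (T₀.inv b x))))⁻¹ • T₁.coord (T₀.inv b x) = _
    rw [T₀.proj_inv b (hV0 hb.1), spherePt_coord 1 hb.2.1, hfh _ (coord_mem_annulus hr0 hb)]
  have hann : annulus r ⊆ annulus 2⁻¹ := annulus_mono hr
  rcases hh with hh | hh
  · refine Or.inl (LinearHPBundle.isTrivial_of_isomorphic
      (LinearHPBundle.isomorphic_of_transition_eq (T₀.restrict hV0)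
        ((T₁.restrict hV1).twist (hf.sphereFamily Metric.isOpen_ball 1))
        (prodLinTriv n _) (prodLinTriv n _) (isOpen_chartSet 0 Metric.isOpen_ball)
        (isOpen_chartSet 1 Metric.isOpen_ball) (chartSet_cover hr0 hr1) fun b hb x => ?_))
    rw [htr b hb, hh _ (hann (coord_mem_annulus hr0 hb)), inv_smul_smul]
    rfl
  · have hU0 : chartSet 0 (Metric.ball 0 r⁻¹) ⊆ sphereBase 0 := inter_subset_left
    have hU1 : chartSet 1 (Metric.ball 0 2) ⊆ sphereBase 1 := inter_subset_left
    refine Or.inr (LinearHPBundle.isomorphic_of_transition_eq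
      ((totLinTriv n 0).restrict hU0) ((totLinTriv n 1).restrict hU1)
      (T₀.restrict hV0) ((T₁.restrict hV1).twist (hf.sphereFamily Metric.isOpen_ball 1))
      (isOpen_chartSet 0 Metric.isOpen_ball)
      (isOpen_chartSet 1 Metric.isOpen_ball) (chartSet_cover hr0 hr1) fun b hb x => ?_)
    rw [htr b hb, hh _ (hann (coord_mem_annulus hr0 hb)), inv_smul_smul]
    have hz : sphereCoord 1 b ≠ 0 := (mem_sphereBase_other hb.2.1).1 hb.1.1
    have hc : sphereCoord 0 b = (sphereCoord 1 b)⁻¹ := sphereCoord_other hb.2.1 hb.1.1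
    -- The remaining `(phase z)⁻¹` in the coordinate of chart 1 is the phase of the coordinate of
    -- chart 0, as in `totBundle`.
    rw [← phase_inv hz, ← hc]
    exact totLinTriv_transition 0 hb.1.1 hb.2.1 x

/-! ### Unitary matrices as symplectic matrices -/

theorem quatMat_mul {m : ℕ} (A B : Matrix (Fin m) (Fin m) ℂ) :
    quatMat (A * B) = quatMat A * quatMat B :=
  Matrix.map_mul (f := Quaternion.ofComplex.toRingHom)

theorem quatMat_one {m : ℕ} : quatMat (1 : Matrix (Fin m) (Fin m) ℂ) = 1 :=
  Matrix.map_one _ (map_zero Quaternion.ofComplex) (map_one Quaternion.ofComplex)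

theorem coe_star_complex (c : ℂ) : ((star c : ℂ) : ℍ) = star (c : ℍ) := by
  ext <;> simp

theorem quatMat_star {m : ℕ} (A : Matrix (Fin m) (Fin m) ℂ) : quatMat (star A) = star (quatMat A) := by
  ext1 i j
  exact coe_star_complex _

/-- The inclusion `U(n+1) ⊆ Sp(n+1)`. -/
def unitarySp (n : ℕ) : Matrix.unitaryGroup (Fin (n + 1)) ℂ →* Sp n where
  toFun U := ⟨quatMat U.1, by
    rw [Unitary.mem_iff, ← quatMat_star, ← quatMat_mul, ← quatMat_mul,
      Unitary.star_mul_self_of_mem U.2, Unitary.mul_star_self_of_mem U.2, quatMat_one]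
    exact ⟨rfl, rfl⟩⟩
  map_one' := Subtype.ext quatMat_one
  map_mul' U V := Subtype.ext (quatMat_mul U.1 V.1)

/-- The inclusion `SU(m) ⊆ U(m)`. -/
def SU.toUnitary {m : ℕ} (A : SU m) : Matrix.unitaryGroup (Fin m) ℂ :=
  ⟨A.1, (Matrix.mem_specialUnitaryGroup_iff.1 A.2).1⟩

theorem SU.smul_eq_unitarySp {n : ℕ} (A : SU (n + 1)) (x : HP n) :
    A • x = unitarySp n A.toUnitary • x := by
  obtain ⟨v, hv, rfl⟩ := x.exists_ofVec
  rw [HP.SU_smul_ofVec A hv, HP.Sp_smul_ofVec _ hv]; rfl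

/-- The inclusion of the scalar matrices. -/
def circleUnitary (m : ℕ) (μ : Circle) : Matrix.unitaryGroup (Fin m) ℂ :=
  ⟨(μ : ℂ) • 1, by
    have h : (starRingEnd ℂ) μ * (μ : ℂ) = 1 := by
      rw [← Circle.coe_inv_eq_conj, ← Circle.coe_mul, inv_mul_cancel, Circle.coe_one]
    rw [Matrix.mem_unitaryGroup_iff', star_smul, star_one, smul_mul_smul_comm, one_mul,
      Complex.star_def, h, one_smul]⟩

theorem circleSp_eq_unitarySp {n : ℕ} (μ : Circle) :
    circleSp n μ = unitarySp n (circleUnitary (n + 1) μ) := by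
  refine Subtype.ext ?_
  ext1 i j
  change Matrix.diagonal (fun _ => ((μ : ℂ) : ℍ)) i j =
    (((μ : ℂ) • (1 : Matrix (Fin (n + 1)) (Fin (n + 1)) ℂ)) i j : ℂ)
  rw [Matrix.smul_apply, smul_eq_mul]
  by_cases hij : i = j
  · subst hij; simp
  · rw [Matrix.diagonal_apply_ne _ hij, Matrix.one_apply_ne hij, mul_zero]
    exact (map_zero Quaternion.ofComplex).symm

theorem circle_smul_eq_unitarySp {n : ℕ} {z μ : Circle} (h : μ * μ = z) (x : HP n) :
    z • x = unitarySp n (circleUnitary (n + 1) μ) • x := by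
  rw [circle_smul_eq_circleSp h, circleSp_eq_unitarySp]

/-- Every unitary matrix acts as an element of `SU(n+1) × S¹`. -/
theorem exists_circle_SU_smul {n : ℕ} (U : Matrix.unitaryGroup (Fin (n + 1)) ℂ) :
    ∃ (z : Circle) (A : SU (n + 1)), ∀ x : HP n, unitarySp n U • x = z • A • x := by
  have hd : ‖U.1.det‖ = 1 := CStarRing.norm_of_mem_unitary (Matrix.det_of_mem_unitary U.2)
  -- A root of `w^(n+1) = det U` makes `w⁻¹ U` special unitary. The scalar `w` acts as the circle
  -- element `w²`, since the circle acts through half angles.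
  obtain ⟨w, hw⟩ := IsAlgClosed.exists_pow_nat_eq U.1.det (Nat.succ_pos n)
  have hw1 : ‖w‖ = 1 := by
    have : ‖w‖ ^ (n + 1) = 1 := by rw [← norm_pow, hw, hd]
    exact (pow_eq_one_iff_of_nonneg (norm_nonneg w) (Nat.succ_ne_zero n)).1 this
  set μ : Circle := ⟨w, mem_sphere_zero_iff_norm.2 hw1⟩ with hμ
  set V := circleUnitary (n + 1) μ⁻¹ * U with hV
  have hVd : V.1.det = 1 := by
    change (((μ⁻¹ : Circle) : ℂ) • (1 : Matrix _ _ ℂ) * U.1).det = 1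
    rw [smul_mul_assoc, one_mul, Matrix.det_smul, Fintype.card_fin, ← hw, ← mul_pow]
    have : ((μ⁻¹ : Circle) : ℂ) * w = 1 := by
      change ((μ⁻¹ : Circle) : ℂ) * (μ : ℂ) = 1
      rw [← Circle.coe_mul, inv_mul_cancel, Circle.coe_one]
    rw [this, one_pow]
  refine ⟨μ * μ, ⟨V.1, Matrix.mem_specialUnitaryGroup_iff.2 ⟨V.2, hVd⟩⟩, fun x => ?_⟩
  rw [SU.smul_eq_unitarySp, circle_smul_eq_unitarySp rfl, ← mul_smul, ← map_mul]
  congr 2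
  refine Subtype.ext ?_
  change U.1 = ((μ : ℂ) • (1 : Matrix _ _ ℂ)) * ((((μ⁻¹ : Circle) : ℂ) • (1 : Matrix _ _ ℂ)) * U.1)
  rw [smul_mul_assoc, one_mul, smul_mul_assoc, one_mul, smul_smul, ← Circle.coe_mul,
    mul_inv_cancel, Circle.coe_one, one_smul]

/-! ### Topology of the groups and of the total space -/

instance (m : ℕ) : CompactSpace (SU m) := by
  refine isCompact_iff_compactSpace.1 ?_
  refine IsCompact.of_isClosed_subset
    (s := Set.pi univ fun _ => Set.pi univ fun _ => Metric.closedBall (0 : ℂ) 1)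
    (isCompact_univ_pi fun _ => isCompact_univ_pi fun _ => isCompact_closedBall _ _) ?_ ?_
  · have h : ((Matrix.specialUnitaryGroup (Fin m) ℂ : Set (Matrix (Fin m) (Fin m) ℂ))) =
        {A | A * star A = 1} ∩ {A | A.det = 1} := by
      ext A
      rw [SetLike.mem_coe, Matrix.mem_specialUnitaryGroup_iff, Matrix.mem_unitaryGroup_iff]; rfl
    rw [h]
    exact (isClosed_eq (by fun_prop) continuous_const).inter
      (isClosed_eq (by fun_prop) continuous_const)
  · intro A hA
    simp only [mem_univ_pi, mem_closedBall_zero_iff]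
    exact fun i j => entry_norm_bound_of_unitary (Matrix.mem_specialUnitaryGroup_iff.1 hA).1 i j

instance (n : ℕ) : CompactSpace (Tot n) :=
  Tot.isOpenQuotientMap_mk.surjective.compactSpace Tot.isOpenQuotientMap_mk.continuous

/-- Points over different base points are separated by the projection; points over the same base
point lie in a common trivialization, with values in the Hausdorff space `HP^n × ℂ`. -/
instance (n : ℕ) : T2Space (Tot n) := by
  refine ⟨fun m m' h => ?_⟩
  by_cases hp : m.proj = m'.proj
  · obtain ⟨k, hk⟩ := m.exists_mem_triv_source
    have hk' : m' ∈ (Tot.triv k).source := by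
      rw [Tot.mem_triv_source_iff] at hk ⊢; rwa [← hp]
    obtain ⟨U, V, oU, oV, hU, hV, hUV⟩ := t2_separation ((Tot.triv k).injOn.ne hk hk' h)
    exact ⟨_, _, (Tot.triv k).isOpen_inter_preimage oU, (Tot.triv k).isOpen_inter_preimage oV,
      ⟨hk, hU⟩, ⟨hk', hV⟩,
      (hUV.preimage _).mono inter_subset_right inter_subset_right⟩
  · obtain ⟨U, V, oU, oV, hU, hV, hUV⟩ := t2_separation hp
    exact ⟨_, _, oU.preimage Tot.contMDiff_proj.continuous,
      oV.preimage Tot.contMDiff_proj.continuous, hU, hV, hUV.preimage _⟩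

instance (n : ℕ) : ConnectedSpace (Tot n) := by
  have h : ∀ k, IsConnected (Tot.triv (n := n) k).source := by
    intro k
    rw [← (Tot.triv k).symm_image_target_eq_source]
    have ht : (Tot.triv (n := n) k).target = univ := rfl
    rw [ht]
    exact isConnected_univ.image _ (Tot.contMDiff_triv_symm k).continuous.continuousOn
  have hu : (Tot.triv (n := n) 0).source ∪ (Tot.triv 1).source = univ := by
    refine eq_univ_of_forall fun m => ?_
    rw [mem_union, Tot.mem_triv_source_iff, Tot.mem_triv_source_iff]
    exact sphereBase_cover _
  have := IsConnected.union (s := (Tot.triv (n := n) 0).source) (t := (Tot.triv 1).source) ?_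
    (h 0) (h 1)
  · rw [hu] at this
    exact connectedSpace_iff_univ.2 this
  · obtain ⟨x⟩ := (inferInstance : Nonempty (HP n))
    -- The first column of `sec 0 1` has no zero entry, so its class lies in both trivialization
    -- domains.
    have h0 : (sec 0 1).1 1 0 ≠ 0 := by
      have := sec_other 0 1
      rw [zero_add] at this
      rw [this]
      exact div_ne_zero one_ne_zero (by exact_mod_cast (sqrt_pos 1).ne')
    exact ⟨Tot.mk (x, sec 0 1), (Tot.mem_triv_source _ _).2 (sec_self_ne _ _),
      (Tot.mem_triv_source _ _).2 h0⟩

/-! ### Almost effectiveness -/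

theorem unitarySp_injective {n : ℕ} : Function.Injective (unitarySp n) := by
  intro U V h
  refine Subtype.ext ?_
  ext1 i j
  exact Quaternion.ofComplex.toRingHom.injective
    (congrFun (congrFun (congrArg Subtype.val h) i) j : ((U.1 i j : ℂ) : ℍ) = (V.1 i j : ℂ))

theorem Circle_eq_of_mul_self {z : Circle} (h : z * z = 1) : z = 1 ∨ z = Circle.exp Real.pi := by
  have h1 : (z : ℂ) * z = 1 := by rw [← Circle.coe_mul, h, Circle.coe_one]
  rcases mul_self_eq_one_iff.1 h1 with h2 | h2
  · exact Or.inl (Circle.ext h2)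
  · refine Or.inr (Circle.ext ?_)
    rw [h2, Circle.coe_exp, Complex.exp_pi_mul_I]

theorem exists_of_smul_mk_eq {n : ℕ} {g : G n} {x : HP n} {s : SU 2}
    (h : g • Tot.mk (x, s) = Tot.mk (x, s)) :
    ∃ z : Circle, g.1 • x = z • x ∧ g.2 * s = s * (torus z)⁻¹ := by
  obtain ⟨z, hz⟩ := Tot.mk_eq_iff.1 (show Tot.mk (g.1 • x, g.2 * s) = Tot.mk (x, s) from h)
  exact ⟨z, (congrArg Prod.fst hz).symm, (congrArg Prod.snd hz).symm⟩

theorem torus_inv_col (z : Circle) (s : SU 2) (i : Fin 2) :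
    ((torus z)⁻¹ * s).1 i 0 = (if i = 0 then ((z⁻¹ : Circle) : ℂ) else z) * s.1 i 0 := by
  rw [← map_inv]
  change (Matrix.diagonal ![((z⁻¹ : Circle) : ℂ), ((z⁻¹⁻¹ : Circle) : ℂ)] * s.1) i 0 = _
  rw [Matrix.diagonal_mul, inv_inv]
  fin_cases i <;> rfl

/-- Fixing `[x, 1]` puts `g.2` into the torus and makes `g.1` act on `x` as a circle element `z`,
determined by `g.2` and so independent of `x`. Fixing a fibre away from the poles then forces `z =
z⁻¹`. -/
theorem exists_of_forall_smul_eq {n : ℕ} {g : G n} (h : ∀ m : Tot n, g • m = m) :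
    ∃ z : Circle, (z = 1 ∨ z = Circle.exp Real.pi) ∧ (∀ x : HP n, g.1 • x = z • x) ∧
      g.2 = (torus z)⁻¹ := by
  have h1 : ∀ x : HP n, ∃ z : Circle, g.1 • x = z • x ∧ g.2 = (torus z)⁻¹ := by
    intro x
    obtain ⟨z, hz, hz'⟩ := exists_of_smul_mk_eq (h (Tot.mk (x, 1)))
    rw [mul_one, one_mul] at hz'
    exact ⟨z, hz, hz'⟩
  have hinj : ∀ z w : Circle, (torus z)⁻¹ = (torus w)⁻¹ → z = w := by
    intro z w hzw
    have := torus_inv_col z 1 0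
    rw [hzw, torus_inv_col] at this
    exact Circle.ext (by simpa using this.symm)
  obtain ⟨x₀⟩ := (inferInstance : Nonempty (HP n))
  obtain ⟨z, -, hz⟩ := h1 x₀
  -- Both entries of the first column of `sec 0 1` are nonzero, so a diagonal matrix that rescales
  -- this column has equal diagonal entries.
  obtain ⟨w, -, hw⟩ := exists_of_smul_mk_eq (h (Tot.mk (x₀, sec 0 1)))
  have hcol : ∀ i, (if i = 0 then ((z⁻¹ : Circle) : ℂ) else z) * (sec 0 1).1 i 0 =
      (sec 0 1).1 i 0 * ((w⁻¹ : Circle) : ℂ) := by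
    intro i
    rw [← torus_inv_col, ← hz, hw, torus_inv_apply]
  have h0 := hcol 0
  have h2 := hcol 1
  have hs := sec_other 0 1
  rw [zero_add] at hs
  have hr : ((Real.sqrt (1 + Complex.normSq 1) : ℝ) : ℂ) ≠ 0 := by exact_mod_cast (sqrt_pos 1).ne'
  rw [sec_self, if_pos rfl, mul_comm] at h0
  rw [hs, if_neg (by decide), mul_comm] at h2
  have h3 : ((z⁻¹ : Circle) : ℂ) = ((w⁻¹ : Circle) : ℂ) :=
    mul_left_cancel₀ (by exact_mod_cast (inv_pos.2 (sqrt_pos 1)).ne') h0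
  have h4 : (z : ℂ) = ((w⁻¹ : Circle) : ℂ) := mul_left_cancel₀ (div_ne_zero one_ne_zero hr) h2
  have h5 : z = z⁻¹ := Circle.ext (h4.trans h3.symm)
  refine ⟨z, Circle_eq_of_mul_self ?_, fun x => ?_, hz⟩
  · conv_lhs => rw [h5]
    exact inv_mul_cancel z ▸ by rw [← h5]
  · obtain ⟨z', h6, h7⟩ := h1 x
    rw [h6, hinj z' z (h7.symm.trans hz)]

/-- An ineffective element acts on `HP^n` as a circle element `z = ±1`, which leaves two choices for
`g.2` and, up to sign, two for `g.1` viewed in `Sp n`. -/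
theorem finite_ineffective_kernel {n : ℕ} (hn : 1 ≤ n) : {g : G n | ∀ m : Tot n, g • m = m}.Finite := by
  set c : Circle → Sp n := fun z => circleSp n (halfAngle z) with hc
  set S : Set (Sp n) := {c 1, -c 1, c (Circle.exp Real.pi), -c (Circle.exp Real.pi)}
  set S' : Set (SU 2) := {(torus 1)⁻¹, (torus (Circle.exp Real.pi))⁻¹}
  have hS : S.Finite := toFinite _
  have hS' : S'.Finite := toFinite _
  have hinj : Function.Injective fun g : G n => (unitarySp n g.1.toUnitary, g.2) := by
    intro g g' h
    obtain ⟨h1, h2⟩ := Prod.mk.inj h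
    have h3 : g.1.toUnitary.1 = g'.1.toUnitary.1 := by rw [unitarySp_injective h1]
    exact Prod.ext (Subtype.ext h3) h2
  refine ((hS.prod hS').preimage hinj.injOn).subset fun g hg => ?_
  obtain ⟨z, hz, hx, h2⟩ := exists_of_forall_smul_eq hg
  have h1 : unitarySp n g.1.toUnitary = c z ∨ unitarySp n g.1.toUnitary = -c z :=
    Sp.eq_or_eq_neg_of_smul_eq hn fun x => by
      rw [← SU.smul_eq_unitarySp, hx, circle_smul_eq_circleSp (halfAngle_mul_self z)]
  change unitarySp n g.1.toUnitary ∈ S ∧ g.2 ∈ S'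
  rw [h2]
  rcases hz with rfl | rfl <;> rcases h1 with h1 | h1 <;> rw [h1] <;> simp [S, S']

/-! ### Smoothness of the action -/

theorem contDiff_unitCol (k i : Fin 2) : ContDiff ℝ ∞ fun ζ => unitCol k ζ i := by
  have hn : ContDiff ℝ ∞ fun ζ : ℂ => Complex.normSq ζ := by
    simp only [Complex.normSq_apply]
    exact (Complex.reCLM.contDiff.mul Complex.reCLM.contDiff).add
      (Complex.imCLM.contDiff.mul Complex.imCLM.contDiff)
  have hs : ContDiff ℝ ∞ fun ζ : ℂ => ((Real.sqrt (1 + Complex.normSq ζ) : ℝ) : ℂ) :=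
    Complex.ofRealCLM.contDiff.comp ((contDiff_const.add hn).sqrt fun ζ => by
      have := Complex.normSq_nonneg ζ; positivity)
  have hd : ContDiff ℝ ∞ fun ζ : ℂ => ((Real.sqrt (1 + Complex.normSq ζ) : ℝ) : ℂ)⁻¹ :=
    hs.inv fun ζ => by exact_mod_cast (sqrt_pos ζ).ne'
  have hi : ContDiff ℝ ∞ fun ζ : ℂ => if i = k then 1 else ζ := by
    by_cases h : i = k
    · simp only [h, if_true]; exact contDiff_const
    · simp only [h, if_false]; exact contDiff_id
  simp only [unitCol, div_eq_mul_inv]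
  exact hi.mul hd

theorem contDiffAt_div_norm {z : ℂ} (hz : z ≠ 0) : ContDiffAt ℝ ∞ (fun w : ℂ => w / (‖w‖ : ℂ)) z := by
  have hn : ContDiffAt ℝ ∞ (fun w : ℂ => (‖w‖ : ℂ)) z :=
    Complex.ofRealCLM.contDiff.contDiffAt.comp z (contDiffAt_id.norm ℝ hz)
  have hi : ContDiffAt ℝ ∞ (fun w : ℂ => (‖w‖ : ℂ)⁻¹) z := hn.inv (by simpa using hz)
  simpa only [div_eq_mul_inv, id] using contDiffAt_id.mul hi

theorem continuous_toMatPair {n : ℕ} : Continuous (G.toMatPair (n := n)) := by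
  have h : ∀ m (i j : Fin m), Continuous fun A : SU m => A.1 i j := fun m i j =>
    continuous_subtype_val.matrix_elem i j
  exact (continuous_pi fun i => continuous_pi fun j => (h _ i j).comp continuous_fst).prodMk
    (continuous_pi fun i => continuous_pi fun j => (h _ i j).comp continuous_snd)

theorem rot_ne_zero_vec {n : ℕ} {z : ℂ} {v : Fin (n + 1) → ℍ} (hz : z ≠ 0) (hv : v ≠ 0) :
    (fun i => rot (z / ‖z‖) (v i)) ≠ 0 := by
  rw [← coe_phase hz]
  exact (NZ.rot (phase z) ⟨v, hv⟩).2

section smooth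

variable {E : Type*} [NormedAddCommGroup E] [NormedSpace ℝ E] {H : Type*} [TopologicalSpace H]
  {I : ModelWithCorners ℝ E H} {X : Type*} [TopologicalSpace X] [ChartedSpace H X] {n : ℕ}

theorem contMDiffAt_matMul_sec {P : X → MatPair n} {ζ : X → ℂ} {p : X}
    (hP : ContMDiffAt I 𝓘(ℝ, MatPair n) ∞ P p) (hζ : ContMDiffAt I 𝓘(ℝ, ℂ) ∞ ζ p)
    (k i : Fin 2) :
    ContMDiffAt I 𝓘(ℝ, ℂ) ∞ (fun q => ∑ j, (P q).2 i j * (sec k (ζ q)).1 j 0) p := by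
  have h1 : ContDiff ℝ ∞ fun q : MatPair n × ℂ => ∑ j, q.1.2 i j * unitCol k q.2 j :=
    ContDiff.sum fun j _ => ContDiff.mul (by fun_prop) ((contDiff_unitCol k j).comp contDiff_snd)
  simp only [sec_apply]
  exact (h1.contMDiff.contMDiffAt).comp p (hP.prodMk_space hζ)

theorem contMDiffAt_matMul_vec {P : X → MatPair n} {v : X → Fin (n + 1) → ℍ} {p : X}
    (hP : ContMDiffAt I 𝓘(ℝ, MatPair n) ∞ P p)
    (hv : ContMDiffAt I 𝓘(ℝ, Fin (n + 1) → ℍ) ∞ v p) :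
    ContMDiffAt I 𝓘(ℝ, Fin (n + 1) → ℍ) ∞
      (fun q i => ∑ j, (((P q).1 i j : ℂ) : ℍ) * v q j) p := by
  refine contMDiffAt_pi_space.2 fun i => ?_
  have h1 : ContDiff ℝ ∞ fun q : MatPair n × (Fin (n + 1) → ℍ) =>
      ∑ j, ((q.1.1 i j : ℂ) : ℍ) * q.2 j := by
    refine ContDiff.sum fun j _ => ContDiff.mul ?_ (by fun_prop)
    have h2 : ContDiff ℝ ∞ fun q : MatPair n × (Fin (n + 1) → ℍ) => q.1.1 i j := by fun_prop
    exact contDiff_coeComplex.comp h2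
  have h3 := (h1.contMDiff.contMDiffAt (x := (P p, v p))).comp p (hP.prodMk_space hv)
  exact h3

theorem contMDiffAt_triv_symm_ofVec {w : X → Fin 2 → ℂ} {u : X → Fin (n + 1) → ℍ} {p : X}
    (hw : ∀ i, ContMDiffAt I 𝓘(ℝ, ℂ) ∞ (fun q => w q i) p)
    (hu : ContMDiffAt I 𝓘(ℝ, Fin (n + 1) → ℍ) ∞ u p) (k : Fin 2) (hw0 : w p k ≠ 0)
    (hu0 : u p ≠ 0) :
    ContMDiffAt I (modelTot n) ∞ (fun q => (Tot.triv k).symm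
      (HP.ofVec fun i => rot (w q k / ‖w q k‖) (u q i), w q (k + 1) / w q k)) p := by
  have h1 : ContMDiffAt I 𝓘(ℝ, ℂ) ∞ (fun q => w q k / (‖w q k‖ : ℂ)) p :=
    (contDiffAt_div_norm hw0).contMDiffAt.comp p (hw k)
  have h2 : ContMDiffAt I 𝓘(ℝ, Fin (n + 1) → ℍ) ∞
      (fun q i => rot (w q k / ‖w q k‖) (u q i)) p :=
    contMDiffAt_pi_space.2 fun i => (contDiff_rot.contMDiff.contMDiffAt).comp p
      (h1.prodMk_space (contMDiffAt_pi_space.1 hu i))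
  have h3 : ContDiffAt ℝ ∞ (fun q : ℂ × ℂ => q.1 / q.2) (w p (k + 1), w p k) := by
    simp only [div_eq_mul_inv]
    exact contDiffAt_fst.mul (contDiffAt_snd.inv hw0)
  exact (Tot.contMDiff_triv_symm k).contMDiffAt.comp p
    (((contMDiffAt_ofVec (rot_ne_zero_vec hw0 hu0)).comp p h2).prodMk
      (h3.contMDiffAt.comp p ((hw (k + 1)).prodMk_space (hw k))))

end smooth

/-- In trivializations `k` around `m` and `k'` around `g • m` the action is given by a formula in
the matrix entries: multiply homogeneous coordinates by `A` and the section's column by `t`, then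
renormalize. It makes sense for matrices near the group, which gives the required local extension.
-/
theorem smoothOnG_Tot {n : ℕ} :
    SmoothOnG (modelTot n) (modelTot n) (fun (g : G n) (m : Tot n) => g • m) := by
  intro g m
  obtain ⟨k, hk⟩ := m.exists_mem_triv_source
  obtain ⟨r, hr, hr0, hre⟩ := (Tot.triv k m).1.exists_smooth_vec
  obtain ⟨k', hk'⟩ := SU2.exists_ne (g.2 * sec k (Tot.triv k m).2)
  have htriv : ContMDiffAt (𝓘(ℝ, MatPair n).prod (modelTot n)) (modelTot n) ∞
      (fun p : MatPair n × Tot n => Tot.triv k p.2) (g.toMatPair, m) :=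
    ContMDiffAt.comp (f := fun p : MatPair n × Tot n => p.2) (g.toMatPair, m)
      ((Tot.contMDiffOn_triv k).contMDiffAt ((Tot.triv k).open_source.mem_nhds hk)) contMDiffAt_snd
  have hζ : ContMDiffAt (𝓘(ℝ, MatPair n).prod (modelTot n)) 𝓘(ℝ, ℂ) ∞
      (fun p : MatPair n × Tot n => (Tot.triv k p.2).2) (g.toMatPair, m) :=
    contMDiff_snd.contMDiffAt.comp (g.toMatPair, m) htriv
  have hx : ContMDiffAt (𝓘(ℝ, MatPair n).prod (modelTot n)) (modelHP n) ∞
      (fun p : MatPair n × Tot n => (Tot.triv k p.2).1) (g.toMatPair, m) :=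
    contMDiff_fst.contMDiffAt.comp (g.toMatPair, m) htriv
  have hrx : ContMDiffAt (𝓘(ℝ, MatPair n).prod (modelTot n)) 𝓘(ℝ, Fin (n + 1) → ℍ) ∞
      (fun p : MatPair n × Tot n => r (Tot.triv k p.2).1) (g.toMatPair, m) :=
    ContMDiffAt.comp (f := fun p : MatPair n × Tot n => (Tot.triv k p.2).1) (g.toMatPair, m) hr hx
  have hw := contMDiffAt_matMul_sec (P := fun p : MatPair n × Tot n => p.1) contMDiffAt_fst hζ k
  have hu := contMDiffAt_matMul_vec (P := fun p : MatPair n × Tot n => p.1) contMDiffAt_fst hrx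
  have hu0 : (quatMat g.1.1 *ᵥ r (Tot.triv k m).1) ≠ 0 := SU.mulVec_ne_zero g.1 (hr0 _)
  set w : MatPair n × Tot n → Fin 2 → ℂ :=
    fun p i => ∑ j, p.1.2 i j * (sec k (Tot.triv k p.2).2).1 j 0 with hwd
  set u : MatPair n × Tot n → Fin (n + 1) → ℍ :=
    fun p i => ∑ j, ((p.1.1 i j : ℂ) : ℍ) * r (Tot.triv k p.2).1 j with hud
  have hw0 : w (g.toMatPair, m) k' ≠ 0 := hk'
  refine ⟨fun p => (Tot.triv k').symm (HP.ofVec fun i => rot (w p k' / ‖w p k'‖) (u p i),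
    w p (k' + 1) / w p k'), contMDiffAt_triv_symm_ofVec hw hu k' hw0 hu0, ?_⟩
  · have hc : Continuous fun p : G n × Tot n => (p.1.toMatPair, p.2) :=
      (continuous_toMatPair.comp continuous_fst).prodMk continuous_snd
    have e1 : ∀ᶠ p : G n × Tot n in 𝓝 (g, m), p.2 ∈ (Tot.triv k).source :=
      continuousAt_snd.eventually ((Tot.triv k).open_source.mem_nhds hk)
    have e2 : ∀ᶠ p : G n × Tot n in 𝓝 (g, m),
        HP.ofVec (r (Tot.triv k p.2).1) = (Tot.triv k p.2).1 := by
      have h1 : ContinuousAt (fun m => (Tot.triv k m).1) m :=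
        continuousAt_fst.comp ((Tot.triv k).continuousAt hk)
      exact (ContinuousAt.comp (f := Prod.snd) (x := (g, m)) h1 continuousAt_snd).eventually hre
    have e3 : ∀ᶠ p : G n × Tot n in 𝓝 (g, m), w (p.1.toMatPair, p.2) k' ≠ 0 :=
      (ContinuousAt.comp (f := fun p : G n × Tot n => (p.1.toMatPair, p.2)) (x := (g, m))
        (hw k').continuousAt hc.continuousAt).eventually (isOpen_ne.mem_nhds hw0)
    filter_upwards [e1, e2, e3] with p h1 h2 h3
    have h4 : p.2 = Tot.mk ((Tot.triv k p.2).1, sec k (Tot.triv k p.2).2) :=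
      ((Tot.triv k).left_inv h1).symm
    have h5 : p.1 • p.2 = Tot.mk (p.1.1 • (Tot.triv k p.2).1, p.1.2 * sec k (Tot.triv k p.2).2) := by
      conv_lhs => rw [h4]
      rfl
    rw [h5, ← mk_sec_trivCoord k' _ h3]
    have h6 : phase (w (p.1.toMatPair, p.2) k') • p.1.1 • (Tot.triv k p.2).1 =
        HP.ofVec fun i => rot (w (p.1.toMatPair, p.2) k' / ‖w (p.1.toMatPair, p.2) k'‖)
          (u (p.1.toMatPair, p.2) i) := by
      rw [← h2, HP.SU_smul_ofVec _ (hr0 _), HP.circle_smul_ofVec _ (SU.mulVec_ne_zero _ (hr0 _)),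
        coe_phase h3]
      rfl
    rw [Tot.triv_symm_apply, ← h6]
    rfl

/-! ### The norm of the moment map -/

/-- The moment map `v* i v` of the action of unit complex scalars. -/
def moment {n : ℕ} (v : Fin (n + 1) → ℍ) : ℍ := ∑ k, star (v k) * ((Complex.I : ℂ) : ℍ) * v k

/-- Changing the representative conjugates the moment map up to scale, so its norm scales by `|q|²`,
exactly as `vecNormSq` does; the quotient is a function on `HP n`. -/
theorem moment_mul {n : ℕ} (v : Fin (n + 1) → ℍ) (q : ℍ) :
    moment (fun i => v i * q) = star q * moment v * q := by
  simp only [moment, Finset.mul_sum, Finset.sum_mul, star_mul, mul_assoc]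

/-- Complex matrices commute with the scalar `i`, so `U* i U = i`. -/
theorem moment_unitary {n : ℕ} (U : Matrix.unitaryGroup (Fin (n + 1)) ℂ) (v : Fin (n + 1) → ℍ) :
    moment (quatMat U.1 *ᵥ v) = moment v := by
  set J : Matrix (Fin (n + 1)) (Fin (n + 1)) ℍ :=
    quatMat (Matrix.diagonal fun _ => Complex.I) with hJ
  have hm : ∀ w : Fin (n + 1) → ℍ, moment w = star w ⬝ᵥ (J *ᵥ w) := by
    intro w
    have hJd : J = Matrix.diagonal fun _ => ((Complex.I : ℂ) : ℍ) := by
      exact Matrix.diagonal_map (f := fun c : ℂ => (c : ℍ)) (map_zero Quaternion.ofComplex)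
    simp only [moment, dotProduct, hJd, Matrix.mulVec_diagonal, Pi.star_apply, mul_assoc]
  have hc : star (quatMat U.1) * J * quatMat U.1 = J := by
    have h1 : (Matrix.diagonal fun _ => Complex.I : Matrix (Fin (n + 1)) (Fin (n + 1)) ℂ) =
        Complex.I • 1 := by rw [Matrix.smul_one_eq_diagonal]
    rw [← quatMat_star, hJ, ← quatMat_mul, ← quatMat_mul, h1, mul_smul_comm, smul_mul_assoc,
      mul_one, Unitary.star_mul_self_of_mem U.2]
  rw [hm, hm, Matrix.star_mulVec, Matrix.mulVec_mulVec, Matrix.dotProduct_mulVec,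
    Matrix.vecMul_vecMul, ← Matrix.dotProduct_mulVec, ← Matrix.star_eq_conjTranspose, ← mul_assoc,
    hc]

/-- The norm of the moment map at a unit representative. -/
def HP.momentNorm {n : ℕ} (x : HP n) : ℝ := ‖moment x.rep.1‖ / vecNormSq x.rep.1

theorem HP.momentNorm_ofVec {n : ℕ} {v : Fin (n + 1) → ℍ} (hv : v ≠ 0) :
    (HP.ofVec v).momentNorm = ‖moment v‖ / vecNormSq v := by
  rw [HP.ofVec_of_ne hv]
  obtain ⟨q, hq, h⟩ := HP.mk_eq_iff.1 (HP.mk_rep (HP.mk ⟨v, hv⟩))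
  have h' : (HP.mk ⟨v, hv⟩).rep.1 = fun i => v i * q := funext h
  have hq' : ‖q‖ * ‖q‖ ≠ 0 := mul_ne_zero (norm_ne_zero_iff.2 hq) (norm_ne_zero_iff.2 hq)
  rw [HP.momentNorm, h', moment_mul, vecNormSq_mul, norm_mul, norm_mul, norm_star,
    Quaternion.normSq_eq_norm_mul_self, mul_comm ‖q‖, mul_assoc, mul_div_mul_right _ _ hq']

theorem HP.continuous_momentNorm {n : ℕ} : Continuous (HP.momentNorm (n := n)) := by
  rw [HP.isOpenQuotientMap_mk.isQuotientMap.continuous_iff]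
  have h : HP.momentNorm ∘ HP.mk = fun v : NZ n => ‖moment v.1‖ / vecNormSq v.1 := by
    funext v
    change (HP.mk v).momentNorm = _
    rw [← HP.ofVec_coe, HP.momentNorm_ofVec v.2]
  rw [h]
  have hm : Continuous fun v : Fin (n + 1) → ℍ => moment v := by
    unfold moment; fun_prop
  exact (hm.comp continuous_subtype_val).norm.div
    (contDiff_vecNormSq.continuous.comp continuous_subtype_val) fun v => (vecNormSq_pos v.2).ne'

theorem HP.momentNorm_unitary_smul {n : ℕ} (U : Matrix.unitaryGroup (Fin (n + 1)) ℂ) (x : HP n) :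
    (unitarySp n U • x).momentNorm = x.momentNorm := by
  obtain ⟨v, hv, rfl⟩ := x.exists_ofVec
  rw [HP.Sp_smul_ofVec _ hv, HP.momentNorm_ofVec (Sp.mulVec_ne_zero _ hv), HP.momentNorm_ofVec hv,
    Sp.vecNormSq_mulVec]
  exact congrArg (‖·‖ / _) (moment_unitary U v)

/-! ### Normal forms -/

/-- The vector `c e₀ + s e₁ j`. -/
def pairVec (n : ℕ) (c s : ℝ) : Fin (n + 1) → ℍ :=
  Pi.single 0 (quatMk c 0 0 0) + Pi.single 1 (quatMk 0 0 s 0)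

theorem fin_one_ne_zero {n : ℕ} (hn : 1 ≤ n) : (1 : Fin (n + 1)) ≠ 0 := by
  rw [Ne, Fin.one_eq_zero_iff]; omega

theorem pairVec_zero {n : ℕ} (hn : 1 ≤ n) (c s : ℝ) : pairVec n c s 0 = quatMk c 0 0 0 := by
  simp [pairVec, Pi.single_eq_of_ne (fin_one_ne_zero hn).symm]

theorem pairVec_one {n : ℕ} (hn : 1 ≤ n) (c s : ℝ) : pairVec n c s 1 = quatMk 0 0 s 0 := by
  simp [pairVec, Pi.single_eq_of_ne (fin_one_ne_zero hn)]

theorem pairVec_of_ne {n : ℕ} (c s : ℝ) {i : Fin (n + 1)} (h0 : i ≠ 0) (h1 : i ≠ 1) :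
    pairVec n c s i = 0 := by
  simp [pairVec, Pi.single_eq_of_ne h0, Pi.single_eq_of_ne h1]

theorem sum_pairVec {n : ℕ} (hn : 1 ≤ n) {N : Type*} [AddCommMonoid N] {f : Fin (n + 1) → N}
    (hf : ∀ i, i ≠ 0 → i ≠ 1 → f i = 0) : ∑ i, f i = f 0 + f 1 :=
  Finset.sum_eq_add 0 1 (fin_one_ne_zero hn).symm (fun i _ h => hf i h.1 h.2)
    (fun h => absurd (Finset.mem_univ _) h) fun h => absurd (Finset.mem_univ _) h

theorem vecNormSq_pairVec {n : ℕ} (hn : 1 ≤ n) (c s : ℝ) :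
    vecNormSq (pairVec n c s) = c ^ 2 + s ^ 2 := by
  rw [vecNormSq, sum_pairVec hn fun i h0 h1 => by rw [pairVec_of_ne c s h0 h1, map_zero],
    pairVec_zero hn, pairVec_one hn, Quaternion.normSq_def', Quaternion.normSq_def']
  simp

theorem pairVec_ne_zero {n : ℕ} (hn : 1 ≤ n) {c s : ℝ} (h : c ^ 2 + s ^ 2 ≠ 0) :
    pairVec n c s ≠ 0 := by
  intro h0
  rw [← vecNormSq_pairVec hn, h0] at h
  simp [vecNormSq] at h

theorem moment_pairVec {n : ℕ} (hn : 1 ≤ n) (c s : ℝ) :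
    moment (pairVec n c s) = quatMk 0 (c ^ 2 - s ^ 2) 0 0 := by
  rw [moment, sum_pairVec hn fun i h0 h1 => by rw [pairVec_of_ne c s h0 h1, mul_zero],
    pairVec_zero hn, pairVec_one hn]
  ext <;> simp
  ring

theorem quatMat_mulVec_pairVec {n : ℕ} (A : Matrix (Fin (n + 1)) (Fin (n + 1)) ℂ) (c s : ℝ)
    (i : Fin (n + 1)) : (quatMat A *ᵥ pairVec n c s) i =
      quatMk (c * (A i 0).re) (c * (A i 0).im) (s * (A i 1).re) (s * (A i 1).im) := by
  rw [pairVec, Matrix.mulVec_add, Pi.add_apply, Matrix.mulVec_single, Matrix.mulVec_single]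
  simp only [Pi.smul_apply, Matrix.col_apply, Matrix.map_apply, MulOpposite.smul_eq_mul_unop,
    MulOpposite.unop_op]
  ext <;> simp <;> ring

/-- The vector `a` such that `v = a + b j`. -/
def fstPart {n : ℕ} (v : Fin (n + 1) → ℍ) : EuclideanSpace ℂ (Fin (n + 1)) :=
  WithLp.toLp 2 fun i => ⟨(v i).re, (v i).imI⟩

/-- The vector `b` such that `v = a + b j`. -/
def sndPart {n : ℕ} (v : Fin (n + 1) → ℍ) : EuclideanSpace ℂ (Fin (n + 1)) :=
  WithLp.toLp 2 fun i => ⟨(v i).imJ, (v i).imK⟩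

/-- Since `jα = ᾱj`, one has `(a + bj)(α + xj) = (αa - xb) + (xa + ᾱb)j` for real `x`. -/
theorem fstPart_mul {n : ℕ} (v : Fin (n + 1) → ℍ) (α : ℂ) (x : ℝ) :
    fstPart (fun i => v i * quatMk α.re α.im x 0) = α • fstPart v - (x : ℂ) • sndPart v := by
  ext i
  refine Complex.ext ?_ ?_ <;> simp [fstPart, sndPart] <;> ring

theorem sndPart_mul {n : ℕ} (v : Fin (n + 1) → ℍ) (α : ℂ) (x : ℝ) :
    sndPart (fun i => v i * quatMk α.re α.im x 0) =
      (x : ℂ) • fstPart v + (starRingEnd ℂ) α • sndPart v := by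
  ext i
  refine Complex.ext ?_ ?_ <;> simp [fstPart, sndPart] <;> ring

/-- For `q = w̄ + j`, orthogonality of the two parts of `vq` is the quadratic equation `⟨a,b⟩ w² +
(⟨a,a⟩ - ⟨b,b⟩) w - ⟨b,a⟩ = 0`, which is solvable over `ℂ` if `⟨a,b⟩ ≠ 0`; otherwise `q = 1` will
do. -/
theorem exists_inner_parts_eq_zero {n : ℕ} (v : Fin (n + 1) → ℍ) : ∃ q : ℍ, q ≠ 0 ∧
    inner ℂ (fstPart fun i => v i * q) (sndPart fun i => v i * q) = 0 := by
  by_cases h : inner ℂ (fstPart v) (sndPart v) = 0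
  · refine ⟨1, one_ne_zero, ?_⟩
    simpa only [mul_one] using h
  · obtain ⟨s, hs⟩ := IsAlgClosed.exists_pow_nat_eq (discrim (inner ℂ (fstPart v) (sndPart v))
      (inner ℂ (fstPart v) (fstPart v) - inner ℂ (sndPart v) (sndPart v))
      (-inner ℂ (sndPart v) (fstPart v))) (two_pos)
    obtain ⟨w, hw⟩ := exists_quadratic_eq_zero h ⟨s, by rw [← hs, sq]⟩
    refine ⟨quatMk ((starRingEnd ℂ) w).re ((starRingEnd ℂ) w).im 1 0, fun h0 => ?_, ?_⟩
    · have := congrArg (fun q : ℍ => q.imJ) h0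
      simp at this
    · rw [fstPart_mul, sndPart_mul]
      simp only [inner_sub_left, inner_add_right, inner_smul_left, inner_smul_right,
        Complex.conj_conj, Complex.ofReal_one, one_mul, map_one]
      linear_combination hw

/-- Right multiplication by `j` replaces `(a, b)` by `(-b, a)`, so the larger part can be put first
without losing orthogonality. -/
theorem exists_orthogonal_parts {n : ℕ} {v : Fin (n + 1) → ℍ} (hv : v ≠ 0) :
    ∃ w : Fin (n + 1) → ℍ, w ≠ 0 ∧ HP.ofVec w = HP.ofVec v ∧
      inner ℂ (fstPart w) (sndPart w) = 0 ∧ ‖sndPart w‖ ≤ ‖fstPart w‖ := by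
  have hm : ∀ {v : Fin (n + 1) → ℍ} {q : ℍ}, v ≠ 0 → q ≠ 0 → (fun i => v i * q) ≠ 0 := by
    intro v q hv hq h
    obtain ⟨i, hi⟩ := Function.ne_iff.1 hv
    exact mul_ne_zero hi hq (congrFun h i)
  obtain ⟨q, hq, h⟩ := exists_inner_parts_eq_zero v
  have hw := hm hv hq
  have he : HP.ofVec (fun i => v i * q) = HP.ofVec v :=
    (HP.ofVec_eq_iff hw hv).2 ⟨q, hq, fun i => rfl⟩
  rcases le_total ‖sndPart fun i => v i * q‖ ‖fstPart fun i => v i * q‖ with hle | hle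
  · exact ⟨_, hw, he, h, hle⟩
  · have hj : quatMk (0 : ℂ).re (0 : ℂ).im 1 0 ≠ 0 := fun h0 => by
      have := congrArg (fun q : ℍ => q.imJ) h0
      simp at this
    refine ⟨_, hm hw hj, ((HP.ofVec_eq_iff (hm hw hj) hw).2 ⟨_, hj, fun i => rfl⟩).trans he, ?_, ?_⟩
    · rw [fstPart_mul (fun i => v i * q), sndPart_mul (fun i => v i * q), zero_smul, map_zero,
        zero_smul, zero_sub, add_zero, Complex.ofReal_one, one_smul, one_smul, inner_neg_left,
        inner_eq_zero_symm.1 h, neg_zero]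
    · rw [fstPart_mul (fun i => v i * q), sndPart_mul (fun i => v i * q), zero_smul, map_zero,
        zero_smul, zero_sub, add_zero, Complex.ofReal_one, one_smul, one_smul, norm_neg]
      exact hle

theorem exists_unitary_cols {n : ℕ} (hn : 1 ≤ n) {a b : EuclideanSpace ℂ (Fin (n + 1))}
    (h : inner ℂ a b = 0) : ∃ U : Matrix.unitaryGroup (Fin (n + 1)) ℂ,
      (∀ i, a i = ‖a‖ * U.1 i 0) ∧ ∀ i, b i = ‖b‖ * U.1 i 1 := by
  set u : Fin (n + 1) → EuclideanSpace ℂ (Fin (n + 1)) :=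
    fun i => if i = 0 then (‖a‖⁻¹ : ℂ) • a else (‖b‖⁻¹ : ℂ) • b with hu
  have hu0 : u 0 = (‖a‖⁻¹ : ℂ) • a := if_pos rfl
  have hu1 : u 1 = (‖b‖⁻¹ : ℂ) • b := if_neg (fin_one_ne_zero hn)
  -- Either vector may be zero and is then left out of the orthonormal family; its column is
  -- arbitrary, being multiplied by norm `0`.
  set S : Set (Fin (n + 1)) := {i | (i = 0 ∨ i = 1) ∧ u i ≠ 0} with hS
  have hunit : ∀ c : EuclideanSpace ℂ (Fin (n + 1)), (‖c‖⁻¹ : ℂ) • c ≠ 0 →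
      ‖(‖c‖⁻¹ : ℂ) • c‖ = 1 := by
    intro c hc
    have h0 : ‖c‖ ≠ 0 := fun h0 => hc (by rw [h0]; simp)
    rw [norm_smul, norm_inv, Complex.norm_real, norm_norm, inv_mul_cancel₀ h0]
  have h01 : inner ℂ (u 0) (u 1) = 0 := by
    rw [hu0, hu1, inner_smul_left, inner_smul_right, h, mul_zero, mul_zero]
  have hon : Orthonormal ℂ (S.domRestrict u) := by
    constructor
    · rintro ⟨i, rfl | rfl, hi⟩
      · change ‖u 0‖ = 1; rw [hu0] at hi ⊢; exact hunit a hi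
      · change ‖u 1‖ = 1; rw [hu1] at hi ⊢; exact hunit b hi
    · rintro ⟨i, rfl | rfl, hi⟩ ⟨j, rfl | rfl, hj⟩ hij
      · exact absurd rfl hij
      · exact h01
      · exact inner_eq_zero_symm.1 h01
      · exact absurd rfl hij
  obtain ⟨B, hB⟩ := hon.exists_orthonormalBasis_extension_of_card_eq (by simp)
  have hcol : ∀ (j : Fin (n + 1)) (c : EuclideanSpace ℂ (Fin (n + 1))), (j = 0 ∨ j = 1) →
      u j = (‖c‖⁻¹ : ℂ) • c → ∀ i, c i = ‖c‖ * B j i := by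
    intro j c hj hc i
    by_cases h0 : c = 0
    · simp [h0]
    · have hn0 : (‖c‖ : ℂ) ≠ 0 := by exact_mod_cast norm_ne_zero_iff.2 h0
      rw [hB j ⟨hj, by rw [hc]; exact smul_ne_zero (inv_ne_zero hn0) h0⟩, hc, PiLp.smul_apply,
        smul_eq_mul, mul_inv_cancel_left₀ hn0]
  refine ⟨⟨Matrix.of fun i j => B j i, ?_⟩, hcol 0 a (Or.inl rfl) hu0, hcol 1 b (Or.inr rfl) hu1⟩
  rw [Matrix.mem_unitaryGroup_iff']
  ext1 i j
  have hij := orthonormal_iff_ite.1 B.orthonormal i j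
  rw [Matrix.one_apply, ← hij, PiLp.inner_apply, Matrix.mul_apply]
  refine Finset.sum_congr rfl fun k _ => ?_
  rw [Matrix.star_apply]
  simp [mul_comm]

/-- A representative `a + bj` with `a ⊥ b` equals `U(‖a‖ e₀ + ‖b‖ e₁ j)`, where the first two
columns of the unitary `U` point along `a` and `b`. A real rescaling then gives `c² + s² = 1`. -/
theorem exists_normal_form {n : ℕ} (hn : 1 ≤ n) (x : HP n) :
    ∃ (U : Matrix.unitaryGroup (Fin (n + 1)) ℂ) (c s : ℝ), 0 ≤ s ∧ s ≤ c ∧ c ^ 2 + s ^ 2 = 1 ∧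
      x = unitarySp n U • HP.ofVec (pairVec n c s) := by
  obtain ⟨v, hv, rfl⟩ := x.exists_ofVec
  obtain ⟨w, hw, he, h0, hle⟩ := exists_orthogonal_parts hv
  obtain ⟨U, hU0, hU1⟩ := exists_unitary_cols hn h0
  set a := ‖fstPart w‖
  set b := ‖sndPart w‖
  have hwU : w = quatMat U.1 *ᵥ pairVec n a b := by
    funext i
    rw [quatMat_mulVec_pairVec]
    have h1 := hU0 i
    have h2 := hU1 i
    have r1 := congrArg Complex.re h1
    have r2 := congrArg Complex.im h1
    have r3 := congrArg Complex.re h2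
    have r4 := congrArg Complex.im h2
    simp only [Complex.re_ofReal_mul, Complex.im_ofReal_mul] at r1 r2 r3 r4
    ext
    exacts [r1, r2, r3, r4]
  have hp : pairVec n a b ≠ 0 := by
    intro h; rw [hwU, h, Matrix.mulVec_zero] at hw; exact hw rfl
  have hr : 0 < a ^ 2 + b ^ 2 := by
    rw [← vecNormSq_pairVec hn]; exact vecNormSq_pos hp
  set r := Real.sqrt (a ^ 2 + b ^ 2) with hrd
  have hr0 : 0 < r := Real.sqrt_pos.2 hr
  have hr2 : r ^ 2 = a ^ 2 + b ^ 2 := Real.sq_sqrt hr.le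
  have h1 : (a / r) ^ 2 + (b / r) ^ 2 = 1 := by
    rw [div_pow, div_pow, ← add_div, hr2, div_self hr.ne']
  refine ⟨U, a / r, b / r, div_nonneg (norm_nonneg _) hr0.le,
    div_le_div_of_nonneg_right hle hr0.le, h1, ?_⟩
  have hp' : pairVec n (a / r) (b / r) ≠ 0 := pairVec_ne_zero hn (by rw [h1]; exact one_ne_zero)
  have h2 : HP.ofVec (pairVec n a b) = HP.ofVec (pairVec n (a / r) (b / r)) := by
    refine (HP.ofVec_eq_iff hp hp').2 ⟨(r : ℍ), fun h => hr0.ne' (Quaternion.coe_injective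
      (h.trans Quaternion.coe_zero.symm)), fun i => ?_⟩
    rw [Quaternion.mul_coe_eq_smul]
    by_cases hi0 : i = 0
    · subst hi0
      rw [pairVec_zero hn, pairVec_zero hn]
      ext <;> simp; field_simp
    · by_cases hi1 : i = 1
      · subst hi1
        rw [pairVec_one hn, pairVec_one hn]
        ext <;> simp; field_simp
      · rw [pairVec_of_ne _ _ hi0 hi1, pairVec_of_ne _ _ hi0 hi1, smul_zero]
  rw [← h2, HP.Sp_smul_ofVec _ hp, ← he]
  exact congrArg HP.ofVec hwU

/-! ### The orbit space -/

theorem sec_zero_zero : sec 0 0 = 1 := by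
  refine SU2.ext_col fun i => ?_
  rw [sec_apply, unitCol]
  fin_cases i <;> simp

theorem Tot.contMDiff_mk_one {n : ℕ} :
    ContMDiff (modelHP n) (modelTot n) ∞ fun x : HP n => Tot.mk (x, (1 : SU 2)) := by
  have h : (fun x : HP n => Tot.mk (x, (1 : SU 2))) = fun x => (Tot.triv 0).symm (x, (0 : ℂ)) := by
    funext x
    rw [Tot.triv_symm_apply, sec_zero_zero]
  rw [h]
  exact (Tot.contMDiff_triv_symm 0).comp (contMDiff_id.prodMk contMDiff_const)

theorem HP.momentNorm_SU_smul {n : ℕ} (A : SU (n + 1)) (x : HP n) :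
    (A • x).momentNorm = x.momentNorm := by
  rw [SU.smul_eq_unitarySp, HP.momentNorm_unitary_smul]

theorem HP.momentNorm_circle_smul {n : ℕ} (z : Circle) (x : HP n) :
    (z • x).momentNorm = x.momentNorm := by
  rw [circle_smul_eq_unitarySp (halfAngle_mul_self z), HP.momentNorm_unitary_smul]

/-- The invariant function on `HP^n ×_{S¹} SU(2)` induced by the norm of the moment map. -/
def Tot.momentNorm {n : ℕ} (m : Tot n) : ℝ := m.rep.1.momentNorm

theorem Tot.momentNorm_mk {n : ℕ} (p : HP n × SU 2) : (Tot.mk p).momentNorm = p.1.momentNorm := by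
  obtain ⟨z, hz⟩ := Tot.mk_eq_iff.1 (Tot.mk_rep (Tot.mk p))
  rw [Tot.momentNorm, ← hz]
  exact HP.momentNorm_circle_smul z p.1

theorem Tot.continuous_momentNorm {n : ℕ} : Continuous (Tot.momentNorm (n := n)) := by
  rw [Tot.isOpenQuotientMap_mk.isQuotientMap.continuous_iff]
  exact (HP.continuous_momentNorm.comp continuous_fst).congr fun p => (Tot.momentNorm_mk p).symm

theorem Tot.momentNorm_smul {n : ℕ} (g : G n) (m : Tot n) : (g • m).momentNorm = m.momentNorm := by
  obtain ⟨p, rfl⟩ := Tot.mk_surjective m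
  change (Tot.mk (g.1 • p.1, g.2 * p.2)).momentNorm = _
  rw [Tot.momentNorm_mk, Tot.momentNorm_mk, HP.momentNorm_SU_smul]

/-- The induced function on the orbit space. -/
def orbitMomentNorm (n : ℕ) : MulAction.orbitRel.Quotient (G n) (Tot n) → ℝ :=
  Quotient.lift Tot.momentNorm (by
    rintro m m' h
    obtain ⟨g, rfl⟩ := MulAction.orbitRel_apply.1 h
    exact Tot.momentNorm_smul g m')

theorem continuous_orbitMomentNorm (n : ℕ) : Continuous (orbitMomentNorm n) :=
  Tot.continuous_momentNorm.quotient_lift _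

/-- A curve in `HP^n` that meets every orbit of `SU(n+1) × S¹`. -/
def curvePt (n : ℕ) (t : ℝ) : HP n :=
  HP.ofVec (pairVec n (Real.cos (Real.pi * t / 4)) (Real.sin (Real.pi * t / 4)))

/-- A curve in `HP^n ×_{S¹} SU(2)` that meets every orbit of `SU(n+1) × SU(2)`. -/
def curve (n : ℕ) (t : ℝ) : Tot n := Tot.mk (curvePt n t, 1)

theorem contMDiff_curve {n : ℕ} (hn : 1 ≤ n) : ContMDiff 𝓘(ℝ, ℝ) (modelTot n) ∞ (curve n) := by
  refine Tot.contMDiff_mk_one.comp fun t => ?_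
  have h : ContDiff ℝ ∞ fun t : ℝ =>
      pairVec n (Real.cos (Real.pi * t / 4)) (Real.sin (Real.pi * t / 4)) := by
    have h1 : ∀ c s, pairVec n c s =
        c • (Pi.single 0 (quatMk 1 0 0 0) : Fin (n + 1) → ℍ) +
          s • (Pi.single 1 (quatMk 0 0 1 0) : Fin (n + 1) → ℍ) := by
      intro c s
      rw [pairVec, ← Pi.single_smul, ← Pi.single_smul]
      congr 2 <;> ext <;> simp
    simp only [h1]
    have hl : ContDiff ℝ ∞ fun t : ℝ => Real.pi * t / 4 := by fun_prop
    have hc : ContDiff ℝ ∞ fun t : ℝ => Real.cos (Real.pi * t / 4) := Real.contDiff_cos.comp hl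
    have hs : ContDiff ℝ ∞ fun t : ℝ => Real.sin (Real.pi * t / 4) := Real.contDiff_sin.comp hl
    exact (hc.smul contDiff_const).add (hs.smul contDiff_const)
  have h0 : pairVec n (Real.cos (Real.pi * t / 4)) (Real.sin (Real.pi * t / 4)) ≠ 0 :=
    pairVec_ne_zero hn (by rw [Real.cos_sq_add_sin_sq]; exact one_ne_zero)
  exact (contMDiffAt_ofVec h0).comp t h.contMDiff.contMDiffAt

theorem norm_quatMk_imI (a : ℝ) : ‖quatMk 0 a 0 0‖ = |a| := by
  rw [← Real.sqrt_mul_self (norm_nonneg _), ← Quaternion.normSq_eq_norm_mul_self,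
    Quaternion.normSq_def']
  simp [Real.sqrt_sq_eq_abs]

/-- The invariant is `|c² - s²|`, that is, the cosine of twice the angle `πt/4`. The angle runs from
`0`, where `s = 0`, to `π/4`, where `s = c`, and there the cosine is nonnegative and strictly
decreasing. -/
theorem momentNorm_curve {n : ℕ} (hn : 1 ≤ n) {t : ℝ} (h0 : 0 ≤ t) (h1 : t ≤ 1) :
    (curve n t).momentNorm = Real.cos (Real.pi * t / 2) := by
  have hp := Real.pi_pos
  have h : Real.cos (Real.pi * t / 4) ^ 2 + Real.sin (Real.pi * t / 4) ^ 2 = 1 :=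
    Real.cos_sq_add_sin_sq _
  rw [curve, Tot.momentNorm_mk]
  change (curvePt n t).momentNorm = _
  rw [curvePt, HP.momentNorm_ofVec (pairVec_ne_zero hn (by rw [h]; exact one_ne_zero)),
    moment_pairVec hn, vecNormSq_pairVec hn, h, div_one, norm_quatMk_imI, ← Real.cos_two_mul']
  have h2 : 2 * (Real.pi * t / 4) = Real.pi * t / 2 := by ring
  rw [h2]
  refine abs_of_nonneg (Real.cos_nonneg_of_neg_pi_div_two_le_of_le ?_ ?_) <;> nlinarith

theorem momentNorm_curve_injOn {n : ℕ} (hn : 1 ≤ n) {t t' : ℝ} (h0 : 0 ≤ t) (h1 : t ≤ 1)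
    (h0' : 0 ≤ t') (h1' : t' ≤ 1) (h : (curve n t).momentNorm = (curve n t').momentNorm) :
    t = t' := by
  have hp := Real.pi_pos
  rw [momentNorm_curve hn h0 h1, momentNorm_curve hn h0' h1'] at h
  have h2 := Real.injOn_cos (x₁ := Real.pi * t / 2) (x₂ := Real.pi * t' / 2)
    ⟨by positivity, by nlinarith⟩ ⟨by positivity, by nlinarith⟩ h
  have h3 : Real.pi * t = Real.pi * t' := by linarith
  exact mul_left_cancel₀ hp.ne' h3

theorem Tot.mk_circle_smul {n : ℕ} (z : Circle) (x : HP n) :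
    Tot.mk (z • x, (1 : SU 2)) = Tot.mk (x, torus z) := by
  refine Tot.mk_eq_iff.2 ⟨z, Prod.ext rfl ?_⟩
  exact mul_inv_cancel (torus z)

/-- The normal form needs `U(n+1)`, which acts through `SU(n+1)` and a circle element `z`. The
latter is moved to the other factor by `[zx, 1] = [x, torus z]` and absorbed by `SU(2)`. -/
theorem exists_smul_curve {n : ℕ} (hn : 1 ≤ n) (m : Tot n) :
    ∃ t : ℝ, 0 ≤ t ∧ t ≤ 1 ∧ ∃ g : G n, g • curve n t = m := by
  have hp := Real.pi_pos
  obtain ⟨⟨x, u⟩, rfl⟩ := Tot.mk_surjective m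
  obtain ⟨U, c, s, hs, hsc, h1, hx⟩ := exists_normal_form hn x
  obtain ⟨z, A, hzA⟩ := exists_circle_SU_smul U
  have hc1 : c ≤ 1 := by nlinarith
  -- From `s ≤ c` and `c² + s² = 1`; this bounds `arccos c` by `π/4`, so the parameter is at most
  -- `1`.
  have hc2 : Real.sqrt 2 / 2 ≤ c := by
    have h2 : (Real.sqrt 2) ^ 2 = 2 := Real.sq_sqrt (by norm_num)
    have h3 : 0 ≤ c := hs.trans hsc
    refine (sq_le_sq₀ (by positivity) h3).1 ?_
    rw [div_pow, h2]; nlinarith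
  refine ⟨4 * Real.arccos c / Real.pi, by have := Real.arccos_nonneg c; positivity, ?_,
    (A, u * torus z), ?_⟩
  · rw [div_le_one hp]
    linarith [Real.arccos_le_pi_div_four.2 hc2]
  · have e1 : Real.pi * (4 * Real.arccos c / Real.pi) / 4 = Real.arccos c := by field_simp
    have e2 : Real.sin (Real.arccos c) = s := by
      rw [Real.sin_arccos, ← h1, add_sub_cancel_left, Real.sqrt_sq hs]
    rw [curve, curvePt, e1, e2, Real.cos_arccos (by linarith [hs.trans hsc]) hc1]
    change Tot.mk (A • HP.ofVec (pairVec n c s), u * torus z * 1) = _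
    rw [hx, hzA, mul_one]
    have h2 : ∀ y : HP n, Tot.mk (y, u * torus z) = ((1, u) : G n) • Tot.mk (y, torus z) := by
      intro y
      change _ = Tot.mk ((1 : SU (n + 1)) • y, u * torus z)
      rw [one_smul]
    rw [h2, ← Tot.mk_circle_smul]
    change Tot.mk ((1 : SU (n + 1)) • z • A • HP.ofVec (pairVec n c s), u * 1) = _
    rw [one_smul, mul_one]

/-- The curve parametrizes the orbit space. -/
def orbitParam (n : ℕ) (t : unitInterval) : MulAction.orbitRel.Quotient (G n) (Tot n) :=
  Quotient.mk'' (curve n t)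

theorem orbitParam_bijective {n : ℕ} (hn : 1 ≤ n) : Function.Bijective (orbitParam n) := by
  constructor
  · intro t t' h
    have h1 := congrArg (orbitMomentNorm n) h
    exact Subtype.ext (momentNorm_curve_injOn hn t.2.1 t.2.2 t'.2.1 t'.2.2 h1)
  · intro q
    induction q using Quotient.inductionOn' with
    | h m =>
      obtain ⟨t, h0, h1, g, hg⟩ := exists_smul_curve hn m
      refine ⟨⟨t, h0, h1⟩, Quotient.sound' ?_⟩
      exact (MulAction.orbitRel (G n) (Tot n)).symm
        (MulAction.orbitRel_apply.2 ⟨g, hg⟩)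

/-- The curve meets every orbit and the invariant is injective along it, so the invariant separates
orbits. With the Hausdorff property the parametrization by the compact interval is a homeomorphism.
-/
theorem t2Space_orbitSpace {n : ℕ} (hn : 1 ≤ n) :
    T2Space (MulAction.orbitRel.Quotient (G n) (Tot n)) := by
  refine T2Space.of_injective_continuous (f := orbitMomentNorm n) ?_ (continuous_orbitMomentNorm n)
  intro q q' h
  obtain ⟨t, rfl⟩ := (orbitParam_bijective hn).2 q
  obtain ⟨t', rfl⟩ := (orbitParam_bijective hn).2 q'
  have : t = t' := Subtype.ext (momentNorm_curve_injOn hn t.2.1 t.2.2 t'.2.1 t'.2.2 h)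
  rw [this]

theorem exists_homeomorph_orbitSpace {n : ℕ} (hn : 1 ≤ n) :
    ∃ h : unitInterval ≃ₜ MulAction.orbitRel.Quotient (G n) (Tot n),
      ∀ t : unitInterval, h t = Quotient.mk'' (curve n t) := by
  have := t2Space_orbitSpace hn
  have hc : Continuous (Equiv.ofBijective _ (orbitParam_bijective hn)) :=
    continuous_quotient_mk'.comp ((contMDiff_curve hn).continuous.comp continuous_subtype_val)
  exact ⟨hc.homeoOfEquivCompactToT2, fun t => rfl⟩

theorem isCohomogeneityOne_Tot {n : ℕ} (hn : 1 ≤ n) :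
    IsCohomogeneityOne n (modelTot n) (Tot n) where
  compact_group := inferInstance
  isManifold := inferInstance
  boundaryless := inferInstance
  compact := inferInstance
  hausdorff := inferInstance
  connected := inferInstance
  smooth := smoothOnG_Tot
  almost_effective := finite_ineffective_kernel hn
  orbit_space := Or.inl ⟨(exists_homeomorph_orbitSpace hn).choose.symm⟩

/-! ### Isotropy groups -/

/-- Equality of classes with second component `1` forces `g.2` into the torus, and `g.1` has to act
on `x` as the same circle element. -/
theorem mem_stabilizer_mk_one {n : ℕ} {g : G n} {x : HP n} :
    g ∈ MulAction.stabilizer (G n) (Tot.mk (x, (1 : SU 2))) ↔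
      ∃ z : Circle, g.1 • x = z • x ∧ g.2 = (torus z)⁻¹ := by
  rw [MulAction.mem_stabilizer_iff]
  constructor
  · intro h
    obtain ⟨z, hz, hz'⟩ := exists_of_smul_mk_eq h
    rw [mul_one, one_mul] at hz'
    exact ⟨z, hz, hz'⟩
  · rintro ⟨z, hz, hz'⟩
    change Tot.mk (g.1 • x, g.2 * 1) = _
    refine Tot.mk_eq_iff.2 ⟨z, Prod.ext hz.symm ?_⟩
    change 1 * (torus z)⁻¹ = g.2 * 1
    rw [hz', one_mul, mul_one]

/-- Invariance of the line means `Bv = vq`. The entries `0` and `1` both determine `q`, and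
comparing the two gives the relations; the other entries of `v` are zero. -/
theorem entries_of_smul_pairVec_eq {n : ℕ} (hn : 1 ≤ n) {c s : ℝ} (hc : c ≠ 0) (hs : s ≠ 0)
    {B : Matrix.unitaryGroup (Fin (n + 1)) ℂ}
    (h : unitarySp n B • HP.ofVec (pairVec n c s) = HP.ofVec (pairVec n c s)) :
    B.1 1 1 = star (B.1 0 0) ∧ (c : ℂ) ^ 2 * B.1 1 0 = -(s : ℂ) ^ 2 * star (B.1 0 1) ∧
      ∀ i, i ≠ 0 → i ≠ 1 → B.1 i 0 = 0 ∧ B.1 i 1 = 0 := by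
  have hp : pairVec n c s ≠ 0 := pairVec_ne_zero hn (by positivity)
  rw [HP.Sp_smul_ofVec _ hp] at h
  obtain ⟨q, hq, h⟩ := (HP.ofVec_eq_iff (Sp.mulVec_ne_zero _ hp) hp).1 h
  have h' : ∀ i, quatMk (c * (B.1 i 0).re) (c * (B.1 i 0).im) (s * (B.1 i 1).re)
      (s * (B.1 i 1).im) = pairVec n c s i * q := fun i => by
    rw [← quatMat_mulVec_pairVec]; exact h i
  have h0 := h' 0
  have h1 := h' 1
  rw [pairVec_zero hn, Quaternion.ext_iff] at h0
  rw [pairVec_one hn, Quaternion.ext_iff] at h1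
  simp at h0 h1
  obtain ⟨a1, a2, a3, a4⟩ := h0
  obtain ⟨b1, b2, b3, b4⟩ := h1
  refine ⟨?_, ?_, fun i hi0 hi1 => ?_⟩
  · have a1' := a1.resolve_right hc
    have a2' := a2.resolve_right hc
    have b3' := b3.resolve_right hs
    refine Complex.ext (b3'.trans a1'.symm) ?_
    rw [Complex.star_def, Complex.conj_im, a2']
    exact mul_left_cancel₀ hs (by rw [b4, mul_neg])
  · refine Complex.ext ?_ ?_
    · simp only [sq, Complex.star_def, neg_mul, Complex.neg_re, ← Complex.ofReal_mul,
        Complex.re_ofReal_mul, Complex.conj_re]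
      linear_combination c * b1 + s * a3
    · simp only [sq, Complex.star_def, neg_mul, Complex.neg_im, ← Complex.ofReal_mul,
        Complex.im_ofReal_mul, Complex.conj_im]
      linear_combination c * b2 - s * a4
  · have h2 := h' i
    rw [pairVec_of_ne _ _ hi0 hi1, zero_mul, Quaternion.ext_iff] at h2
    simp [hc, hs] at h2
    exact ⟨Complex.ext h2.1 h2.2.1, Complex.ext h2.2.2.1 h2.2.2.2⟩

/-- The isotropy representation at a point of the curve off the singular orbits does not depend on
the point. -/
theorem smul_pairVec_eq {n : ℕ} (hn : 1 ≤ n) {c s c' s' : ℝ} (hs : 0 < s) (hsc : s < c)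
    (h1 : c' ^ 2 + s' ^ 2 ≠ 0) {B : Matrix.unitaryGroup (Fin (n + 1)) ℂ}
    (h : unitarySp n B • HP.ofVec (pairVec n c s) = HP.ofVec (pairVec n c s)) :
    unitarySp n B • HP.ofVec (pairVec n c' s') = HP.ofVec (pairVec n c' s') := by
  have hc : 0 < c := hs.trans hsc
  obtain ⟨h11, h10, hi⟩ := entries_of_smul_pairVec_eq hn hc.ne' hs.ne' h
  -- The inverse `B* = B⁻¹` fixes the same point and yields a second linear relation between `B₁₀`
  -- and the conjugate of `B₀₁`. As `c⁴ ≠ s⁴`, both off-diagonal entries vanish.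
  have h' : unitarySp n B⁻¹ • HP.ofVec (pairVec n c s) = HP.ofVec (pairVec n c s) := by
    rw [map_inv, inv_smul_eq_iff, h]
  obtain ⟨-, h10', -⟩ := entries_of_smul_pairVec_eq hn hc.ne' hs.ne' h'
  have e1 : (B⁻¹).1 1 0 = star (B.1 0 1) := rfl
  have e2 : (B⁻¹).1 0 1 = star (B.1 1 0) := rfl
  rw [e1, e2, star_star] at h10'
  have hne : (c : ℂ) ^ 4 - (s : ℂ) ^ 4 ≠ 0 := by
    have : s ^ 4 < c ^ 4 := pow_lt_pow_left₀ hsc hs.le (by norm_num)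
    exact_mod_cast (sub_pos.2 this).ne'
  have z10 : B.1 1 0 = 0 := by
    have h3 : ((c : ℂ) ^ 4 - (s : ℂ) ^ 4) * B.1 1 0 = 0 := by
      linear_combination (c : ℂ) ^ 2 * h10 - (s : ℂ) ^ 2 * h10'
    exact (mul_eq_zero.1 h3).resolve_left hne
  have z01 : B.1 0 1 = 0 := by
    rw [z10, mul_zero] at h10'
    exact star_eq_zero.1 ((mul_eq_zero.1 h10').resolve_left
      (pow_ne_zero 2 (by exact_mod_cast hc.ne')))
  have hp := pairVec_ne_zero hn h1
  -- The block is now `diag(a, ā)`. Since `āj = ja`, it multiplies `c' e₀ + s' e₁ j` by `a` on the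
  -- right, whatever `c'` and `s'` are.
  have key : ∀ i, (quatMat B.1 *ᵥ pairVec n c' s') i =
      pairVec n c' s' i * quatMk (B.1 0 0).re (B.1 0 0).im 0 0 := by
    intro i
    rw [quatMat_mulVec_pairVec]
    by_cases hi0 : i = 0
    · subst hi0
      rw [pairVec_zero hn, z01]
      ext <;> simp
    · by_cases hi1 : i = 1
      · subst hi1
        rw [pairVec_one hn, z10, h11]
        ext <;> simp
      · rw [pairVec_of_ne _ _ hi0 hi1, (hi i hi0 hi1).1, (hi i hi0 hi1).2]
        ext <;> simp
  rw [HP.Sp_smul_ofVec _ hp]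
  refine (HP.ofVec_eq_iff (Sp.mulVec_ne_zero _ hp) hp).2 ⟨_, fun h0 => ?_, key⟩
  refine Sp.mulVec_ne_zero (unitarySp n B) hp (funext fun i => (key i).trans ?_)
  rw [h0, mul_zero]; rfl

theorem SU_smul_eq_circle_smul_iff {n : ℕ} (A : SU (n + 1)) (z : Circle) (x : HP n) :
    A • x = z • x ↔
      unitarySp n ((circleUnitary (n + 1) (halfAngle z))⁻¹ * A.toUnitary) • x = x := by
  rw [SU.smul_eq_unitarySp, circle_smul_eq_unitarySp (halfAngle_mul_self z), map_mul, map_inv,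
    mul_smul, inv_smul_eq_iff]

theorem smul_curvePt_eq {n : ℕ} (hn : 1 ≤ n) {t : ℝ} (ht : t ∈ Ioo (0 : ℝ) 1) (t' : ℝ)
    {A : SU (n + 1)} {z : Circle} (h : A • curvePt n t = z • curvePt n t) :
    A • curvePt n t' = z • curvePt n t' := by
  have hp := Real.pi_pos
  rw [SU_smul_eq_circle_smul_iff] at h ⊢
  have h0 : 0 < Real.pi * t / 4 := by have := ht.1; positivity
  have h4 : Real.pi * t / 4 < Real.pi / 4 := by have := ht.2; nlinarith
  refine smul_pairVec_eq hn (Real.sin_pos_of_pos_of_lt_pi h0 (by linarith)) ?_ ?_ h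
  · rw [← Real.cos_pi_div_two_sub]
    exact Real.cos_lt_cos_of_nonneg_of_le_pi h0.le (by linarith) (by linarith)
  · rw [Real.cos_sq_add_sin_sq]; exact one_ne_zero

theorem stabilizer_curve_le {n : ℕ} (hn : 1 ≤ n) {t : ℝ} (ht : t ∈ Ioo (0 : ℝ) 1) (t' : ℝ) :
    MulAction.stabilizer (G n) (curve n t) ≤ MulAction.stabilizer (G n) (curve n t') := by
  intro g hg
  obtain ⟨z, hz, hz'⟩ := mem_stabilizer_mk_one.1 hg
  exact mem_stabilizer_mk_one.2 ⟨z, smul_curvePt_eq hn ht t' hz, hz'⟩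

/-! ### Non-primitivity -/

theorem stabilizer_mk_one_le {n : ℕ} (x : HP n) :
    MulAction.stabilizer (G n) (Tot.mk (x, (1 : SU 2))) ≤ (inclL n).range := by
  intro g hg
  obtain ⟨z, -, hz⟩ := mem_stabilizer_mk_one.1 hg
  refine ⟨(g.1, z⁻¹), Prod.ext rfl ?_⟩
  rw [hz, ← map_inv]; rfl

theorem continuous_torus : Continuous torus := by
  refine Continuous.subtype_mk (continuous_matrix fun i j => ?_) _
  have h : Continuous fun z : Circle => (z : ℂ) := by fun_prop
  fin_cases i <;> fin_cases j
  · exact h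
  · exact continuous_const
  · exact continuous_const
  · exact h.comp continuous_inv

theorem isClosed_range_inclL (n : ℕ) : IsClosed ((inclL n).range : Set (G n)) := by
  have hc : Continuous (inclL n) :=
    continuous_fst.prodMk (continuous_torus.comp continuous_snd)
  rw [MonoidHom.coe_range]
  exact (isCompact_range hc).isClosed

theorem range_inclL_ne_top (n : ℕ) : (inclL n).range ≠ ⊤ := by
  intro h
  obtain ⟨l, hl⟩ : ((1, sec 0 1) : G n) ∈ (inclL n).range := h ▸ Subgroup.mem_top _
  have h1 : torus l.2 = sec 0 1 := congrArg Prod.snd hl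
  have h2 := sec_other 0 1
  rw [zero_add, ← h1] at h2
  have h3 : (torus l.2).1 1 0 = 0 := rfl
  rw [h3] at h2
  exact div_ne_zero one_ne_zero (by exact_mod_cast (sqrt_pos 1).ne') h2.symm

theorem isNonPrimitiveVia_Tot {n : ℕ} (hn : 1 ≤ n) :
    IsNonPrimitiveVia (Γ := G n) (modelTot n) (Tot n) (inclL n).range := by
  -- Any interior parameter would do: interior isotropy groups are contained in all others along the
  -- curve, so they coincide.
  have hm : (1 / 2 : ℝ) ∈ Ioo (0 : ℝ) 1 := by norm_num
  exact ⟨isClosed_range_inclL n, range_inclL_ne_top n,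
    MulAction.stabilizer (G n) (curve n (1 / 2)), _, _,
    ⟨curve n, contMDiff_curve hn, exists_homeomorph_orbitSpace hn, rfl, rfl, fun t ht =>
      le_antisymm (stabilizer_curve_le hn ht _) (stabilizer_curve_le hn hm _)⟩,
    stabilizer_mk_one_le _, stabilizer_mk_one_le _⟩

/-! ### The induced space -/

theorem Ind.mk_eq_iff {n : ℕ} {p q : HP n × G n} :
    Ind.mk p = Ind.mk q ↔ ∃ l : L n, l • q = p :=
  Quotient.eq''.trans MulAction.orbitRel_apply

theorem Ind.mk_surjective {n : ℕ} : Function.Surjective (Ind.mk (n := n)) :=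
  Quotient.mk''_surjective

theorem SmoothOnG.continuous {n : ℕ} {E : Type*} [NormedAddCommGroup E] [NormedSpace ℝ E]
    {H : Type*} [TopologicalSpace H] {E' : Type*} [NormedAddCommGroup E'] [NormedSpace ℝ E']
    {H' : Type*} [TopologicalSpace H'] {I : ModelWithCorners ℝ E H} {I' : ModelWithCorners ℝ E' H'}
    {M N : Type*} [TopologicalSpace M] [ChartedSpace H M] [TopologicalSpace N] [ChartedSpace H' N]
    {f : G n → M → N} (hf : SmoothOnG I I' f) : Continuous fun p : G n × M => f p.1 p.2 := by
  refine continuous_iff_continuousAt.2 fun ⟨g, x⟩ => ?_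
  obtain ⟨F, hF, he⟩ := hf g x
  have hc : Continuous fun p : G n × M => (p.1.toMatPair, p.2) :=
    (continuous_toMatPair.comp continuous_fst).prodMk continuous_snd
  exact (ContinuousAt.comp (f := fun p : G n × M => (p.1.toMatPair, p.2)) (x := (g, x))
    hF.continuousAt hc.continuousAt).congr he

theorem SmoothOnG.comp {n : ℕ} {E : Type*} [NormedAddCommGroup E] [NormedSpace ℝ E]
    {H : Type*} [TopologicalSpace H] {E' : Type*} [NormedAddCommGroup E'] [NormedSpace ℝ E']
    {H' : Type*} [TopologicalSpace H'] {E'' : Type*} [NormedAddCommGroup E''] [NormedSpace ℝ E'']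
    {H'' : Type*} [TopologicalSpace H''] {I : ModelWithCorners ℝ E H}
    {I' : ModelWithCorners ℝ E' H'} {I'' : ModelWithCorners ℝ E'' H''}
    {M N P : Type*} [TopologicalSpace M] [ChartedSpace H M] [TopologicalSpace N] [ChartedSpace H' N]
    [TopologicalSpace P] [ChartedSpace H'' P]
    {f : G n → M → N} (hf : SmoothOnG I I' f) {φ : P → M} (hφ : ContMDiff I'' I ∞ φ) :
    SmoothOnG I'' I' fun g x => f g (φ x) := by
  intro g x
  obtain ⟨F, hF, he⟩ := hf g (φ x)
  refine ⟨fun p => F (p.1, φ p.2), ?_, ?_⟩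
  · exact ContMDiffAt.comp (f := fun p : MatPair n × P => (p.1, φ p.2)) (g.toMatPair, x) hF
      (contMDiffAt_fst.prodMk ((hφ x).comp (g.toMatPair, x) contMDiffAt_snd))
  · have hc : ContinuousAt (fun p : G n × P => (p.1, φ p.2)) (g, x) :=
      (continuous_fst.prodMk (hφ.continuous.comp continuous_snd)).continuousAt
    exact hc.eventually he

theorem SU.smul_mk_one {n : ℕ} (g : G n) (x : HP n) :
    g • Tot.mk (x, (1 : SU 2)) = Tot.mk (g.1 • x, g.2) := by
  change Tot.mk (g.1 • x, g.2 * 1) = _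
  rw [mul_one]

/-- The map `[x, (A, s)] ↦ [A x, s]`. -/
def Ind.toTot {n : ℕ} : Ind n → Tot n :=
  Quotient.lift (fun p : HP n × G n => Tot.mk (p.2.1 • p.1, p.2.2)) (by
    rintro p q h
    obtain ⟨l, rfl⟩ := MulAction.orbitRel_apply.1 h
    refine Tot.mk_eq_iff.2 ⟨l.2, Prod.ext ?_ rfl⟩
    change l.2 • q.2.1 • q.1 = (q.2.1 * l.1⁻¹) • l.2 • l.1 • q.1
    rw [mul_smul, ← SU.smul_circle_smul, ← SU.smul_circle_smul, inv_smul_smul,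
      SU.smul_circle_smul])

/-- The map `[y, s] ↦ [y, (1, s)]`. -/
def Tot.toInd {n : ℕ} : Tot n → Ind n :=
  Quotient.lift (fun p : HP n × SU 2 => Ind.mk (p.1, (1, p.2))) (by
    rintro p q h
    obtain ⟨z, rfl⟩ := MulAction.orbitRel_apply.1 h
    refine Ind.mk_eq_iff.2 ⟨(1, z), Prod.ext ?_ (Prod.ext ?_ rfl)⟩
    · change z • (1 : SU (n + 1)) • q.1 = z • q.1
      rw [one_smul]
    · change (1 : SU (n + 1)) * (1 : SU (n + 1))⁻¹ = 1
      rw [mul_inv_cancel])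

/-- The diffeomorphism `HP^n ×_L G ≅ HP^n ×_{S¹} SU(2)`. -/
def indHomeomorph (n : ℕ) : Ind n ≃ₜ Tot n where
  toFun := Ind.toTot
  invFun := Tot.toInd
  left_inv e := by
    obtain ⟨p, rfl⟩ := Ind.mk_surjective e
    change Ind.mk (p.2.1 • p.1, ((1, p.2.2) : G n)) = Ind.mk p
    -- The element `(A, 1)` of `L` carries `(x, (A, s))` to `(Ax, (1, s))`.
    refine Ind.mk_eq_iff.2 ⟨(p.2.1, 1), Prod.ext ?_ (Prod.ext ?_ ?_)⟩
    · change (1 : Circle) • p.2.1 • p.1 = _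
      rw [one_smul]
    · exact mul_inv_cancel _
    · change p.2.2 * (torus 1)⁻¹ = p.2.2
      rw [map_one, inv_one, mul_one]
  right_inv e := by
    obtain ⟨p, rfl⟩ := Tot.mk_surjective e
    change Tot.mk ((1 : SU (n + 1)) • p.1, p.2) = Tot.mk p
    rw [one_smul]
  continuous_toFun := by
    refine continuous_coinduced_dom.2 ?_
    have h := (smoothOnG_Tot (n := n)).comp Tot.contMDiff_mk_one |>.continuous
    refine (h.comp (continuous_snd.prodMk continuous_fst)).congr fun p => ?_
    exact SU.smul_mk_one p.2 p.1
  continuous_invFun := by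
    refine continuous_coinduced_dom.2 ?_
    have h : Continuous (Ind.mk (n := n)) := continuous_coinduced_rng
    exact h.comp (continuous_fst.prodMk (continuous_const.prodMk continuous_snd))

theorem indHomeomorph_mk {n : ℕ} (x : HP n) (g : G n) :
    indHomeomorph n (Ind.mk (x, g)) = Tot.mk (g.1 • x, g.2) := rfl

theorem indHomeomorph_smul {n : ℕ} (g : G n) (e : Ind n) :
    indHomeomorph n (g • e) = g • indHomeomorph n e := by
  obtain ⟨p, rfl⟩ := Ind.mk_surjective e
  change Tot.mk ((g.1 * p.2.1) • p.1, g.2 * p.2.2) = Tot.mk (g.1 • p.2.1 • p.1, g.2 * p.2.2)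
  rw [mul_smul]

/-! ### Smooth local sections -/

theorem contDiff_sec (k i j : Fin 2) : ContDiff ℝ ∞ fun ζ => (sec k ζ).1 i j := by
  have h0 : ∀ i, ContDiff ℝ ∞ fun ζ => (sec k ζ).1 i 0 := fun i => by
    simp only [sec_apply]; exact contDiff_unitCol k i
  have hs : ∀ i, ContDiff ℝ ∞ fun ζ => star ((sec k ζ).1 i 0) := fun i =>
    Complex.conjCLE.contDiff.comp (h0 i)
  fin_cases j
  · exact h0 i
  · fin_cases i
    · simpa [(SU2.entries _).1] using (hs 1).neg
    · simpa [(SU2.entries _).2] using hs 0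

/-- The `SU(n+1)` component is kept constantly `A`; only the fibre coordinate and the `SU(2)`
component vary, through the local section `sec k`. A constant circle element `u` adjusts the section
so that it passes through `p` itself. -/
theorem exists_smooth_section {n : ℕ} (p : HP n × G n) : ∃ σ : Tot n → HP n × G n,
    σ (indHomeomorph n (Ind.mk p)) = p ∧
    ContMDiffAt (modelTot n) (modelHP n) ∞ (fun e => (σ e).1) (indHomeomorph n (Ind.mk p)) ∧
    ContMDiffAt (modelTot n) 𝓘(ℝ, MatPair n) ∞ (fun e => (σ e).2.toMatPair)
      (indHomeomorph n (Ind.mk p)) ∧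
    ∀ᶠ e in 𝓝 (indHomeomorph n (Ind.mk p)), indHomeomorph n (Ind.mk (σ e)) = e := by
  obtain ⟨x, A, s⟩ := p
  rw [indHomeomorph_mk]
  obtain ⟨k, hk⟩ := SU2.exists_ne s
  have hm : Tot.mk (A • x, s) ∈ (Tot.triv k).source := (Tot.mem_triv_source k _).2 hk
  set u := phase (s.1 k 0) with hu
  have htriv : Tot.triv k (Tot.mk (A • x, s)) = (u • A • x, s.1 (k + 1) 0 / s.1 k 0) :=
    Tot.triv_mk (p := (A • x, s)) hk
  -- `sec k` returns the representative of the coset of `s` whose `k`-th entry is positive;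
  -- multiplication by the phase `u` of that entry restores `s`.
  have hsec : sec k (s.1 (k + 1) 0 / s.1 k 0) * torus u = s := by
    obtain ⟨z, hz⟩ := Tot.mk_eq_iff.1 (mk_sec_trivCoord k (A • x, s) hk)
    have h2 : s * (torus z)⁻¹ = sec k (s.1 (k + 1) 0 / s.1 k 0) := congrArg Prod.snd hz
    have h3 : phase ((s * (torus z)⁻¹).1 k 0) = 1 := by
      rw [h2, sec_self, phase_ofReal_pos (inv_pos.2 (sqrt_pos _))]
    rw [torus_inv_apply, phase_mul hk, ← hu, mul_inv_eq_one] at h3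
    rw [← h2, h3, inv_mul_cancel_right]
  have h1 := (Tot.contMDiffOn_triv k).contMDiffAt ((Tot.triv k).open_source.mem_nhds hm)
  refine ⟨fun e => (A⁻¹ • u⁻¹ • (Tot.triv k e).1, (A, sec k (Tot.triv k e).2 * torus u)),
    ?_, ?_, ?_, ?_⟩
  · simp only [htriv, inv_smul_smul, hsec]
  · have h2 : ∀ y : HP n, A⁻¹ • u⁻¹ • y =
        (unitarySp n (A⁻¹).toUnitary * circleSp n (halfAngle u⁻¹)) • y := fun y => by
      rw [mul_smul, ← circle_smul_eq_circleSp (halfAngle_mul_self _), SU.smul_eq_unitarySp]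
    simp only [h2]
    exact contMDiffAt_Sp_smul (f := fun _ => _) (fun i j => contMDiffAt_const)
      (contMDiff_fst.contMDiffAt.comp _ h1)
  · have hA : ContMDiffAt (modelTot n) 𝓘(ℝ, Fin (n + 1) → Fin (n + 1) → ℂ) ∞
        (fun _ : Tot n => fun i j => A.1 i j) (Tot.mk (A • x, s)) := contMDiffAt_const
    refine hA.prodMk_space ?_
    refine contMDiffAt_pi_space.2 fun i => contMDiffAt_pi_space.2 fun j => ?_
    have h2 : ContDiff ℝ ∞ fun ζ => (sec k ζ * torus u).1 i j := by
      have h3 : ∀ ζ, (sec k ζ * torus u).1 i j = ∑ l, (sec k ζ).1 i l * (torus u).1 l j :=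
        fun ζ => Matrix.mul_apply
      simp only [h3]
      exact ContDiff.sum fun l _ => (contDiff_sec k i l).mul contDiff_const
    exact h2.contMDiff.contMDiffAt.comp _ (contMDiff_snd.contMDiffAt.comp _ h1)
  · filter_upwards [(Tot.triv k).open_source.mem_nhds hm] with e he
    rw [indHomeomorph_mk, smul_inv_smul]
    have h2 : Tot.mk ((Tot.triv k e).1, sec k (Tot.triv k e).2) = e := (Tot.triv k).left_inv he
    conv_rhs => rw [← h2]
    refine Tot.mk_eq_iff.2 ⟨u⁻¹, Prod.ext rfl ?_⟩
    change sec k _ * (torus u⁻¹)⁻¹ = _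
    rw [map_inv, inv_inv]

/-- On representatives the map is `(x, g) ↦ g • [x, 1]`, which is smooth because the action is. -/
theorem smoothOnG_indHomeomorph {n : ℕ} : SmoothOnG (modelHP n) (modelTot n)
    (fun (g : G n) (x : HP n) => indHomeomorph n (Ind.mk (x, g))) := by
  have h := (smoothOnG_Tot (n := n)).comp Tot.contMDiff_mk_one
  simp only [SU.smul_mk_one] at h
  exact h

end CohomOne

end

/-- The smooth structure of the quotient `HP^n ×_L G` is the one that makes the projection from
`HP^n × G` a submersion. So the diffeomorphism claim reads: `Θ` is smooth on representatives, and
its inverse has smooth local lifts to `HP^n × G` through every point. -/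
theorem mainTheorem11 (n : ℕ) (hn : 1 ≤ n) :
    -- `HP^n ×_{S¹} SU(2) → S²` is the unique non-trivial linear `HP^n`-bundle over `S²`:
    (∃ B : LinearHPBundle n (modelTot n) (Tot n),
      B.proj = Tot.proj ∧
      (∀ e ∈ B.atlas, ∀ s : SU 2, hopf s ∈ e.baseSet → ∃ A : Sp n, ∀ x : HP n,
        e (Tot.mk (x, s)) = (hopf s, A • x)) ∧
      ¬ B.IsTrivial ∧
      ∀ (E : Type u) [NormedAddCommGroup E] [NormedSpace ℝ E] [FiniteDimensional ℝ E]
        (M : Type v) [TopologicalSpace M] [ChartedSpace E M] [IsManifold 𝓘(ℝ, E) ∞ M]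
        (B' : LinearHPBundle n 𝓘(ℝ, E) M), ¬ B'.IsTrivial → B.Isomorphic B') ∧
    -- the action of `G = SU(n+1) × SU(2)` on it is a non-primitive cohomogeneity one action,
    -- with `K₋, K₊ ⊆ L = SU(n+1) × S¹`:
    IsCohomogeneityOne n (modelTot n) (Tot n) ∧
    IsNonPrimitiveVia (Γ := G n) (modelTot n) (Tot n) (inclL n).range ∧
    -- it is induced from the action of `L` on `HP^n`: `HP^n ×_L G ≅ HP^n ×_{S¹} SU(2)`,
    -- `[x, (A, s)] ↦ [A x, s]`, compatibly with the smooth structures and the `G`-actions: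
    ∃ Θ : Ind n ≃ₜ Tot n,
      (∀ (x : HP n) (A : SU (n + 1)) (s : SU 2), Θ (Ind.mk (x, (A, s))) = Tot.mk (A • x, s)) ∧
      (∀ (g : G n) (e : Ind n), Θ (g • e) = g • Θ e) ∧
      SmoothOnG (modelHP n) (modelTot n) (fun (g : G n) (x : HP n) => Θ (Ind.mk (x, g))) ∧
      ∀ p : HP n × G n, ∃ σ : Tot n → HP n × G n,
        σ (Θ (Ind.mk p)) = p ∧
        ContMDiffAt (modelTot n) (modelHP n) ∞ (fun e => (σ e).1) (Θ (Ind.mk p)) ∧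
        ContMDiffAt (modelTot n) 𝓘(ℝ, MatPair n) ∞ (fun e => (σ e).2.toMatPair)
          (Θ (Ind.mk p)) ∧
        ∀ᶠ e in 𝓝 (Θ (Ind.mk p)), Θ (Ind.mk (σ e)) = e := by
  refine ⟨⟨totBundle n, rfl, ?_, not_isTrivial_totBundle hn, ?_⟩, ?_, ?_, ?_⟩
  · rintro _ ⟨k, rfl⟩ s hs
    exact Tot.exists_Sp_bundleTriv_mk ((hopf_mem_base k s).1 hs)
  · intro E _ _ _ M _ _ _ B' hB'
    exact B'.isTrivial_or_isomorphic hn |>.resolve_left hB'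
  · exact isCohomogeneityOne_Tot hn
  · exact isNonPrimitiveVia_Tot hn
  · exact ⟨indHomeomorph n, fun x A s => rfl, indHomeomorph_smul, smoothOnG_indHomeomorph,
      exists_smooth_section⟩
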